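/- **Setting.** Let $X$ be a locally compact Hausdorff space with countable base. A kernel $T$ on $X$ is a boundary kernel for an open set $U$ if $T(x,X\setminus\partial U)=0$ for $x\in U$ and $T(x,\cdot)=\varepsilon_x$ (Dirac measure) for $x\notin U$. Let $\mathcal V$ be a base of the topology consisting of relatively compact open sets, with a boundary kernel $H_V$ for every $V\in\mathcal V$. For open $U$ put $\mathcal V(U)=\{W\in\mathcal V:\overline W\subset U\}$. A local choice $\mathcal W$ from $\mathcal V$ in $U$ assigns to every $x\in U$ a fundamental system $\mathcal W(x)\subset\mathcal V(U)$ of neighborhoods of $x$; a lower semicontinuous $u:U\to[0,\infty]$ is positive $\mathcal W$-hyperharmonic if $H_Wu(x)\le u(x)$ for all $x\in U$, $W\in\mathcal W(x)$, and positive hyperharmonic if this holds with $\mathcal W(x)=\{W\in\mathcal V(U):x\in W\}$. A function $h$ is harmonic on $U$ if it is continuous and real on $U$ and $H_Vh=h$ on $V$ for all $V\in\mathcal V(U)$. The family $(H_V)_{V\in\mathcal V}$ is a *normal Bauer family of harmonic boundary kernels* if for every $V\in\mathcal V$: $H_WH_V=H_V$ for all $W\in\mathcal V$ with $W\subset V$;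 $H_V1=1$ and $H_Vf$ is continuous on $X$ for every continuous $f:X\to\mathbb R$; for some local choice $\mathcal W$ from $\mathcal V$ in $V$ the positive $\mathcal W$-hyperharmonic functions on $V$ separate the points of $V$; and $H_Vf$ is continuous on $V$ for every bounded Borel $f$. It is *elliptic* if every harmonic function $h\ge0$ on a connected open set is either identically zero or strictly positive there. These notions are used on any such space. Let $(H_V)_{V\in\mathcal V}$ be a normal Bauer family on $X$. An open set $U$ is a $\mathcal P$-set if the positive hyperharmonic functions on $U$ separate its points. A relatively compact open $U$ is regular if every $f\in\mathcal C(\partial U)$ has a unique continuous extension to $\overline U$ which is harmonic on $U$, and this extension is $\ge0$ if $f\ge0$; $H_U$ then denotes the corresponding boundary kernel. A compact $K\neq\emptyset$ is strongly stable if it is contained in a $\mathcal P$-set $W$ for which there is a strictly positive harmonic function on $W\setminus K$ tending to zero at $\partial K$. Fix a strongly stable compact $K$ and a regular $\mathcal P$-set $W_0\supset K$ such that $W_0\setminus K$ is regular and $g:=H_{W_0\setminus K}1_{\partial W_0}>0$ on $W_0\setminus K$. For $0<r<1$ let $$A_r=\{x\in W_0\setminus K: g(x)<r\},\qquad S_r=\{x\in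 W_0\setminus K:g(x)=r\}.$$ Let $X_0=\{x_0\}\cup(X\setminus K)$ be the space obtained by identifying $K$ with a point $x_0$ (quotient topology), $U_r=\{x_0\}\cup A_r$, and $$\mathcal V_0=\{U_r:0<r<1\}\cup\{V\in\mathcal V:\overline V\cap K=\emptyset\}.$$ Probability measures $\sigma_r$ on $S_r$, $0<r<1$, are *compatible* if $\sigma_rH_{A_t}=(r/t)\,\sigma_t$ on $S_t$ for all $0<r<t<1$, where $\sigma_rH_{A_t}=\int H_{A_t}(y,\cdot)\,d\sigma_r(y)$. A *darning* of $K$ with $(\sigma_r)$ is a normal Bauer family of harmonic boundary kernels on $X_0$, indexed by $\mathcal V_0$, which contains the given kernels $H_V$ for $V\in\mathcal V$ with $\overline V\cap K=\emptyset$ (regarded as kernels on $X_0$) and satisfies $H_{U_t}(x_0,\cdot)=\sigma_t$ for $0<t<1$. **Choices.** Let $\eta_0=1$ and let $(\eta_n)_{n\ge1}$ be a sequence in $(0,1)$ strictly decreasing to $0$. Let $\mathfrak C_0$ be the set of connected components of $W_0\setminus K$ and, for $n\ge1$, $\mathfrak C_n$ the set of connected components of $A_{\eta_n}$. For $V\in\bigcup_{n\ge0}\mathfrak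 C_n$ let $\alpha_V\in[0,1]$ be such that $$\sum_{V\in\mathfrak C_0}\alpha_V=1,\qquad \sum_{V'\in\mathfrak C_n,\,V'\subset V}\alpha_{V'}=\alpha_V\quad(n\ge1,\ V\in\mathfrak C_{n-1}),$$ and for $n\ge1$ let $\nu_n$ be a probability measure on $S_{\eta_n}$ with $\nu_n(V\cap S_{\eta_n})=\alpha_V$ for every $V\in\mathfrak C_{n-1}$. **Theorem.** All sets $A_r$, $0<r<1$, are regular. There is a subsequence $(\nu_{n_k})$ such that, for every $0<r<1$, the measures $$\sigma_{r,k}=(r/\eta_{n_k})\,(\nu_{n_k}H_{A_r})|_{S_r}\qquad(\eta_{n_k}<r)$$ converge weakly, as $k\to\infty$, to a probability measure $\sigma_r$ on $S_r$. For every such subsequence, the limits $\sigma_r$, $0<r<1$, have the following properties. 1. They are compatible. 2. $\sigma_r(V)=\alpha_V$ for all $n\ge0$, $V\in\mathfrak C_n$ and $0<r<\eta_n$. 3. A darning of $K$ with $(\sigma_r)$ exists; and if $(H_V)_{V\in\mathcal V}$ is elliptic and $\alpha_V>0$ for all $V\in\bigcup_{n\ge0}\mathfrak C_n$, then every darning of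 $K$ with $(\sigma_r)$ is elliptic on $X_0$. -/

import Mathlib

open Set Filter Topology MeasureTheory ProbabilityTheory
open scoped ENNReal

namespace Darning

section Harmonic

variable {X : Type*} [TopologicalSpace X] [MeasurableSpace X]

/-- `T` is a boundary kernel for `U`: it is carried by the boundary of `U` when started in `U`,
and it is the Dirac measure at the starting point outside of `U`. -/
def IsBoundaryKernel (U : Set X) (T : Kernel X X) : Prop :=
  (∀ x ∈ U, T x (frontier U)ᶜ = 0) ∧ ∀ x ∈ Uᶜ, T x = Measure.dirac x

/-- The members of `𝒱` whose closure is contained in `U`. -/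
def inside (𝒱 : Set (Set X)) (U : Set X) : Set (Set X) :=
  {W | W ∈ 𝒱 ∧ closure W ⊆ U}

/-- A local choice from `𝒱` in `U`: to every `x ∈ U` a fundamental system of neighborhoods of `x`
which are members of `𝒱` with closure in `U`. -/
def IsLocalChoice (𝒱 : Set (Set X)) (U : Set X) (𝒲 : X → Set (Set X)) : Prop :=
  ∀ x ∈ U, (∀ W ∈ 𝒲 x, W ∈ inside 𝒱 U ∧ x ∈ W) ∧ ∀ N ∈ 𝓝 x, ∃ W ∈ 𝒲 x, W ⊆ N

/-- Positive `𝒲`-hyperharmonic functions on `U`, with values in `[0, ∞]`. Only the values of `u`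
on `U` matter: for `x ∈ W` and `closure W ⊆ U`, the measure `H W x` is carried by
`frontier W ⊆ U`. -/
def IsPosHyperharmonicOn (H : Set X → Kernel X X) (𝒲 : X → Set (Set X)) (U : Set X)
    (u : X → ℝ≥0∞) : Prop :=
  LowerSemicontinuousOn u U ∧ ∀ x ∈ U, ∀ W ∈ 𝒲 x, ∫⁻ y, u y ∂(H W x) ≤ u x

/-- The positive `𝒲`-hyperharmonic functions on `U` separate the points of `U`. -/
def HyperharmonicSeparates (H : Set X → Kernel X X) (𝒲 : X → Set (Set X)) (U : Set X) : Prop :=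
  ∀ x ∈ U, ∀ y ∈ U, x ≠ y → ∃ u : X → ℝ≥0∞, IsPosHyperharmonicOn H 𝒲 U u ∧ u x ≠ u y

/-- `(H V)_{V ∈ 𝒱}` is a normal Bauer family of harmonic boundary kernels on `X`.
Only the kernels `H V` with `V ∈ 𝒱` matter. -/
structure IsNormalBauerFamily (𝒱 : Set (Set X)) (H : Set X → Kernel X X) : Prop where
  base : TopologicalSpace.IsTopologicalBasis 𝒱
  relCompact : ∀ V ∈ 𝒱, IsCompact (closure V)
  boundary : ∀ V ∈ 𝒱, IsBoundaryKernel V (H V)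
  /-- `H_W H_V = H_V` for `W ⊆ V`. -/
  comp : ∀ V ∈ 𝒱, ∀ W ∈ 𝒱, W ⊆ V → H V ∘ₖ H W = H V
  continuous : ∀ V ∈ 𝒱, ∀ f : X → ℝ, Continuous f → Continuous fun x => ∫ y, f y ∂(H V x)
  markov : ∀ V ∈ 𝒱, IsMarkovKernel (H V)
  separates : ∀ V ∈ 𝒱, ∃ 𝒲 : X → Set (Set X),
    IsLocalChoice 𝒱 V 𝒲 ∧ HyperharmonicSeparates H 𝒲 V
  strongFeller : ∀ V ∈ 𝒱, ∀ f : X → ℝ, Measurable f → (∃ C, ∀ x, |f x| ≤ C) →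
    ContinuousOn (fun x => ∫ y, f y ∂(H V x)) V

/-- `h` is harmonic on the open set `U` (only the values of `h` on `U` matter). -/
def IsHarmonicOn (𝒱 : Set (Set X)) (H : Set X → Kernel X X) (U : Set X) (h : X → ℝ) : Prop :=
  ContinuousOn h U ∧ ∀ V ∈ inside 𝒱 U, ∀ x ∈ V, ∫ y, h y ∂(H V x) = h x

/-- `U` is a `𝒫`-set: an open set whose points are separated by the positive hyperharmonic
functions on `U`. -/
def IsPSet (𝒱 : Set (Set X)) (H : Set X → Kernel X X) (U : Set X) : Prop :=
  IsOpen U ∧ HyperharmonicSeparates H (fun x => {W | W ∈ inside 𝒱 U ∧ x ∈ W}) U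

/-- `h` is a continuous extension of `f` from the boundary to the closure of `U` which is harmonic
on `U`. -/
def IsDirichletSolution (𝒱 : Set (Set X)) (H : Set X → Kernel X X) (U : Set X) (f h : X → ℝ) :
    Prop :=
  ContinuousOn h (closure U) ∧ EqOn h f (frontier U) ∧ IsHarmonicOn 𝒱 H U h

/-- Regular sets: relatively compact open sets for which the Dirichlet problem with continuous
boundary values is uniquely solvable, with positive solutions for positive boundary values. -/
def IsRegular (𝒱 : Set (Set X)) (H : Set X → Kernel X X) (U : Set X) : Prop :=
  IsOpen U ∧ IsCompact (closure U) ∧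
    ∀ f : X → ℝ, ContinuousOn f (frontier U) →
      ∃ h : X → ℝ, IsDirichletSolution 𝒱 H U f h ∧
        (∀ h' : X → ℝ, IsDirichletSolution 𝒱 H U f h' → EqOn h' h (closure U)) ∧
        ((∀ x ∈ frontier U, 0 ≤ f x) → ∀ x ∈ closure U, 0 ≤ h x)

/-- `T` is the boundary kernel for `U` given by solving the Dirichlet problem. -/
def IsHarmonicKernel (𝒱 : Set (Set X)) (H : Set X → Kernel X X) (U : Set X) (T : Kernel X X) :
    Prop :=
  IsBoundaryKernel U T ∧
    ∀ f h : X → ℝ, ContinuousOn f (frontier U) → IsDirichletSolution 𝒱 H U f h →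
      ∀ x ∈ U, ∫ y, f y ∂(T x) = h x

open Classical in
/-- The harmonic kernel `H_U` of a regular set `U` (the zero kernel if there is none). -/
noncomputable def harmonicKernel (𝒱 : Set (Set X)) (H : Set X → Kernel X X) (U : Set X) :
    Kernel X X :=
  if h : ∃ T : Kernel X X, IsHarmonicKernel 𝒱 H U T then h.choose else 0

/-- `K` is a strongly stable compact set. -/
def IsStronglyStable (𝒱 : Set (Set X)) (H : Set X → Kernel X X) (K : Set X) : Prop :=
  IsCompact K ∧ K.Nonempty ∧ ∃ W : Set X, IsPSet 𝒱 H W ∧ K ⊆ W ∧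
    ∃ h : X → ℝ, IsHarmonicOn 𝒱 H (W \ K) h ∧ (∀ x ∈ W \ K, 0 < h x) ∧
      ∀ z ∈ frontier K, Tendsto h (𝓝[W \ K] z) (𝓝 0)

/-- Ellipticity: every positive harmonic function on a connected open set is either identically
zero or strictly positive. -/
def IsElliptic (𝒱 : Set (Set X)) (H : Set X → Kernel X X) : Prop :=
  ∀ U : Set X, IsOpen U → IsConnected U → ∀ h : X → ℝ, IsHarmonicOn 𝒱 H U h →
    (∀ x ∈ U, 0 ≤ h x) → (∀ x ∈ U, h x = 0) ∨ ∀ x ∈ U, 0 < h x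

/-- The function `g = H_{W₀ \ K} 1_{∂W₀}`. -/
noncomputable def gauge (𝒱 : Set (Set X)) (H : Set X → Kernel X X) (K W₀ : Set X) (x : X) : ℝ :=
  (harmonicKernel 𝒱 H (W₀ \ K) x).real (frontier W₀)

/-- `A_r = {x ∈ W₀ \ K : g x < r}`. -/
def shell (𝒱 : Set (Set X)) (H : Set X → Kernel X X) (K W₀ : Set X) (r : ℝ) : Set X :=
  {x | x ∈ W₀ \ K ∧ gauge 𝒱 H K W₀ x < r}

/-- `S_r = {x ∈ W₀ \ K : g x = r}`. -/
def level (𝒱 : Set (Set X)) (H : Set X → Kernel X X) (K W₀ : Set X) (r : ℝ) : Set X :=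
  {x | x ∈ W₀ \ K ∧ gauge 𝒱 H K W₀ x = r}

/-- The set of connected components of a set. -/
def components (A : Set X) : Set (Set X) :=
  {C | ∃ x ∈ A, C = connectedComponentIn A x}

/-- `ℭ_0` is the set of components of `W₀ \ K`, and `ℭ_n`, `n ≥ 1`, is the set of components
of `A_{η n}`. -/
def compAt (𝒱 : Set (Set X)) (H : Set X → Kernel X X) (K W₀ : Set X) (η : ℕ → ℝ) :
    ℕ → Set (Set X)
  | 0 => components (W₀ \ K)
  | n + 1 => components (shell 𝒱 H K W₀ (η (n + 1)))

/-- `μ` is a probability measure on the set `S`. -/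
def IsProbabilityOn (S : Set X) (μ : Measure X) : Prop :=
  IsProbabilityMeasure μ ∧ μ Sᶜ = 0

/-- The measure `(r / s) (ν H_{A_r})|_{S_r}`. -/
noncomputable def sweep (𝒱 : Set (Set X)) (H : Set X → Kernel X X) (K W₀ : Set X) (s r : ℝ)
    (ν : Measure X) : Measure X :=
  ENNReal.ofReal (r / s) •
    (ν.bind (harmonicKernel 𝒱 H (shell 𝒱 H K W₀ r))).restrict (level 𝒱 H K W₀ r)

/-- `(σ r)_{0 < r < 1}` is the family of weak limits obtained along the subsequence `φ` of the
probability measures `(r / η n) (ν n H_{A_r})|_{S_r}`, which are considered for `η n < r`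
(hence for all but finitely many terms of the subsequence). -/
structure IsLimitFamily (𝒱 : Set (Set X)) (H : Set X → Kernel X X) (K W₀ : Set X) (η : ℕ → ℝ)
    (ν : ℕ → Measure X) (φ : ℕ → ℕ) (σ : ℝ → Measure X) : Prop where
  one_le : ∀ k, 1 ≤ φ k
  strictMono : StrictMono φ
  probability : ∀ r ∈ Ioo (0 : ℝ) 1, IsProbabilityOn (level 𝒱 H K W₀ r) (σ r)
  tendsto : ∀ r ∈ Ioo (0 : ℝ) 1, ∀ f : BoundedContinuousFunction X ℝ,
    Tendsto (fun k => ∫ x, f x ∂(sweep 𝒱 H K W₀ (η (φ k)) r (ν (φ k)))) atTop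
      (𝓝 (∫ x, f x ∂(σ r)))

/-- Compatibility: `σ_r H_{A_t} = (r / t) σ_t` on `S_t` for `0 < r < t < 1`. -/
def IsCompatible (𝒱 : Set (Set X)) (H : Set X → Kernel X X) (K W₀ : Set X) (σ : ℝ → Measure X) :
    Prop :=
  ∀ r t : ℝ, 0 < r → r < t → t < 1 →
    ((σ r).bind (harmonicKernel 𝒱 H (shell 𝒱 H K W₀ t))).restrict (level 𝒱 H K W₀ t) =
      (ENNReal.ofReal (r / t) • σ t).restrict (level 𝒱 H K W₀ t)

end Harmonic

section DarnedSpace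

/-- The space `X₀ = {x₀} ∪ (X \ K)`, where `none` is the point `x₀`. -/
def DarnedSpace {X : Type*} (K : Set X) : Type _ := Option {x : X // x ∉ K}

/-- The point `x₀`. -/
def center {X : Type*} (K : Set X) : DarnedSpace K := (none : Option {x : X // x ∉ K})

open Classical in
/-- The map `X → X₀` which collapses `K` to `x₀` and is the identity on `X \ K`. -/
noncomputable def collapse {X : Type*} (K : Set X) (x : X) : DarnedSpace K :=
  if h : x ∈ K then (none : Option {x : X // x ∉ K}) else (some ⟨x, h⟩ : Option {x : X // x ∉ K})

/-- The quotient topology: a set is open if and only if its preimage under the collapsing map is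
open. So (for closed `K`) the subspace `X₀ \ {x₀}` has the topology of `X \ K`, and the
neighborhoods of `x₀` are the sets `{x₀} ∪ (N \ K)`, `N` a neighborhood of `K`. -/
noncomputable instance {X : Type*} [TopologicalSpace X] (K : Set X) :
    TopologicalSpace (DarnedSpace K) :=
  TopologicalSpace.coinduced (collapse K) inferInstance

noncomputable instance {X : Type*} [TopologicalSpace X] (K : Set X) :
    MeasurableSpace (DarnedSpace K) :=
  borel _

instance {X : Type*} [TopologicalSpace X] (K : Set X) : BorelSpace (DarnedSpace K) :=
  ⟨rfl⟩

theorem continuous_collapse {X : Type*} [TopologicalSpace X] (K : Set X) :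
    Continuous (collapse K) :=
  continuous_coinduced_rng

theorem measurable_collapse {X : Type*} [TopologicalSpace X] [MeasurableSpace X] [BorelSpace X]
    (K : Set X) : Measurable (collapse K) :=
  (continuous_collapse K).measurable

variable {X : Type*} [TopologicalSpace X] [MeasurableSpace X]

/-- `U_r = {x₀} ∪ A_r`. -/
def darnedNhd (𝒱 : Set (Set X)) (H : Set X → Kernel X X) (K W₀ : Set X) (r : ℝ) :
    Set (DarnedSpace K) :=
  insert (center K) (collapse K '' shell 𝒱 H K W₀ r)

/-- `𝒱₀ = {U_r : 0 < r < 1} ∪ {V ∈ 𝒱 : closure V ∩ K = ∅}`. -/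
def darnedBase (𝒱 : Set (Set X)) (H : Set X → Kernel X X) (K W₀ : Set X) :
    Set (Set (DarnedSpace K)) :=
  {U | ∃ r ∈ Ioo (0 : ℝ) 1, U = darnedNhd 𝒱 H K W₀ r} ∪
    {U | ∃ V ∈ 𝒱, Disjoint (closure V) K ∧ U = collapse K '' V}

/-- `(H₀ V)_{V ∈ 𝒱₀}` is a normal Bauer family on `X₀` obtained by darning of `K` with `(σ r)`:
it contains the kernels `H V` for `V ∈ 𝒱` with `closure V ∩ K = ∅` (transported to `X₀`), and
`H_{U_t}(x₀, ·) = σ_t` for `0 < t < 1`. -/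
structure IsDarning (𝒱 : Set (Set X)) (H : Set X → Kernel X X) (K W₀ : Set X)
    (σ : ℝ → Measure X) (H₀ : Set (DarnedSpace K) → Kernel (DarnedSpace K) (DarnedSpace K)) :
    Prop where
  bauer : IsNormalBauerFamily (darnedBase 𝒱 H K W₀) H₀
  away : ∀ V ∈ 𝒱, Disjoint (closure V) K →
    ∀ y : X, H₀ (collapse K '' V) (collapse K y) = (H V y).map (collapse K)
  atCenter : ∀ t ∈ Ioo (0 : ℝ) 1,
    H₀ (darnedNhd 𝒱 H K W₀ t) (center K) = (σ t).map (collapse K)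

end DarnedSpace

end Darning

set_option linter.unusedSectionVars false

namespace Darning

/-! ### Measurability of functions that are semicontinuous on a carrier of the measure. -/

section Semicontinuity

variable {X : Type*} [TopologicalSpace X] [MeasurableSpace X] [BorelSpace X]

/-! Everything is governed by one continuous function `G` on `X`: the gauge on `W₀ \ K`, continued
by `0` on `K` and by `1` off `W₀`. The shell `A_r` is `{0 < G < r}`, and its boundary lies in `{G =
0} ∪ {G = r}`, where `G` and `r - G` are barriers. Perron's method (`isRegular_of_barrier`), which
rests on a minimum principle for sets whose points are separated by hyperharmonic functions,
therefore shows that `A_r` is regular.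

Solving the Dirichlet problem for `G` gives `H_{A_t} 1_{S_t} = G / t` on `{G ≤ t}` (`sweepFun_one`).
So `t / s` is exactly the factor turning the part on `S_t` of `ν H_{A_t}`, with `ν` a probability
measure on `S_s`, into a probability measure. Sweeping is also transitive: `H_{A_t} f`, cut off at
`K`, is harmonic on every smaller shell and vanishes on `K`, hence is reproduced by `H_{A_r}`
(`sweepFun_sweepFun`). It thus suffices to extract convergence on the countably many compact levels
`S_{η m}`; since sweeping preserves continuity, convergence spreads to all levels. Passing to the
limit in transitivity yields compatibility.

For the masses, `X` is locally connected (`locallyConnectedSpace`), so components of open sets are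
open, and harmonic measures do not charge pieces separated from the starting point
(`null_of_clopen`). Consequently `1_V G` is harmonic on `A_r` for a component `V` of a larger shell,
and integrating it against the swept measures shows that the mass of `V` never changes. The
additivity of the weights says that all later `ν n` give `V` the mass `α V` (`nu_apply`), and so do
the limits.

The darning is built on `X` before collapsing: `darnKernel` runs `H_{A_t}` and restarts with `σ_t`
whenever `K` is hit. Applied to `f` it solves the Dirichlet problem with `f` on the outer boundary
and the constant `∫ f dσ_t` on `K`. Compatibility says that this solution has `σ_s`-mean equal to
its value on `K`, which is what consistency of the kernels requires. Continuity at `x₀` comes from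
the bound by a multiple of `G`, and separation of points from `t - G` and a truncation of
hyperharmonic functions on `W₀`. The axioms then pass to the quotient along `collapse K`.

For ellipticity, the zero set of a harmonic `h ≥ 0` is closed in its domain and has to be shown
open. Off `K` this is ellipticity of the given family. If `h x₀ = 0`, then `h` vanishes `σ_t`-almost
everywhere; since `σ_t` charges every component of a small shell, `h` has a zero in each component
and vanishes around `x₀`. -/

theorem restrict_eq_self_of_compl_null {μ : Measure X} {M : Set X} (h : μ Mᶜ = 0) :
    μ.restrict M = μ :=
  Measure.restrict_eq_self_of_ae_mem (by rwa [← mem_ae_iff] at h)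

theorem aemeasurable_of_lowerSemicontinuousOn {β : Type*} [LinearOrder β] [TopologicalSpace β]
    [OrderTopology β] [SecondCountableTopology β] [MeasurableSpace β] [BorelSpace β]
    {μ : Measure X} {M : Set X} (hM : MeasurableSet M) (h : μ Mᶜ = 0) {u : X → β}
    (hu : LowerSemicontinuousOn u M) : AEMeasurable u μ := by
  rw [← restrict_eq_self_of_compl_null h]
  exact aemeasurable_restrict_of_measurable_subtype hM
    (lowerSemicontinuous_restrict_iff.2 hu).measurable

theorem integrable_of_bounded {μ : Measure X} [IsFiniteMeasure μ] {f : X → ℝ}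
    (hf : Measurable f) {C : ℝ} (hC : ∀ x, |f x| ≤ C) : Integrable f μ :=
  .of_bound hf.aestronglyMeasurable C (.of_forall hC)

end Semicontinuity

/-! ### Absorbing sets and the minimum principle. -/

section Potential

variable {X : Type*} [TopologicalSpace X] [T2Space X]
    [SecondCountableTopology X] [MeasurableSpace X] [BorelSpace X]
    {𝒱 : Set (Set X)} {H : Set X → Kernel X X} {𝒲 : X → Set (Set X)} {P : Set X}

/-- The value at the starting point of a Markov boundary kernel is never charged. -/
theorem IsNormalBauerFamily.apply_singleton_ne (hH : IsNormalBauerFamily 𝒱 H) {V : Set X}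
    (hV : V ∈ 𝒱) {x : X} (hx : x ∈ V) : H V x {x}ᶜ ≠ 0 := by
  have hVo : IsOpen V := hH.base.isOpen hV
  have := hH.markov V hV
  have h1 := (hH.boundary V hV).1 x hx
  intro h
  have h2 : H V x univ ≤ H V x (frontier V)ᶜ + H V x {x}ᶜ := by
    refine (measure_mono ?_).trans (measure_union_le _ _)
    intro y _
    by_cases hy : y = x
    · subst hy
      left
      rw [hVo.frontier_eq]
      exact fun h => h.2 hx
    · exact Or.inr hy
  rw [h1, h, measure_univ] at h2
  simp at h2

/-- There is no nonempty compact absorbing set in a set where hyperharmonic functions separate. -/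
theorem absorbing_eq_empty (hH : IsNormalBauerFamily 𝒱 H) (hc : IsLocalChoice 𝒱 P 𝒲)
    (hs : HyperharmonicSeparates H 𝒲 P) {F : Set X} (hF : IsCompact F) (hFP : F ⊆ P)
    (h : ∀ x ∈ F, ∃ N ∈ 𝓝 x, ∀ W ∈ 𝒲 x, W ⊆ N → H W x Fᶜ = 0) : F = ∅ := by
  by_contra hne
  rw [← ne_eq, ← nonempty_iff_ne_empty] at hne
  -- A single neighborhood `w x` is fixed for each point, so that being absorbing is a condition on
  -- one measure per point and survives intersections of chains.
  have hw : ∀ x ∈ F, ∃ W ∈ 𝒲 x, H W x Fᶜ = 0 := by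
    intro x hx
    obtain ⟨N, hN, hNW⟩ := h x hx
    obtain ⟨W, hW, hWN⟩ := (hc x (hFP hx)).2 N hN
    exact ⟨W, hW, hNW W hW hWN⟩
  choose! w hw hw0 using hw
  let S : Set (Set X) := {A | A ⊆ F ∧ IsClosed A ∧ A.Nonempty ∧ ∀ x ∈ A, H (w x) x Aᶜ = 0}
  obtain ⟨M, -, hMin⟩ := zorn_superset_nonempty S (by
    intro c hcS hchain hcne
    refine ⟨⋂₀ c, ⟨?_, ?_, ?_, ?_⟩, fun s hs => sInter_subset_of_mem hs⟩
    · obtain ⟨A, hA⟩ := hcne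
      exact (sInter_subset_of_mem hA).trans (hcS hA).1
    · exact isClosed_sInter fun A hA => (hcS hA).2.1
    · have : Nonempty c := hcne.to_subtype
      rw [sInter_eq_iInter]
      refine IsCompact.nonempty_iInter_of_directed_nonempty_isCompact_isClosed _ ?_
        (fun A => (hcS A.2).2.2.1) (fun A => hF.of_isClosed_subset (hcS A.2).2.1 (hcS A.2).1)
        fun A => (hcS A.2).2.1
      intro A B
      rcases hchain.total A.2 B.2 with h | h
      · exact ⟨A, subset_rfl, h⟩
      · exact ⟨B, h, subset_rfl⟩
    · intro x hx
      rw [compl_sInter]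
      -- By Lindelöf the complement of the intersection is already a countable union of null sets.
      obtain ⟨T, hTc, hT, hTe⟩ := TopologicalSpace.isOpen_sUnion_countable (compl '' c) (by
        rintro _ ⟨A, hA, rfl⟩
        exact (hcS hA).2.1.isOpen_compl)
      rw [← hTe, measure_sUnion_null_iff hTc]
      intro B hB
      obtain ⟨A, hA, rfl⟩ := hT hB
      exact (hcS hA).2.2.2 x (hx A hA)) F ⟨subset_rfl, hF.isClosed, hne, hw0⟩
  obtain ⟨hMF, hMcl, hMne, hMH⟩ := hMin.prop
  have hMc : IsCompact M := hF.of_isClosed_subset hMcl hMF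
  -- Where `u` attains its minimum over `M`, the mean inequality forces the measure to live on the
  -- minimum set; that set is again absorbing, hence all of `M` by minimality.
  have hconst : ∀ u : X → ℝ≥0∞, IsPosHyperharmonicOn H 𝒲 P u → ∀ x ∈ M, ∀ y ∈ M, u x = u y := by
    intro u hu
    have huM : LowerSemicontinuousOn u M := hu.1.mono (hMF.trans hFP)
    obtain ⟨a, haM, ha⟩ := huM.exists_isMinOn hMne hMc
    have hAc : IsCompact (M ∩ u ⁻¹' Iic (u a)) := huM.isCompact_inter_preimage_Iic hMc _
    have hAS : M ∩ u ⁻¹' Iic (u a) ∈ S := by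
      refine ⟨inter_subset_left.trans hMF, hAc.isClosed, ⟨a, haM, mem_preimage.2 (mem_Iic.2 le_rfl)⟩, ?_⟩
      rintro x ⟨hxM, hxa⟩
      have hWx := hw x (hMF hxM)
      have hWV := ((hc x (hFP (hMF hxM))).1 _ hWx).1.1
      have := hH.markov _ hWV
      have h1 : ∫⁻ y, u y ∂(H (w x) x) ≤ u a := (hu.2 x (hFP (hMF hxM)) _ hWx).trans hxa
      have hM0 := hMH x hxM
      have haeM : ∀ᵐ y ∂(H (w x) x), y ∈ M := by rwa [← mem_ae_iff] at hM0
      rcases eq_or_ne (u a) ⊤ with htop | htop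
      · rw [htop]
        simpa using hM0
      · have := ae_eq_of_ae_le_of_lintegral_le (f := fun _ => u a) (g := u) (μ := H (w x) x)
          (haeM.mono fun y hy => ha hy) (by simpa using htop)
          (aemeasurable_of_lowerSemicontinuousOn hMcl.measurableSet hM0 huM) (by simpa using h1)
        rw [← mem_ae_iff]
        filter_upwards [haeM, this] with y hy hy'
        exact ⟨hy, hy'.symm.le⟩
    have hsub := hMin.le_of_le hAS inter_subset_left
    have : ∀ x ∈ M, u x = u a := fun x hx => le_antisymm (hsub hx).2 (ha hx)
    intro x hx y hy
    rw [this x hx, this y hy]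
  obtain ⟨x, hx⟩ := hMne
  have hsing : M = {x} := by
    refine (subset_singleton_iff.2 fun y hy => ?_).antisymm (singleton_subset_iff.2 hx)
    by_contra hyx
    obtain ⟨u, hu, hne⟩ := hs y (hFP (hMF hy)) x (hFP (hMF hx)) hyx
    exact hne (hconst u hu y hy x hx)
  have hW := (hc x (hFP (hMF hx))).1 _ (hw x (hMF hx))
  have := hMH x hx
  rw [hsing] at this
  exact hH.apply_singleton_ne hW.1.1 hW.2 this

/-- Minimum principle. -/
theorem min_principle (hH : IsNormalBauerFamily 𝒱 H) (hc : IsLocalChoice 𝒱 P 𝒲)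
    (hs : HyperharmonicSeparates H 𝒲 P) {Y O : Set X} (hY : IsCompact Y) (hO : O ⊆ P)
    {u : X → ℝ} (hu : LowerSemicontinuousOn u Y) {C : ℝ} (hC : ∀ y ∈ Y, u y ≤ C)
    (hb : ∀ y ∈ Y, y ∉ O → 0 ≤ u y)
    (hloc : ∀ x ∈ Y, x ∈ O → ∃ N ∈ 𝓝 x, ∀ W ∈ 𝒲 x, W ⊆ N →
      H W x Yᶜ = 0 ∧ ∫ y, u y ∂(H W x) ≤ u x) : ∀ y ∈ Y, 0 ≤ u y := by
  intro y hy
  by_contra! hneg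
  obtain ⟨a, haY, ha⟩ := hu.exists_isMinOn ⟨y, hy⟩ hY
  have ha0 : u a < 0 := (ha hy).trans_lt hneg
  have hFO : ∀ x ∈ Y ∩ u ⁻¹' Iic (u a), x ∈ O := fun x hx => by
    by_contra hxO
    exact absurd (hb x hx.1 hxO) (not_le.2 (lt_of_le_of_lt hx.2 ha0))
  have := absorbing_eq_empty hH hc hs (hu.isCompact_inter_preimage_Iic hY (u a))
    (fun x hx => hO (hFO x hx)) (by
      intro x hx
      obtain ⟨N, hN, h⟩ := hloc x hx.1 (hFO x hx)
      refine ⟨N, hN, fun W hW hWN => ?_⟩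
      obtain ⟨h0, h1⟩ := h W hW hWN
      have hWV := ((hc x (hO (hFO x hx))).1 _ hW).1.1
      have := hH.markov _ hWV
      have haeM : ∀ᵐ y ∂(H W x), y ∈ Y := by rwa [← mem_ae_iff] at h0
      have hm : AEMeasurable u (H W x) :=
        aemeasurable_of_lowerSemicontinuousOn hY.isClosed.measurableSet h0 hu
      -- Lower semicontinuity bounds `u` only from below; the constant `C` supplies the upper bound.
      have hint : Integrable u (H W x) := by
        refine .of_bound hm.aestronglyMeasurable (max |C| |u a|) (haeM.mono fun y hy => ?_)
        rw [Real.norm_eq_abs]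
        exact abs_le_max_abs_abs (ha hy) (hC y hy) |>.trans (max_comm _ _).le
      have hint' : Integrable (fun y => u y - u a) (H W x) := hint.sub (integrable_const _)
      have hnn : 0 ≤ᵐ[H W x] fun y => u y - u a := haeM.mono fun y hy => sub_nonneg.2 (ha hy)
      have h2 : ∫ y, (u y - u a) ∂(H W x) = 0 := by
        refine le_antisymm ?_ (integral_nonneg_of_ae hnn)
        rw [integral_sub hint (integrable_const _)]
        simp only [integral_const, probReal_univ, one_smul]
        linarith [h1, show u x ≤ u a from hx.2]
      have h3 := (integral_eq_zero_iff_of_nonneg_ae hnn hint').1 h2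
      rw [← mem_ae_iff]
      filter_upwards [haeM, h3] with y hy hy'
      exact ⟨hy, (sub_eq_zero.1 hy').le⟩)
  exact absurd (this ▸ (⟨haY, mem_preimage.2 (mem_Iic.2 le_rfl)⟩ : a ∈ Y ∩ u ⁻¹' Iic (u a)) : a ∈ (∅ : Set X)) (by simp)

end Potential
end Darning

namespace Darning

/-! ### From local to global mean value inequalities. -/

section LocalToGlobal

variable {X : Type*} [TopologicalSpace X] [T2Space X] [LocallyCompactSpace X]
    [SecondCountableTopology X] [MeasurableSpace X] [BorelSpace X]
    {𝒱 : Set (Set X)} {H : Set X → Kernel X X}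

theorem exists_bump {x : X} {N : Set X} (hN : N ∈ 𝓝 x) :
    ∃ φ : X → ℝ, Continuous φ ∧ φ x = 1 ∧ (∀ y, 0 ≤ φ y) ∧ (∀ y, φ y ≤ 1) ∧
      ∀ y, y ∉ N → φ y = 0 := by
  obtain ⟨f, hf1, hf2, hf3⟩ := exists_continuousMap_one_of_isCompact_subset_isOpen
    (isCompact_singleton (x := x)) isOpen_interior
    (singleton_subset_iff.2 (mem_interior_iff_mem_nhds.2 hN))
  refine ⟨f, f.continuous, hf1 rfl, fun y => (hf3.2 y).1, fun y => (hf3.2 y).2, fun y hy => ?_⟩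
  exact image_eq_zero_of_notMem_tsupport fun h => hy (interior_subset (hf3.1 h))

theorem IsNormalBauerFamily.integral_of_notMem (hH : IsNormalBauerFamily 𝒱 H) {V : Set X}
    (hV : V ∈ 𝒱) {x : X} (hx : x ∉ V) (f : X → ℝ) : ∫ y, f y ∂(H V x) = f x := by
  rw [(hH.boundary V hV).2 x hx, integral_dirac]

/-- The kernels preserve lower semicontinuity. -/
theorem IsNormalBauerFamily.lowerSemicontinuous_integral (hH : IsNormalBauerFamily 𝒱 H)
    {V : Set X} (hV : V ∈ 𝒱) {v : X → ℝ} (hv : LowerSemicontinuous v) (h0 : ∀ x, 0 ≤ v x) {C : ℝ}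
    (hC : ∀ x, v x ≤ C) : LowerSemicontinuous fun x => ∫ y, v y ∂(H V x) := by
  have hbd : ∀ x, |v x| ≤ C := fun x => by rw [abs_of_nonneg (h0 x)]; exact hC x
  intro z
  by_cases hz : z ∈ V
  · exact ((hH.strongFeller V hV v hv.measurable ⟨C, hbd⟩).continuousAt
      ((hH.base.isOpen hV).mem_nhds hz)).lowerSemicontinuousAt
  · intro a ha
    replace ha : a < v z := by simpa only [gt_iff_lt, hH.integral_of_notMem hV hz] using ha
    show ∀ᶠ x in 𝓝 z, a < ∫ y, v y ∂(H V x)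
    rcases lt_or_ge a 0 with ha0 | ha0
    · exact .of_forall fun x => ha0.trans_le (integral_nonneg h0)
    -- Off `V` there is no smoothing, but `c * φ` is a continuous minorant of `v` with value `c > a`
    -- at `z`, and its image under the kernel is continuous.
    · obtain ⟨c, hac, hcv⟩ := exists_between ha
      obtain ⟨φ, hφ, hφz, hφ0, hφ1, hφN⟩ := exists_bump (hv z c hcv)
      have hcont := (hH.continuous V hV φ hφ).const_mul c
      have : a < c * ∫ y, φ y ∂(H V z) := by
        rw [hH.integral_of_notMem hV hz, hφz, mul_one]; exact hac
      filter_upwards [hcont.continuousAt.eventually (lt_mem_nhds this)] with x hx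
      refine lt_of_lt_of_le hx ?_
      have := hH.markov V hV
      rw [← integral_const_mul]
      refine integral_mono ?_ (integrable_of_bounded hv.measurable hbd) ?_
      · exact (integrable_of_bounded hφ.measurable
          (fun x => by rw [abs_of_nonneg (hφ0 x)]; exact hφ1 x)).const_mul c
      · intro y
        by_cases hy : y ∈ {y | c < v y}
        · exact (mul_le_of_le_one_right (ha0.trans hac.le) (hφ1 y)).trans (le_of_lt hy)
        · simp only [hφN y hy, mul_zero, h0 y]

/-- A bounded lower semicontinuous function is a limit of smaller continuous functions. -/
theorem exists_seq_continuous_tendsto {v : X → ℝ} (hv : LowerSemicontinuous v)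
    (h0 : ∀ x, 0 ≤ v x) :
    ∃ φ : ℕ → X → ℝ, (∀ n, Continuous (φ n)) ∧ (∀ n x, 0 ≤ φ n x) ∧ (∀ n x, φ n x ≤ v x) ∧
      ∀ x, Tendsto (fun n => φ n x) atTop (𝓝 (v x)) := by
  let := TopologicalSpace.metrizableSpaceMetric X
  -- Inf-convolution with `n * dist`: an `n`-Lipschitz minorant. Points at distance at least `δ`
  -- cost `n * δ`, so for large `n` only points near `x` matter.
  let φ : ℕ → X → ℝ := fun n x => ⨅ y, (v y + n * dist x y)
  have hnn : ∀ (n : ℕ) x y, 0 ≤ v y + n * dist x y := fun n x y =>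
    add_nonneg (h0 y) (by positivity)
  have hbdd : ∀ (n : ℕ) x, BddBelow (range fun y => v y + n * dist x y) := fun (n : ℕ) x =>
    ⟨0, by rintro _ ⟨y, rfl⟩; exact hnn n x y⟩
  have hle : ∀ n x, φ n x ≤ v x := fun n x => (ciInf_le (hbdd n x) x).trans (by simp)
  refine ⟨φ, fun n => ?_, fun n x => Real.iInf_nonneg fun y => hnn n x y, hle, fun x => ?_⟩
  · refine (LipschitzWith.of_le_add_mul (K := n) fun x x' => ?_).continuous
    have : Nonempty X := ⟨x⟩
    rw [← sub_le_iff_le_add]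
    refine le_ciInf fun y => ?_
    rw [sub_le_iff_le_add]
    refine (ciInf_le (hbdd n x) y).trans ?_
    have h1 : (n : ℝ) * dist x y ≤ n * (dist x x' + dist x' y) := by
      gcongr; exact dist_triangle _ _ _
    simp only [NNReal.coe_natCast]
    linarith
  · have : Nonempty X := ⟨x⟩
    refine tendsto_order.2 ⟨fun a ha => ?_, fun a ha => .of_forall fun n => (hle n x).trans_lt ha⟩
    obtain ⟨c, hac, hcv⟩ := exists_between ha
    obtain ⟨δ, hδ, hball⟩ := Metric.eventually_nhds_iff.1 (hv x c hcv)
    obtain ⟨m, hm⟩ := exists_nat_gt (c / δ)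
    filter_upwards [eventually_ge_atTop m] with n hn
    refine hac.trans_le (le_ciInf fun y => ?_)
    rcases lt_or_ge (dist y x) δ with hy | hy
    · exact (hball hy).le.trans (le_add_of_nonneg_right (by positivity))
    · rw [dist_comm] at hy
      have h1 : c ≤ m * δ := ((div_lt_iff₀ hδ).1 hm).le
      have h2 : (m : ℝ) * δ ≤ n * dist x y := by gcongr
      linarith [h0 y]

/-- `v` is hyperharmonic in a neighborhood of every point of `U`. -/
def IsLocallyHyperharmonic (𝒱 : Set (Set X)) (H : Set X → Kernel X X) (U : Set X) (v : X → ℝ) :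
    Prop :=
  ∀ x ∈ U, ∃ N ∈ 𝓝 x, ∀ W ∈ 𝒱, x ∈ W → W ⊆ N → ∫ y, v y ∂(H W x) ≤ v x

theorem IsNormalBauerFamily.comp_apply (hH : IsNormalBauerFamily 𝒱 H) {V W : Set X} (hV : V ∈ 𝒱)
    (hW : W ∈ 𝒱) (hWV : W ⊆ V) (x : X) {f : X → ℝ} (hf : Measurable f) {C : ℝ}
    (hC : ∀ x, |f x| ≤ C) : ∫ z, ∫ y, f y ∂(H V z) ∂(H W x) = ∫ y, f y ∂(H V x) := by
  have := hH.markov V hV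
  have := hH.markov W hW
  conv_rhs => rw [← hH.comp V hV W hW hWV]
  rw [Kernel.integral_comp]
  rw [hH.comp V hV W hW hWV]
  exact integrable_of_bounded hf hC

theorem measurable_integral_kernel {Y : Type*} [MeasurableSpace Y] (κ : Kernel X Y)
    [IsSFiniteKernel κ] {f : Y → ℝ} (hf : Measurable f) : Measurable fun x => ∫ y, f y ∂(κ x) :=
  (hf.stronglyMeasurable.integral_kernel (κ := κ)).measurable

theorem abs_integral_le_of_bounded {μ : Measure X} [IsProbabilityMeasure μ] {f : X → ℝ} {C : ℝ}
    (hC : ∀ x, |f x| ≤ C) : |∫ y, f y ∂μ| ≤ C := by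
  simpa using norm_integral_le_of_norm_le_const (μ := μ) (f := f) (C := C) (.of_forall hC)

theorem IsLocalChoice.exists_mem_inside {𝒲 : X → Set (Set X)} {P : Set X}
    (hc : IsLocalChoice 𝒱 P 𝒲) {x : X} (hx : x ∈ P) {W : Set X} (hW : W ∈ 𝒲 x) :
    W ∈ 𝒱 ∧ closure W ⊆ P ∧ x ∈ W :=
  ⟨((hc x hx).1 W hW).1.1, ((hc x hx).1 W hW).1.2, ((hc x hx).1 W hW).2⟩

theorem IsNormalBauerFamily.compl_null (hH : IsNormalBauerFamily 𝒱 H) {W A : Set X}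
    (hW : W ∈ 𝒱) {x : X} (hx : x ∈ W) (hA : closure W ⊆ A) : H W x Aᶜ = 0 :=
  measure_mono_null (compl_subset_compl.2 (frontier_subset_closure.trans hA))
    ((hH.boundary W hW).1 x hx)

/-- Locally hyperharmonic functions on `V ∈ 𝒱` satisfy `H_V v ≤ v`. -/
theorem IsLocallyHyperharmonic.integral_le (hH : IsNormalBauerFamily 𝒱 H) {V : Set X}
    (hV : V ∈ 𝒱) {v : X → ℝ} (hv : LowerSemicontinuous v) (h0 : ∀ x, 0 ≤ v x) {C : ℝ}
    (hC : ∀ x, v x ≤ C) (hloc : IsLocallyHyperharmonic 𝒱 H V v) (x : X) :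
    ∫ y, v y ∂(H V x) ≤ v x := by
  obtain ⟨φ, hφc, hφ0, hφv, hφlim⟩ := exists_seq_continuous_tendsto hv h0
  have hVo := hH.base.isOpen hV
  have hm := hH.markov V hV
  have hφC : ∀ n x, |φ n x| ≤ C := fun n x => by
    rw [abs_of_nonneg (hφ0 n x)]; exact (hφv n x).trans (hC x)
  have hvC : ∀ x, |v x| ≤ C := fun x => by rw [abs_of_nonneg (h0 x)]; exact hC x
  have key : ∀ n, ∫ y, φ n y ∂(H V x) ≤ v x := by
    intro n
    by_cases hx : x ∈ V
    swap
    · rw [hH.integral_of_notMem hV hx]; exact hφv n x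
    obtain ⟨𝒲, hc, hs⟩ := hH.separates V hV
    have hcont := hH.continuous V hV (φ n) (hφc n)
    have hbd : ∀ y, |∫ z, φ n z ∂(H V y)| ≤ C := fun y => abs_integral_le_of_bounded (hφC n)
    -- With `φ n` in place of `v` the subtracted term is continuous on `X`, so the difference is
    -- lower semicontinuous up to the boundary, where it equals `v - φ n ≥ 0`.
    have := min_principle hH hc hs (hH.relCompact V hV) (O := V) subset_rfl
      (u := fun y => v y - ∫ z, φ n z ∂(H V y)) (C := C + C)
      (by
        simp only [sub_eq_add_neg]
        exact (hv.add hcont.neg.lowerSemicontinuous).lowerSemicontinuousOn _)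
      (fun y _ => by linarith [hC y, neg_le_of_abs_le (hbd y)])
      (fun y _ hy => by
        simp only [hH.integral_of_notMem hV hy, sub_nonneg]
        exact hφv n y)
      (by
        intro y _ hyV
        obtain ⟨N, hN, hNW⟩ := hloc y hyV
        refine ⟨N, hN, fun W hW hWN => ?_⟩
        obtain ⟨hW1, hW2, hW3⟩ := hc.exists_mem_inside hyV hW
        have := hH.markov W hW1
        refine ⟨hH.compl_null hW1 hW3 (hW2.trans subset_closure), ?_⟩
        rw [integral_sub (integrable_of_bounded hv.measurable hvC)
          (integrable_of_bounded hcont.measurable hbd),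
          hH.comp_apply hV hW1 (subset_closure.trans hW2) y (hφc n).measurable (hφC n)]
        exact sub_le_sub_right (hNW W hW1 hW3 hWN) _)
      x (subset_closure hx)
    exact sub_nonneg.1 this
  refine le_of_tendsto' (tendsto_integral_of_dominated_convergence (fun _ => C)
    (fun n => (hφc n).aestronglyMeasurable) (integrable_const _) (fun n => .of_forall (hφC n))
    (.of_forall hφlim)) key

/-- Continuous functions which are harmonic on `V ∈ 𝒱` are reproduced by `H_V`. -/
theorem IsNormalBauerFamily.integral_eq_of_locally (hH : IsNormalBauerFamily 𝒱 H) {V : Set X}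
    (hV : V ∈ 𝒱) {q : X → ℝ} (hq : Continuous q) {C : ℝ} (hC : ∀ x, |q x| ≤ C)
    (hloc : ∀ x ∈ V, ∃ N ∈ 𝓝 x, ∀ W ∈ 𝒱, x ∈ W → W ⊆ N → ∫ y, q y ∂(H W x) = q x) (x : X) :
    ∫ y, q y ∂(H V x) = q x := by
  have hint : ∀ W ∈ 𝒱, ∀ x, Integrable q (H W x) := fun W hW x => by
    have := hH.markov W hW
    exact integrable_of_bounded hq.measurable hC
  -- Both `C + q` and `C - q` are nonnegative and locally hyperharmonic; the two inequalities
  -- together give equality.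
  have h1 := IsLocallyHyperharmonic.integral_le hH hV (v := fun x => C + q x)
    (continuous_const.add hq).lowerSemicontinuous
    (fun x => by linarith [neg_le_of_abs_le (hC x)]) (C := C + C)
    (fun x => by linarith [le_of_abs_le (hC x)]) (fun x hx => by
      obtain ⟨N, hN, h⟩ := hloc x hx
      refine ⟨N, hN, fun W hW hxW hWN => ?_⟩
      have := hH.markov W hW
      rw [integral_add (integrable_const _) (hint W hW x), h W hW hxW hWN]
      simp) x
  have h2 := IsLocallyHyperharmonic.integral_le hH hV (v := fun x => C - q x)
    (continuous_const.sub hq).lowerSemicontinuous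
    (fun x => by linarith [le_of_abs_le (hC x)]) (C := C + C)
    (fun x => by linarith [neg_le_of_abs_le (hC x)]) (fun x hx => by
      obtain ⟨N, hN, h⟩ := hloc x hx
      refine ⟨N, hN, fun W hW hxW hWN => ?_⟩
      have := hH.markov W hW
      rw [integral_sub (integrable_const _) (hint W hW x), h W hW hxW hWN]
      simp) x
  have := hH.markov V hV
  rw [integral_add (integrable_const _) (hint V hV x)] at h1
  rw [integral_sub (integrable_const _) (hint V hV x)] at h2
  simp only [integral_const, probReal_univ, one_smul] at h1 h2
  linarith

end LocalToGlobal

/-! ### Local connectedness of the base space. -/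

section Connected

variable {X : Type*} [TopologicalSpace X] [T2Space X] [LocallyCompactSpace X]
    [SecondCountableTopology X] [MeasurableSpace X] [BorelSpace X]
    {𝒱 : Set (Set X)} {H : Set X → Kernel X X}

theorem IsNormalBauerFamily.exists_mem_subset (hH : IsNormalBauerFamily 𝒱 H) {x : X} {N : Set X}
    (hN : N ∈ 𝓝 x) : ∃ W ∈ 𝒱, x ∈ W ∧ closure W ⊆ N := by
  obtain ⟨A, hA, hAc, hAN⟩ := exists_mem_nhds_isClosed_subset hN
  obtain ⟨W, hW, hxW, hWA⟩ := hH.base.mem_nhds_iff.1 hA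
  exact ⟨W, hW, hxW, (hAc.closure_subset_iff.2 hWA).trans hAN⟩

/-- Harmonic measures do not charge pieces of `U` which are separated from the starting point. -/
theorem IsNormalBauerFamily.null_of_clopen (hH : IsNormalBauerFamily 𝒱 H) {U A B : Set X}
    (hA : IsOpen A) (hB : IsOpen B) (hAB : Disjoint A B) (hU : A ∪ B = U) {W : Set X}
    (hW : W ∈ inside 𝒱 U) {x : X} (hx : x ∈ W) (hxA : x ∈ A) : H W x B = 0 := by
  obtain ⟨hWV, hWU⟩ := hW
  have hWo := hH.base.isOpen hWV
  have hWc := hH.relCompact W hWV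
  have hm := hH.markov W hWV
  obtain ⟨𝒲, hc, hs⟩ := hH.separates W hWV
  have hAcl : ∀ y ∈ closure W, y ∉ B → y ∈ A := fun y hy hyB =>
    ((hU ▸ hWU hy : y ∈ A ∪ B).resolve_right hyB)
  have hYc : IsCompact (closure W ∩ Bᶜ) := hWc.inter_right hB.isClosed_compl
  have hK : IsCompact (closure W ∩ Aᶜ) := hWc.inter_right hA.isClosed_compl
  -- For starting points in `W`, `H_W v` is the probability of leaving `W` through `A`. It equals
  -- `1` at points of `closure W ∩ A` outside `W`, so the minimum principle on `closure W ∩ A` makes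
  -- it at least `1` there, leaving no mass for `B`.
  let v : X → ℝ := (closure W ∩ Aᶜ)ᶜ.indicator fun _ => 1
  have hv : LowerSemicontinuous v := hK.isClosed.isOpen_compl.lowerSemicontinuous_indicator
    zero_le_one
  have hv0 : ∀ x, 0 ≤ v x := fun x => indicator_nonneg (fun _ _ => zero_le_one) x
  have hv1 : ∀ x, v x ≤ 1 := fun x => indicator_le_self' (fun _ _ => zero_le_one) x
  have hvb : ∀ x, |v x| ≤ 1 := fun x => by rw [abs_of_nonneg (hv0 x)]; exact hv1 x
  have hHv := hH.lowerSemicontinuous_integral hWV hv hv0 hv1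
  have hbd : ∀ y, |∫ z, v z ∂(H W y)| ≤ 1 := fun y => abs_integral_le_of_bounded hvb
  have h := min_principle hH hc hs hYc (O := W) subset_rfl
    (u := fun y => (∫ z, v z ∂(H W y)) + (-1)) (C := 1)
    ((hHv.add lowerSemicontinuous_const).lowerSemicontinuousOn _)
    (fun y _ => by linarith [le_of_abs_le (hbd y)])
    (fun y hy hyW => by
      have : v y = 1 := indicator_of_mem (fun h => h.2 (hAcl y hy.1 hy.2)) _
      simp only [hH.integral_of_notMem hWV hyW, this]
      norm_num)
    (by
      intro y hy hyW
      obtain ⟨N, hN, hNcl, hNA⟩ := exists_mem_nhds_isClosed_subset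
        ((hA.inter hWo).mem_nhds ⟨hAcl y hy.1 hy.2, hyW⟩)
      refine ⟨N, hN, fun W' hW' hW'N => ?_⟩
      obtain ⟨h1, h2, h3⟩ := hc.exists_mem_inside hyW hW'
      have := hH.markov W' h1
      refine ⟨hH.compl_null h1 h3 ?_, ?_⟩
      · intro z hz
        have hz' := hNA (hNcl.closure_subset_iff.2 hW'N hz)
        exact ⟨subset_closure hz'.2, fun hzB => disjoint_left.1 hAB hz'.1 hzB⟩
      · rw [integral_add (integrable_of_bounded hHv.measurable hbd) (integrable_const _),
          hH.comp_apply hWV h1 (subset_closure.trans h2) y hv.measurable hvb]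
        simp)
    x ⟨subset_closure hx, fun hxB => disjoint_left.1 hAB hxA hxB⟩
  have h1 : ∫ z, v z ∂(H W x) = (H W x).real (closure W ∩ Aᶜ)ᶜ :=
    integral_indicator_one hK.isClosed.isOpen_compl.measurableSet
  rw [h1, probReal_compl_eq_one_sub hK.isClosed.measurableSet] at h
  have h2 : (H W x).real (closure W ∩ Aᶜ) = 0 := le_antisymm (by linarith) measureReal_nonneg
  have h3 := (measureReal_eq_zero_iff).1 h2
  refine measure_mono_null (t := (closure W ∩ Aᶜ) ∪ (closure W)ᶜ) (fun y hy => ?_)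
    (measure_union_null h3 (hH.compl_null hWV hx subset_rfl))
  by_cases hyW : y ∈ closure W
  · exact Or.inl ⟨hyW, fun hyA => disjoint_left.1 hAB hyA hy⟩
  · exact Or.inr hyW

/-- The strong Feller property forces this. Let `Q` be the quasi-component of `x` in `U`, the
intersection of the relatively clopen sets containing `x`. Harmonic measures do not cross clopen
splittings, so `H_W 1_Q` is `1` on `Q ∩ W` and `0` on `W \ Q`; being continuous, it shows that `Q`
is open. A clopen quasi-component is connected, hence is the component. -/
theorem IsNormalBauerFamily.locallyConnectedSpace (hH : IsNormalBauerFamily 𝒱 H) :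
    LocallyConnectedSpace X := by
  rw [locallyConnectedSpace_iff_connectedComponentIn_open]
  intro U hU x hxU
  have : Nonempty U := ⟨⟨x, hxU⟩⟩
  let 𝒬 : Set (Set U) := {s | IsClopen s ∧ (⟨x, hxU⟩ : U) ∈ s}
  let Q : Set U := ⋂₀ 𝒬
  have hQcl : IsClosed Q := isClosed_sInter fun s hs => hs.1.1
  have hQopen : IsOpen Q := by
    -- Countably many clopen sets already cut out `Q`, so that null sets can be united below.
    obtain ⟨T, hTc, hT, hTe⟩ := TopologicalSpace.isOpen_sUnion_countable (compl '' 𝒬) (by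
      rintro _ ⟨A, hA, rfl⟩
      exact hA.1.1.isOpen_compl)
    rw [← compl_sInter] at hTe
    have hQm : MeasurableSet (Subtype.val '' Q) :=
      hU.measurableSet.subtype_image hQcl.measurableSet
    rw [isOpen_iff_mem_nhds]
    rintro ⟨y, hyU⟩ hyQ
    obtain ⟨W, hW, hyW, hWU⟩ := hH.exists_mem_subset (hU.mem_nhds hyU)
    have hm := hH.markov W hW
    let f : X → ℝ := (Subtype.val '' Q).indicator fun _ => 1
    have hcont := hH.strongFeller W hW f (measurable_const.indicator hQm)
      ⟨1, fun x => by
        rw [abs_of_nonneg (indicator_nonneg (fun _ _ => zero_le_one) x)]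
        exact indicator_le_self' (fun _ _ => zero_le_one) x⟩
    have hclopen : ∀ s ∈ 𝒬, ∀ z (hz : z ∈ U), z ∈ W → ((⟨z, hz⟩ : U) ∈ s →
        H W z (Subtype.val '' sᶜ) = 0) ∧ ((⟨z, hz⟩ : U) ∉ s → H W z (Subtype.val '' s) = 0) := by
      intro s hs z hz hzW
      have h1 := hU.isOpenMap_subtype_val _ hs.1.2
      have h2 := hU.isOpenMap_subtype_val _ hs.1.compl.2
      have h3 : Disjoint (Subtype.val '' s) (Subtype.val '' sᶜ) :=
        disjoint_image_of_injective Subtype.val_injective disjoint_compl_right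
      have h4 : (Subtype.val '' s) ∪ (Subtype.val '' sᶜ) = U := by
        rw [← image_union, union_compl_self, image_univ, Subtype.range_val]
      refine ⟨fun h => hH.null_of_clopen h1 h2 h3 h4 ⟨hW, hWU⟩ hzW ⟨_, h, rfl⟩, fun h =>
        hH.null_of_clopen h2 h1 h3.symm (by rw [union_comm, h4]) ⟨hW, hWU⟩ hzW ⟨_, h, rfl⟩⟩
    have hval : ∀ z (hz : z ∈ U), z ∈ W → ((⟨z, hz⟩ : U) ∈ Q → ∫ y, f y ∂(H W z) = 1) ∧
        ((⟨z, hz⟩ : U) ∉ Q → ∫ y, f y ∂(H W z) = 0) := by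
      intro z hz hzW
      have hint : ∫ y, f y ∂(H W z) = (H W z).real (Subtype.val '' Q) := integral_indicator_one hQm
      rw [hint]
      constructor
      · intro hzQ
        have h0 : H W z (Subtype.val '' Qᶜ) = 0 := by
          rw [← hTe, image_sUnion, measure_sUnion_null_iff (hTc.image _)]
          rintro _ ⟨B, hB, rfl⟩
          obtain ⟨s, hs, rfl⟩ := hT hB
          exact (hclopen s hs z hz hzW).1 (hzQ s hs)
        have h1 : H W z (Subtype.val '' Q)ᶜ = 0 := by
          refine measure_mono_null (t := (Subtype.val '' Qᶜ) ∪ Uᶜ) (fun y hy => ?_)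
            (measure_union_null h0 (hH.compl_null hW hzW hWU))
          by_cases hyU : y ∈ U
          · exact Or.inl ⟨⟨y, hyU⟩, fun h => hy ⟨_, h, rfl⟩, rfl⟩
          · exact Or.inr hyU
        have := probReal_compl_eq_one_sub (μ := H W z) hQm
        rw [measureReal_def, h1] at this
        simp only [ENNReal.toReal_zero] at this
        linarith
      · intro hzQ
        obtain ⟨s, hs, hzs⟩ : ∃ s ∈ 𝒬, (⟨z, hz⟩ : U) ∉ s := by
          simpa [Q, mem_sInter] using hzQ
        rw [measureReal_def, measure_mono_null (image_mono (sInter_subset_of_mem hs))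
          ((hclopen s hs z hz hzW).2 hzs), ENNReal.toReal_zero]
    have hWn := (hH.base.isOpen hW).mem_nhds hyW
    have hev := (hcont.continuousAt hWn).eventually
      (lt_mem_nhds (a := 0) (by simp only [(hval y hyU hyW).1 hyQ, zero_lt_one]))
    have : ∀ᶠ z : U in 𝓝 ⟨y, hyU⟩, 0 < ∫ w, f w ∂(H W z) ∧ (z : X) ∈ W :=
      (continuous_subtype_val.tendsto (⟨y, hyU⟩ : U)).eventually (hev.and hWn)
    filter_upwards [this] with z hz
    by_contra hzQ
    rw [(hval z z.2 hz.2).2 hzQ] at hz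
    exact lt_irrefl _ hz.1
  have hxQ : (⟨x, hxU⟩ : U) ∈ Q := fun s hs => hs.2
  have hQconn : IsPreconnected Q := by
    have key : ∀ u v : Set U, IsOpen u → IsOpen v → Q ⊆ u ∪ v → Q ∩ (u ∩ v) = ∅ →
        (⟨x, hxU⟩ : U) ∈ u → Q ⊆ u := by
      intro u v hu hv huv hdisj hxu
      -- A splitting of the clopen set `Q` would produce a smaller clopen set containing `x`.
      have : Q ∩ u ∈ 𝒬 := by
        refine ⟨⟨⟨?_⟩, hQopen.inter hu⟩, hxQ, hxu⟩
        have : (Q ∩ u)ᶜ = Qᶜ ∪ Q ∩ v := by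
          ext z
          have h1 := @huv z
          have h2 : z ∉ Q ∩ (u ∩ v) := by simp [hdisj]
          simp only [mem_union, mem_inter_iff, mem_compl_iff] at h1 h2 ⊢
          tauto
        rw [this]
        exact hQcl.isOpen_compl.union (hQopen.inter hv)
      exact (sInter_subset_of_mem this).trans inter_subset_right
    rw [isPreconnected_iff_subset_of_disjoint]
    intro u v hu hv huv hdisj
    rcases huv hxQ with h | h
    · exact Or.inl (key u v hu hv huv hdisj h)
    · exact Or.inr (key v u hv hu (by rwa [union_comm]) (by rwa [inter_comm v u]) h)
  have : connectedComponent (⟨x, hxU⟩ : U) = Q :=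
    (subset_sInter fun s hs => hs.1.connectedComponent_subset hs.2).antisymm
      (hQconn.subset_connectedComponent hxQ)
  rw [connectedComponentIn_eq_image hxU, this]
  exact hU.isOpenMap_subtype_val _ hQopen

end Connected
end Darning

namespace Darning

/-! ### Perron's method and barriers. -/

section Perron

variable {X : Type*} [TopologicalSpace X] [T2Space X] [LocallyCompactSpace X]
    [SecondCountableTopology X] [MeasurableSpace X] [BorelSpace X]
    {𝒱 : Set (Set X)} {H : Set X → Kernel X X} {U : Set X}

theorem IsNormalBauerFamily.isLocalChoice (hH : IsNormalBauerFamily 𝒱 H) (hU : IsOpen U) :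
    IsLocalChoice 𝒱 U fun x => {W | W ∈ inside 𝒱 U ∧ x ∈ W} := by
  refine fun x hx => ⟨fun W hW => hW, fun N hN => ?_⟩
  obtain ⟨W, hW, hxW, hWN⟩ := hH.exists_mem_subset (inter_mem hN (hU.mem_nhds hx))
  exact ⟨W, ⟨⟨hW, hWN.trans inter_subset_right⟩, hxW⟩,
    subset_closure.trans (hWN.trans inter_subset_left)⟩

theorem integrable_of_continuousOn_compact {μ : Measure X} [IsFiniteMeasure μ] {Y : Set X}
    (hY : IsCompact Y) (h0 : μ Yᶜ = 0) {f : X → ℝ} (hf : ContinuousOn f Y) : Integrable f μ := by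
  rw [← restrict_eq_self_of_compl_null h0]
  exact hf.integrableOn_compact hY

theorem IsNormalBauerFamily.integrable_of_continuousOn (hH : IsNormalBauerFamily 𝒱 H) {W : Set X}
    (hW : W ∈ inside 𝒱 U) {f : X → ℝ} (hf : ContinuousOn f U) {x : X} (hx : x ∈ W) :
    Integrable f (H W x) :=
  have := hH.markov W hW.1
  integrable_of_continuousOn_compact (hH.relCompact W hW.1) (hH.compl_null hW.1 hx subset_rfl)
    (hf.mono hW.2)

theorem IsHarmonicOn.sub (hH : IsNormalBauerFamily 𝒱 H) {f g : X → ℝ}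
    (hf : IsHarmonicOn 𝒱 H U f) (hg : IsHarmonicOn 𝒱 H U g) :
    IsHarmonicOn 𝒱 H U fun x => f x - g x := by
  refine ⟨hf.1.sub hg.1, fun W hW x hx => ?_⟩
  rw [integral_sub (hH.integrable_of_continuousOn hW hf.1 hx)
    (hH.integrable_of_continuousOn hW hg.1 hx), hf.2 W hW x hx, hg.2 W hW x hx]

theorem IsHarmonicOn.const (hH : IsNormalBauerFamily 𝒱 H) (c : ℝ) :
    IsHarmonicOn 𝒱 H U fun _ => c := by
  refine ⟨continuousOn_const, fun W hW x _ => ?_⟩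
  have := hH.markov W hW.1
  simp

theorem IsHarmonicOn.const_mul {f : X → ℝ} (hf : IsHarmonicOn 𝒱 H U f) (c : ℝ) :
    IsHarmonicOn 𝒱 H U fun x => c * f x := by
  refine ⟨hf.1.const_mul c, fun W hW x hx => ?_⟩
  rw [integral_const_mul, hf.2 W hW x hx]

theorem IsHarmonicOn.mono {f : X → ℝ} (hf : IsHarmonicOn 𝒱 H U f) {U' : Set X} (h : U' ⊆ U) :
    IsHarmonicOn 𝒱 H U' f :=
  ⟨hf.1.mono h, fun W hW x hx => hf.2 W ⟨hW.1, hW.2.trans h⟩ x hx⟩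

theorem IsNormalBauerFamily.ae_mem (hH : IsNormalBauerFamily 𝒱 H) {W : Set X} (hW : W ∈ 𝒱) {x : X}
    (hx : x ∈ W) {A : Set X} (hA : closure W ⊆ A) : ∀ᵐ y ∂(H W x), y ∈ A := by
  have := hH.compl_null hW hx hA
  rwa [← mem_ae_iff] at this

theorem IsHarmonicOn.congr (hH : IsNormalBauerFamily 𝒱 H) {f g : X → ℝ}
    (hf : IsHarmonicOn 𝒱 H U f) (hfg : EqOn g f U) : IsHarmonicOn 𝒱 H U g := by
  refine ⟨hf.1.congr hfg, fun W hW x hx => ?_⟩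
  rw [hfg (hW.2 (subset_closure hx)), ← hf.2 W hW x hx]
  exact integral_congr_ae ((hH.ae_mem hW.1 hx hW.2).mono hfg)

/-- Minimum principle for continuous harmonic functions. -/
theorem IsHarmonicOn.nonneg_of_frontier (hH : IsNormalBauerFamily 𝒱 H) {P : Set X}
    (hP : IsPSet 𝒱 H P) (hUo : IsOpen U) (hUP : U ⊆ P) (hUc : IsCompact (closure U)) {h : X → ℝ}
    (hh : IsHarmonicOn 𝒱 H U h) (hc : ContinuousOn h (closure U))
    (h0 : ∀ x ∈ frontier U, 0 ≤ h x) : ∀ x ∈ closure U, 0 ≤ h x := by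
  obtain ⟨C, hC⟩ := hUc.exists_bound_of_continuousOn hc
  refine min_principle hH (hH.isLocalChoice hP.1) hP.2 hUc (O := U) hUP
    hc.lowerSemicontinuousOn (C := C) (fun y hy => (le_abs_self _).trans (hC y hy)) ?_ ?_
  · intro y hy hyU
    exact h0 y (by rw [hUo.frontier_eq]; exact ⟨hy, hyU⟩)
  · intro x _ hxU
    obtain ⟨N, hN, hNc, hNU⟩ := exists_mem_nhds_isClosed_subset (hUo.mem_nhds hxU)
    refine ⟨N, hN, fun W hW hWN => ?_⟩
    have hWU : closure W ⊆ U := (hNc.closure_subset_iff.2 hWN).trans hNU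
    exact ⟨hH.compl_null hW.1.1 hW.2 (hWU.trans subset_closure),
      (hh.2 W ⟨hW.1.1, hWU⟩ x hW.2).le⟩

/-- Upper functions for the boundary function `f` on the open set `U`. -/
structure IsUpper (𝒱 : Set (Set X)) (H : Set X → Kernel X X) (U : Set X) (f v : X → ℝ) : Prop where
  lsc : LowerSemicontinuous v
  nonneg : ∀ x, 0 ≤ v x
  le_one : ∀ x, v x ≤ 1
  eq_off : ∀ x, x ∉ U → v x = f x
  hyper : IsLocallyHyperharmonic 𝒱 H U v

theorem IsUpper.abs_le {f v : X → ℝ} (hv : IsUpper 𝒱 H U f v) (x : X) : |v x| ≤ 1 := by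
  rw [abs_of_nonneg (hv.nonneg x)]; exact hv.le_one x

theorem IsUpper.integral_le (hH : IsNormalBauerFamily 𝒱 H) {f v : X → ℝ}
    (hv : IsUpper 𝒱 H U f v) {W : Set X} (hW : W ∈ inside 𝒱 U) (x : X) :
    ∫ y, v y ∂(H W x) ≤ v x :=
  IsLocallyHyperharmonic.integral_le hH hW.1 hv.lsc hv.nonneg hv.le_one
    (fun x hx => hv.hyper x (hW.2 (subset_closure hx))) x

theorem IsUpper.inf (hH : IsNormalBauerFamily 𝒱 H) {f v w : X → ℝ} (hv : IsUpper 𝒱 H U f v)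
    (hw : IsUpper 𝒱 H U f w) : IsUpper 𝒱 H U f fun x => min (v x) (w x) := by
  have hlsc : LowerSemicontinuous fun x => min (v x) (w x) := hv.lsc.inf hw.lsc
  have hab : ∀ x, |min (v x) (w x)| ≤ 1 := fun x => by
    rw [abs_of_nonneg (le_min (hv.nonneg x) (hw.nonneg x))]
    exact (min_le_left _ _).trans (hv.le_one x)
  refine ⟨hlsc, fun x => le_min (hv.nonneg x) (hw.nonneg x),
    fun x => (min_le_left _ _).trans (hv.le_one x), fun x hx => ?_, fun x hx => ?_⟩
  · rw [hv.eq_off x hx, hw.eq_off x hx, min_self]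
  · obtain ⟨N, hN, h1⟩ := hv.hyper x hx
    obtain ⟨N', hN', h2⟩ := hw.hyper x hx
    refine ⟨N ∩ N', inter_mem hN hN', fun W hW hxW hWN => le_min ?_ ?_⟩
    all_goals have := hH.markov W hW
    · refine (integral_mono (integrable_of_bounded hlsc.measurable hab)
        (integrable_of_bounded hv.lsc.measurable hv.abs_le) fun y => min_le_left _ _).trans
        (h1 W hW hxW (hWN.trans inter_subset_left))
    · refine (integral_mono (integrable_of_bounded hlsc.measurable hab)
        (integrable_of_bounded hw.lsc.measurable hw.abs_le) fun y => min_le_right _ _).trans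
        (h2 W hW hxW (hWN.trans inter_subset_right))

/-- Inside `W` the mean value property follows from `H_{W'} H_W = H_W`; at a point of `U \ W` the
value is unchanged while the function has only decreased. -/
theorem IsUpper.poisson (hH : IsNormalBauerFamily 𝒱 H) {f v : X → ℝ} (hv : IsUpper 𝒱 H U f v)
    {W : Set X} (hW : W ∈ inside 𝒱 U) : IsUpper 𝒱 H U f fun x => ∫ y, v y ∂(H W x) := by
  have hm := hH.markov W hW.1
  have hlsc := hH.lowerSemicontinuous_integral hW.1 hv.lsc hv.nonneg hv.le_one
  have hb : ∀ x, |∫ y, v y ∂(H W x)| ≤ 1 := fun x => abs_integral_le_of_bounded hv.abs_le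
  refine ⟨hlsc, fun x => integral_nonneg hv.nonneg, fun x => le_of_abs_le (hb x), fun x hx => ?_,
    fun x hx => ?_⟩
  · rw [hH.integral_of_notMem hW.1 fun h => hx (hW.2 (subset_closure h)), hv.eq_off x hx]
  · by_cases hxW : x ∈ W
    · exact ⟨W, (hH.base.isOpen hW.1).mem_nhds hxW, fun W' hW' _ hW'W =>
        (hH.comp_apply hW.1 hW' hW'W x hv.lsc.measurable hv.abs_le).le⟩
    · obtain ⟨N, hN, h⟩ := hv.hyper x hx
      refine ⟨N, hN, fun W' hW' hxW' hW'N => ?_⟩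
      rw [hH.integral_of_notMem hW.1 hxW]
      have := hH.markov W' hW'
      exact (integral_mono (integrable_of_bounded hlsc.measurable hb)
        (integrable_of_bounded hv.lsc.measurable hv.abs_le) fun y => hv.integral_le hH hW y).trans
        (h W' hW' hxW' hW'N)

open Classical in
/-- Upper functions obtained by cutting off a function `w` defined near a boundary point. -/
theorem IsUpper.glue (hH : IsNormalBauerFamily 𝒱 H) (hU : IsOpen U) {f w : X → ℝ}
    (hf : Continuous f) (hf0 : ∀ x, 0 ≤ f x) (hf1 : ∀ x, f x ≤ 1) {V : Set X} (hV : IsOpen V)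
    (hw : LowerSemicontinuous w) (hw0 : ∀ x, 0 ≤ w x) {C : ℝ} (hwC : ∀ x, w x ≤ C)
    (hfw : ∀ y ∈ closure V, y ∉ U → f y ≤ w y) (hw1 : ∀ y ∈ frontier V, y ∈ U → 1 < w y)
    (hloc : IsLocallyHyperharmonic 𝒱 H (V ∩ U) w) :
    IsUpper 𝒱 H U f fun x => if x ∈ U then (if x ∈ V then min 1 (w x) else 1) else f x := by
  set v : X → ℝ := fun x => if x ∈ U then (if x ∈ V then min 1 (w x) else 1) else f x with hv
  have hv0 : ∀ x, 0 ≤ v x := fun x => by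
    simp only [hv]
    split_ifs
    exacts [le_min zero_le_one (hw0 x), zero_le_one, hf0 x]
  have hv1 : ∀ x, v x ≤ 1 := fun x => by
    simp only [hv]
    split_ifs
    exacts [min_le_left _ _, le_rfl, hf1 x]
  have hvU : ∀ x, x ∈ U → (x ∈ V → 1 < w x) → v x = 1 := fun x hx h => by
    simp only [hv, if_pos hx]
    split_ifs with hxV
    exacts [min_eq_left (h hxV).le, rfl]
  have hvV : ∀ x, x ∈ U → x ∈ V → v x = min 1 (w x) := fun x hx hxV => by
    simp only [hv, if_pos hx, if_pos hxV]
  -- The seam along the boundary of `V` inside `U` is harmless because `w > 1` there, and the one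
  -- along the boundary of `U` because `w` dominates `f` on `closure V \ U`.
  have hlsc : LowerSemicontinuous v := by
    intro y a ha
    change a < v y at ha
    change ∀ᶠ x in 𝓝 y, a < v x
    by_cases hyU : y ∈ U
    · have hUn := hU.mem_nhds hyU
      by_cases hyV : y ∈ V
      · rw [hvV y hyU hyV] at ha
        filter_upwards [hUn, hV.mem_nhds hyV, hw y a (ha.trans_le (min_le_right _ _))]
          with x hxU hxV hxw
        rw [hvV x hxU hxV]
        exact lt_min (ha.trans_le (min_le_left _ _)) hxw
      · have ha1 := ha.trans_le (hv1 y)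
        have : ∀ᶠ x in 𝓝 y, x ∈ V → 1 < w x := by
          by_cases hyc : y ∈ closure V
          · have hyf : y ∈ frontier V := by rw [hV.frontier_eq]; exact ⟨hyc, hyV⟩
            filter_upwards [hw y 1 (hw1 y hyf hyU)] with x hx _ using hx
          · filter_upwards [isClosed_closure.isOpen_compl.mem_nhds hyc] with x hx hxV
            exact absurd (subset_closure hxV) hx
        filter_upwards [hUn, this] with x hxU hx
        rwa [hvU x hxU hx]
    · have hya : a < f y := by simpa only [hv, if_neg hyU] using ha
      have : ∀ᶠ x in 𝓝 y, x ∈ V → a < w x := by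
        by_cases hyc : y ∈ closure V
        · filter_upwards [hw y a (hya.trans_le (hfw y hyc hyU))] with x hx _ using hx
        · filter_upwards [isClosed_closure.isOpen_compl.mem_nhds hyc] with x hx hxV
          exact absurd (subset_closure hxV) hx
      filter_upwards [hf.continuousAt.eventually (lt_mem_nhds hya), this] with x hx hxw
      simp only [hv]
      split_ifs with h1 h2
      exacts [lt_min (hx.trans_le (hf1 x)) (hxw h2), hx.trans_le (hf1 x), hx]
  have hvb : ∀ x, |v x| ≤ 1 := fun x => by rw [abs_of_nonneg (hv0 x)]; exact hv1 x
  refine ⟨hlsc, hv0, hv1, fun x hx => if_neg hx, fun x hx => ?_⟩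
  have hle1 : ∀ W ∈ 𝒱, ∫ y, v y ∂(H W x) ≤ 1 := fun W hW => by
    have := hH.markov W hW
    exact le_of_abs_le (abs_integral_le_of_bounded hvb)
  by_cases hxV : x ∈ V
  · obtain ⟨N, hN, h⟩ := hloc x ⟨hxV, hx⟩
    obtain ⟨N', hN', hNc, hNU⟩ :=
      exists_mem_nhds_isClosed_subset ((hV.inter hU).mem_nhds ⟨hxV, hx⟩)
    refine ⟨N ∩ N', inter_mem hN hN', fun W hW hxW hWN => ?_⟩
    rw [hvV x hx hxV]
    refine le_min (hle1 W hW) (le_trans ?_ (h W hW hxW (hWN.trans inter_subset_left)))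
    have := hH.markov W hW
    refine integral_mono_ae (integrable_of_bounded hlsc.measurable hvb)
      (integrable_of_bounded (C := C) hw.measurable fun y => by
        rw [abs_of_nonneg (hw0 y)]; exact hwC y) ?_
    filter_upwards [hH.ae_mem hW hxW (hNc.closure_subset_iff.2 (hWN.trans inter_subset_right))]
      with y hy
    rw [hvV y (hNU hy).2 (hNU hy).1]
    exact min_le_right _ _
  · refine ⟨univ, univ_mem, fun W hW _ _ => ?_⟩
    rw [hvU x hx fun h => absurd h hxV]
    exact hle1 W hW

theorem exists_isUpper (hH : IsNormalBauerFamily 𝒱 H) (hU : IsOpen U) {f : X → ℝ}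
    (hf : Continuous f) (hf0 : ∀ x, 0 ≤ f x) (hf1 : ∀ x, f x ≤ 1) : ∃ v, IsUpper 𝒱 H U f v := by
  classical
  exact ⟨_, IsUpper.glue hH hU hf hf0 hf1 isOpen_empty (w := fun _ => 0) (C := 0)
    continuous_const.lowerSemicontinuous (fun _ => le_rfl) (fun _ => le_rfl) (by simp) (by simp)
    (fun x hx => by simp at hx)⟩

/-- The infimum of all upper functions. -/
noncomputable def perron (𝒱 : Set (Set X)) (H : Set X → Kernel X X) (U : Set X) (f : X → ℝ)
    (x : X) : ℝ :=
  ⨅ v : {v : X → ℝ // IsUpper 𝒱 H U f v}, v.1 x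

theorem IsUpper.perron_le {f v : X → ℝ} (hv : IsUpper 𝒱 H U f v) (x : X) :
    perron 𝒱 H U f x ≤ v x :=
  ciInf_le (f := fun v : {v : X → ℝ // IsUpper 𝒱 H U f v} => v.1 x)
    ⟨0, by rintro _ ⟨v, rfl⟩; exact v.2.nonneg x⟩ ⟨v, hv⟩

theorem exists_isUpper_lt {f : X → ℝ} (hne : ∃ v, IsUpper 𝒱 H U f v) {x : X} {a : ℝ}
    (h : perron 𝒱 H U f x < a) : ∃ v, IsUpper 𝒱 H U f v ∧ v x < a := by
  have : Nonempty {v : X → ℝ // IsUpper 𝒱 H U f v} := let ⟨v, hv⟩ := hne; ⟨⟨v, hv⟩⟩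
  obtain ⟨⟨v, hv⟩, hva⟩ := exists_lt_of_ciInf_lt h
  exact ⟨v, hv, hva⟩

theorem le_perron {f : X → ℝ} (hne : ∃ v, IsUpper 𝒱 H U f v) {x : X} {a : ℝ}
    (h : ∀ v, IsUpper 𝒱 H U f v → a ≤ v x) : a ≤ perron 𝒱 H U f x := by
  by_contra! hlt
  obtain ⟨v, hv, hva⟩ := exists_isUpper_lt hne hlt
  exact absurd (h v hv) (not_le.2 hva)

/-- A Choquet-type reduction to countably many functions. Poisson modifications are continuous on
`W` by the strong Feller property, so the sets where they lie below a rational are open, and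
Lindelöf selects countably many with the same infimum. Running minima remain upper functions and
converge to it. -/
theorem exists_seq_isUpper_tendsto (hH : IsNormalBauerFamily 𝒱 H) (hU : IsOpen U) {f : X → ℝ}
    (hne : ∃ v, IsUpper 𝒱 H U f v) :
    ∃ w : ℕ → X → ℝ, (∀ n, IsUpper 𝒱 H U f (w n)) ∧
      ∀ x, Tendsto (fun n => w n x) atTop (𝓝 (perron 𝒱 H U f x)) := by
  let ι := {p : Set X × (X → ℝ) // p.1 ∈ inside 𝒱 U ∧ IsUpper 𝒱 H U f p.2}
  let F : ι → X → ℝ := fun i x => ∫ y, i.1.2 y ∂(H i.1.1 x)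
  let O : ℚ → ι → Set X := fun q i => i.1.1 ∩ F i ⁻¹' Iio (q : ℝ)
  have hO : ∀ q i, IsOpen (O q i) := fun q i =>
    (hH.strongFeller _ i.2.1.1 _ i.2.2.lsc.measurable ⟨1, i.2.2.abs_le⟩).isOpen_inter_preimage
      (hH.base.isOpen i.2.1.1) isOpen_Iio
  choose T hTc hT using fun q => TopologicalSpace.isOpen_iUnion_countable (O q) (hO q)
  obtain ⟨v₀, hv₀⟩ := hne
  let S : Set (X → ℝ) := insert v₀ (⋃ q, F '' T q)
  have hSc : S.Countable := (countable_iUnion fun q => (hTc q).image F).insert v₀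
  obtain ⟨e, he⟩ := hSc.exists_eq_range ⟨v₀, mem_insert _ _⟩
  have heU : ∀ n, IsUpper 𝒱 H U f (e n) := by
    intro n
    have : e n ∈ S := he ▸ mem_range_self n
    rcases this with h | h
    · rwa [h]
    · obtain ⟨q, i, _, h⟩ := mem_iUnion.1 h
      rw [← h]
      exact i.2.2.poisson hH i.2.1
  have hlt : ∀ x a, perron 𝒱 H U f x < a → ∃ n, e n x < a := by
    intro x a ha
    by_cases hx : x ∈ U
    · obtain ⟨q, hq, hqa⟩ := exists_rat_btwn ha
      obtain ⟨v, hv, hvq⟩ := exists_isUpper_lt ⟨v₀, hv₀⟩ hq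
      obtain ⟨W, hW, hxW, hWU⟩ := hH.exists_mem_subset (hU.mem_nhds hx)
      have hmem : x ∈ ⋃ i, O q i := mem_iUnion.2
        ⟨⟨(W, v), ⟨hW, hWU⟩, hv⟩, hxW, (hv.integral_le hH ⟨hW, hWU⟩ x).trans_lt hvq⟩
      rw [← hT q] at hmem
      obtain ⟨i, hi, hxi⟩ := mem_iUnion₂.1 hmem
      have : F i ∈ range e := he ▸ Or.inr (mem_iUnion.2 ⟨q, i, hi, rfl⟩)
      obtain ⟨n, hn⟩ := this
      exact ⟨n, by rw [hn]; exact lt_trans hxi.2 hqa⟩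
    · refine ⟨0, ?_⟩
      obtain ⟨v, hv, hva⟩ := exists_isUpper_lt ⟨v₀, hv₀⟩ ha
      rwa [(heU 0).eq_off x hx, ← hv.eq_off x hx]
  let w : ℕ → X → ℝ := fun n => Nat.rec (e 0) (fun n u x => min (u x) (e (n + 1) x)) n
  have hw : ∀ n, w (n + 1) = fun x => min (w n x) (e (n + 1) x) := fun n => rfl
  have hwU : ∀ n, IsUpper 𝒱 H U f (w n) := by
    intro n
    induction n with
    | zero => exact heU 0
    | succ n ih => rw [hw]; exact ih.inf hH (heU (n + 1))
  have hanti : ∀ x, Antitone fun n => w n x := fun x => antitone_nat_of_succ_le fun n => by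
    rw [hw]; exact min_le_left _ _
  have hwe : ∀ n x, w n x ≤ e n x := by
    intro n x
    cases n with
    | zero => exact le_rfl
    | succ n => rw [hw]; exact min_le_right _ _
  refine ⟨w, hwU, fun x => tendsto_order.2 ⟨fun a ha => .of_forall fun n =>
    ha.trans_le ((hwU n).perron_le x), fun a ha => ?_⟩⟩
  obtain ⟨n, hn⟩ := hlt x a ha
  filter_upwards [eventually_ge_atTop n] with m hm
  exact ((hanti x hm).trans (hwe n x)).trans_lt hn

/-- Along a sequence `w n` of upper functions tending to the infimum, `H_W (w n) ≤ w n` gives one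
inequality in the limit. The other holds because `H_W (w n)` is itself an upper function. Continuity
is the strong Feller property applied to the reproduced infimum. -/
theorem perron_harmonic (hH : IsNormalBauerFamily 𝒱 H) (hU : IsOpen U) {f : X → ℝ}
    (hne : ∃ v, IsUpper 𝒱 H U f v) : IsHarmonicOn 𝒱 H U (perron 𝒱 H U f) := by
  obtain ⟨w, hw, hlim⟩ := exists_seq_isUpper_tendsto hH hU hne
  have hmeas : Measurable (perron 𝒱 H U f) :=
    measurable_of_tendsto_metrizable (fun n => (hw n).lsc.measurable) (tendsto_pi_nhds.2 hlim)
  have hbd : ∀ x, |perron 𝒱 H U f x| ≤ 1 := fun x =>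
    le_of_tendsto' (hlim x).abs fun n => (hw n).abs_le x
  have hint : ∀ W ∈ inside 𝒱 U, ∀ x, ∫ y, perron 𝒱 H U f y ∂(H W x) = perron 𝒱 H U f x := by
    intro W hW x
    have := hH.markov W hW.1
    have h1 : Tendsto (fun n => ∫ y, w n y ∂(H W x)) atTop
        (𝓝 (∫ y, perron 𝒱 H U f y ∂(H W x))) :=
      tendsto_integral_of_dominated_convergence (fun _ => 1)
        (fun n => (hw n).lsc.measurable.aestronglyMeasurable) (integrable_const _)
        (fun n => .of_forall (hw n).abs_le) (.of_forall hlim)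
    exact le_antisymm (le_of_tendsto_of_tendsto' h1 (hlim x) fun n => (hw n).integral_le hH hW x)
      (ge_of_tendsto' h1 fun n => ((hw n).poisson hH hW).perron_le x)
  refine ⟨fun x hx => ?_, fun W hW x _ => hint W hW x⟩
  obtain ⟨W, hW, hxW, hWU⟩ := hH.exists_mem_subset (hU.mem_nhds hx)
  have := (hH.strongFeller W hW _ hmeas ⟨1, hbd⟩).continuousAt ((hH.base.isOpen hW).mem_nhds hxW)
  simp only [hint W ⟨hW, hWU⟩] at this
  exact this.continuousWithinAt

/-- The sum of an upper function for `f` and one for `g` is locally hyperharmonic on `U` and equals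
`1` off `U`, so the minimum principle applies. This turns upper bounds for the data `1 - f` into
lower bounds for `f`, and lower functions are never needed. -/
theorem one_le_perron_add (hH : IsNormalBauerFamily 𝒱 H) {P : Set X} (hP : IsPSet 𝒱 H P)
    (hU : IsOpen U) (hUP : U ⊆ P) (hUc : IsCompact (closure U)) {f g : X → ℝ}
    (hfg : ∀ x, f x + g x = 1) (hnf : ∃ v, IsUpper 𝒱 H U f v) (hng : ∃ v, IsUpper 𝒱 H U g v)
    {x : X} (hx : x ∈ U) : 1 ≤ perron 𝒱 H U f x + perron 𝒱 H U g x := by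
  rw [← sub_le_iff_le_add]
  refine le_perron hnf fun v hv => ?_
  rw [sub_le_iff_le_add, ← sub_le_iff_le_add']
  refine le_perron hng fun w hw => ?_
  have := min_principle hH (hH.isLocalChoice hP.1) hP.2 hUc (O := U) hUP
    (u := fun x => v x + w x + (-1)) (C := 1)
    (((hv.lsc.add hw.lsc).add lowerSemicontinuous_const).lowerSemicontinuousOn _)
    (fun y _ => by linarith [hv.le_one y, hw.le_one y])
    (fun y _ hy => by rw [hv.eq_off y hy, hw.eq_off y hy, hfg]; norm_num)
    (by
      intro y _ hyU
      obtain ⟨N₁, hN₁, h1⟩ := hv.hyper y hyU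
      obtain ⟨N₂, hN₂, h2⟩ := hw.hyper y hyU
      obtain ⟨N, hN, hNc, hNU⟩ := exists_mem_nhds_isClosed_subset (hU.mem_nhds hyU)
      refine ⟨N₁ ∩ N₂ ∩ N, inter_mem (inter_mem hN₁ hN₂) hN, fun W hW hWN => ?_⟩
      obtain ⟨⟨hW1, -⟩, hyW⟩ := hW
      have := hH.markov W hW1
      have hWU := (hNc.closure_subset_iff.2 (hWN.trans inter_subset_right)).trans hNU
      refine ⟨hH.compl_null hW1 hyW (hWU.trans subset_closure), ?_⟩
      have i1 : Integrable v (H W y) := integrable_of_bounded hv.lsc.measurable hv.abs_le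
      have i2 : Integrable w (H W y) := integrable_of_bounded hw.lsc.measurable hw.abs_le
      have i3 : Integrable (fun y => v y + w y) (H W y) := i1.add i2
      rw [integral_add i3 (integrable_const _), integral_add i1 i2]
      have e1 := h1 W hW1 hyW (hWN.trans (inter_subset_left.trans inter_subset_left))
      have e2 := h2 W hW1 hyW (hWN.trans (inter_subset_left.trans inter_subset_right))
      simp only [integral_const, probReal_univ, one_smul]
      linarith)
    x (subset_closure hx)
  linarith

/-- A barrier for `U` at the boundary point `z`. -/
def IsBarrier (𝒱 : Set (Set X)) (H : Set X → Kernel X X) (U : Set X) (z : X) (b : X → ℝ) : Prop :=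
  IsHarmonicOn 𝒱 H U b ∧ (∀ x ∈ U, 0 < b x) ∧ Tendsto b (𝓝[U] z) (𝓝 0)

/-- The barrier is weak: away from `z` it need not be bounded below. The upper function is glued
from `f z + ε + e + B` near `z`. Here `B` comes from the barrier and reaches `1` on a compact part
`F` of `U ∩ frontier V`; the rest of that boundary piece has small harmonic measure from `z`, and
`e` takes care of it. -/
theorem IsBarrier.perron_le (hH : IsNormalBauerFamily 𝒱 H) (hU : IsOpen U) {z : X} {b : X → ℝ}
    (hb : IsBarrier 𝒱 H U z b) {f : X → ℝ} (hf : Continuous f)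
    (hf0 : ∀ x, 0 ≤ f x) (hf1 : ∀ x, f x ≤ 1) {ε : ℝ} (hε : 0 < ε) :
    ∀ᶠ x in 𝓝[U] z, perron 𝒱 H U f x ≤ f z + 3 * ε := by
  classical
  let := TopologicalSpace.metrizableSpaceMetric X
  obtain ⟨hbh, hbpos, hblim⟩ := hb
  obtain ⟨V, hV, hzV, hVf⟩ := hH.exists_mem_subset
    (hf.continuousAt.eventually (gt_mem_nhds (lt_add_of_pos_right (f z) hε)))
  have hm := hH.markov V hV
  have hVo := hH.base.isOpen hV
  have hUm : MeasurableSet (U ∩ frontier V) := hU.measurableSet.inter isClosed_frontier.measurableSet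
  -- Inner regularity: `F` is compact inside `U`, where `b` has a positive minimum, and misses less
  -- than `ε` of the harmonic measure on `U ∩ frontier V`.
  obtain ⟨F, hFsub, hFc, hFε⟩ := hUm.exists_isCompact_sdiff_lt (μ := H V z) (measure_ne_top _ _)
    (ε := ENNReal.ofReal ε) (by simpa using hε)
  have hO : IsOpen (U \ F) := hU.sdiff hFc.isClosed
  let o : X → ℝ := (U \ F).indicator fun _ => 1
  have ho : LowerSemicontinuous o := hO.lowerSemicontinuous_indicator zero_le_one
  have ho0 : ∀ x, 0 ≤ o x := fun x => indicator_nonneg (fun _ _ => zero_le_one) x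
  have ho1 : ∀ x, o x ≤ 1 := fun x => indicator_le_self' (fun _ _ => zero_le_one) x
  have hob : ∀ x, |o x| ≤ 1 := fun x => by rw [abs_of_nonneg (ho0 x)]; exact ho1 x
  let e : X → ℝ := fun x => ∫ y, o y ∂(H V x)
  have he : LowerSemicontinuous e := hH.lowerSemicontinuous_integral hV ho ho0 ho1
  have he0 : ∀ x, 0 ≤ e x := fun x => integral_nonneg ho0
  have heb : ∀ x, |e x| ≤ 1 := fun x => abs_integral_le_of_bounded hob
  have hez : e z < ε := by
    have h1 : e z = (H V z).real (U \ F) := integral_indicator_one hO.measurableSet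
    rw [h1, measureReal_def, ← ENNReal.lt_ofReal_iff_toReal_lt (measure_ne_top _ _)]
    refine lt_of_le_of_lt ?_ hFε
    refine (measure_mono (t := (U ∩ frontier V) \ F ∪ (frontier V)ᶜ) fun y hy => ?_).trans
      ((measure_union_le _ _).trans ?_)
    · by_cases hyV : y ∈ frontier V
      · exact Or.inl ⟨⟨hy.1, hyV⟩, hy.2⟩
      · exact Or.inr hyV
    · rw [(hH.boundary V hV).1 z hzV, add_zero]
  have hFU : F ⊆ U := hFsub.trans inter_subset_left
  obtain ⟨β, hβ, hβF⟩ : ∃ β > 0, ∀ y ∈ F, β ≤ b y := by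
    rcases F.eq_empty_or_nonempty with h | h
    · exact ⟨1, one_pos, by simp [h]⟩
    · obtain ⟨y, hy, hmin⟩ := hFc.exists_isMinOn h (hbh.1.mono hFU)
      exact ⟨b y, hbpos y (hFU hy), fun y' hy' => hmin hy'⟩
  -- Truncation at `1` keeps `B` bounded; extension by `0` keeps the nonnegative `B` lower
  -- semicontinuous.
  let B : X → ℝ := U.indicator fun x => min 1 (b x / β)
  have hB0 : ∀ x, 0 ≤ B x := fun x =>
    indicator_nonneg (fun y hy => le_min zero_le_one (div_nonneg (hbpos y hy).le hβ.le)) x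
  have hB1 : ∀ x, B x ≤ 1 := fun x => indicator_le' (fun y _ => min_le_left _ _)
    (fun _ _ => zero_le_one) x
  have hBU : ∀ x ∈ U, B x = min 1 (b x / β) := fun x hx => indicator_of_mem hx _
  have hBlsc : LowerSemicontinuous B := by
    intro y a ha
    change a < B y at ha
    change ∀ᶠ x in 𝓝 y, a < B x
    by_cases hy : y ∈ U
    · have hcont : ContinuousOn B U :=
        (continuousOn_const.inf (hbh.1.div_const β)).congr hBU
      exact (hcont.continuousAt (hU.mem_nhds hy)).eventually (lt_mem_nhds ha)
    · rw [show B y = 0 from indicator_of_notMem hy _] at ha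
      exact .of_forall fun x => ha.trans_le (hB0 x)
  have hBb : ∀ x, |B x| ≤ 1 := fun x => by rw [abs_of_nonneg (hB0 x)]; exact hB1 x
  have ha0 : 0 < f z + ε := by linarith [hf0 z]
  have hup := IsUpper.glue hH hU hf hf0 hf1 hVo (w := fun x => f z + ε + e x + B x)
    ((lowerSemicontinuous_const.add he).add hBlsc)
    (fun x => by linarith [he0 x, hB0 x]) (C := f z + ε + 1 + 1)
    (fun x => by linarith [le_of_abs_le (heb x), hB1 x])
    (fun y hy _ => by linarith [show f y < f z + ε from hVf hy, he0 y, hB0 y])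
    (fun y hy hyU => by
      have hyV : y ∉ V := by rw [hVo.frontier_eq] at hy; exact hy.2
      by_cases hyF : y ∈ F
      · have : B y = 1 := by
          rw [hBU y hyU, min_eq_left]
          rw [le_div_iff₀ hβ, one_mul]
          exact hβF y hyF
        linarith [he0 y]
      · have : e y = 1 := by
          simp only [e]
          rw [hH.integral_of_notMem hV hyV]
          exact indicator_of_mem (show y ∈ U \ F from ⟨hyU, hyF⟩) _
        linarith [hB0 y])
    (by
      rintro y ⟨hyV, hyU⟩
      obtain ⟨N, hN, hNc, hNU⟩ := exists_mem_nhds_isClosed_subset (hU.mem_nhds hyU)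
      refine ⟨V ∩ N, inter_mem (hVo.mem_nhds hyV) hN, fun W hW hyW hWN => ?_⟩
      have := hH.markov W hW
      have hWU := (hNc.closure_subset_iff.2 (hWN.trans inter_subset_right)).trans hNU
      have ie : Integrable e (H W y) := integrable_of_bounded he.measurable heb
      have iB : Integrable B (H W y) := integrable_of_bounded hBlsc.measurable hBb
      have h1 : ∫ x, e x ∂(H W y) = e y :=
        hH.comp_apply hV hW (hWN.trans inter_subset_left) y ho.measurable hob
      have h2 : ∫ x, B x ∂(H W y) ≤ B y := by
        rw [hBU y hyU]
        refine le_min (le_of_abs_le (abs_integral_le_of_bounded hBb)) ?_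
        rw [← hbh.2 W ⟨hW, hWU⟩ y hyW, ← integral_div]
        refine integral_mono_ae iB
          ((hH.integrable_of_continuousOn ⟨hW, hWU⟩ hbh.1 hyW).div_const β) ?_
        filter_upwards [hH.ae_mem hW hyW hWU] with x hx
        rw [hBU x hx]
        exact min_le_right _ _
      have i3 : Integrable (fun x => f z + ε + e x) (H W y) := (integrable_const _).add ie
      change ∫ x, (f z + ε + e x + B x) ∂(H W y) ≤ f z + ε + e y + B y
      rw [integral_add i3 iB, integral_add (integrable_const _) ie]
      simp only [integral_const, probReal_univ, one_smul]
      linarith)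
  have hecont : ContinuousAt e z :=
    (hH.strongFeller V hV o ho.measurable ⟨1, hob⟩).continuousAt (hVo.mem_nhds hzV)
  have hbε : ∀ᶠ x in 𝓝[U] z, b x < ε * β := hblim.eventually (gt_mem_nhds (by positivity))
  filter_upwards [self_mem_nhdsWithin, nhdsWithin_le_nhds (hVo.mem_nhds hzV),
    nhdsWithin_le_nhds (hecont.eventually (gt_mem_nhds hez)), hbε] with x hxU hxV hxe hxb
  have := hup.perron_le x
  simp only [if_pos hxU, if_pos hxV] at this
  have h2 := this.trans (min_le_right _ _)
  have h3 : B x ≤ ε := by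
    rw [hBU x hxU]
    exact (min_le_right _ _).trans ((div_le_iff₀ hβ).2 hxb.le)
  linarith

theorem tendsto_perron (hH : IsNormalBauerFamily 𝒱 H) {P : Set X} (hP : IsPSet 𝒱 H P)
    (hU : IsOpen U) (hUP : U ⊆ P) (hUc : IsCompact (closure U)) {z : X} {b : X → ℝ}
    (hb : IsBarrier 𝒱 H U z b) {f : X → ℝ} (hf : Continuous f)
    (hf0 : ∀ x, 0 ≤ f x) (hf1 : ∀ x, f x ≤ 1) :
    Tendsto (perron 𝒱 H U f) (𝓝[U] z) (𝓝 (f z)) := by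
  have hg : Continuous fun x => 1 - f x := continuous_const.sub hf
  have hg0 : ∀ x, 0 ≤ 1 - f x := fun x => by linarith [hf1 x]
  have hg1 : ∀ x, 1 - f x ≤ 1 := fun x => by linarith [hf0 x]
  rw [Metric.tendsto_nhds]
  intro ε hε
  -- The barrier estimate loses three times its parameter, so a quarter leaves the strict bound.
  have hε' : 0 < ε / 4 := by positivity
  filter_upwards [self_mem_nhdsWithin, hb.perron_le hH hU hf hf0 hf1 hε',
    hb.perron_le hH hU hg hg0 hg1 hε'] with x hxU h1 h2
  have h3 := one_le_perron_add hH hP hU hUP hUc (f := f) (g := fun x => 1 - f x)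
    (fun x => by ring) (exists_isUpper hH hU hf hf0 hf1) (exists_isUpper hH hU hg hg0 hg1) hxU
  rw [Real.dist_eq, abs_lt]
  constructor <;> linarith

/-- Relatively compact open subsets of `𝒫`-sets with barriers at all boundary points are
regular. -/
theorem isRegular_of_barrier (hH : IsNormalBauerFamily 𝒱 H) {P : Set X} (hP : IsPSet 𝒱 H P)
    (hU : IsOpen U) (hUP : U ⊆ P) (hUc : IsCompact (closure U))
    (hb : ∀ z ∈ frontier U, ∃ b, IsBarrier 𝒱 H U z b) : IsRegular 𝒱 H U := by
  classical
  have hFc : IsCompact (frontier U) := hUc.of_isClosed_subset isClosed_frontier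
    frontier_subset_closure
  refine ⟨hU, hUc, fun f hf => ?_⟩
  have huniq : ∀ h h' : X → ℝ, IsDirichletSolution 𝒱 H U f h → IsDirichletSolution 𝒱 H U f h' →
      ∀ x ∈ closure U, h x ≤ h' x := by
    intro h h' hh hh' x hx
    refine sub_nonneg.1 (IsHarmonicOn.nonneg_of_frontier hH hP hU hUP hUc
      (hh'.2.2.sub hH hh.2.2) (hh'.1.sub hh.1) (fun y hy => ?_) x hx)
    rw [hh.2.1 hy, hh'.2.1 hy, sub_self]
  suffices hex : ∃ h, IsDirichletSolution 𝒱 H U f h by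
    obtain ⟨h, hh⟩ := hex
    refine ⟨h, hh, fun h' hh' x hx => le_antisymm (huniq h' h hh' hh x hx)
      (huniq h h' hh hh' x hx), fun h0 => ?_⟩
    exact IsHarmonicOn.nonneg_of_frontier hH hP hU hUP hUc hh.2.2 hh.1
      fun x hx => by rw [hh.2.1 hx]; exact h0 x hx
  obtain ⟨M, hM⟩ := hFc.exists_bound_of_continuousOn hf
  obtain ⟨g, hg⟩ := ContinuousMap.exists_restrict_eq (isClosed_frontier (s := U))
    ⟨_, continuousOn_iff_continuous_domRestrict.1 hf⟩
  have hgf : ∀ x ∈ frontier U, g x = f x := fun x hx => DFunLike.congr_fun hg (⟨x, hx⟩ : frontier U)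
  let M' := |M| + 1
  have hM' : 0 < M' := by positivity
  -- Perron's method was set up for data in `[0, 1]`; the extended boundary function is clamped to
  -- `[-M', M']` and rescaled affinely. The added `1` in `M'` avoids division by zero.
  let k : X → ℝ := fun x => (max (-M') (min M' (g x)) + M') / (2 * M')
  have hk : Continuous k := by fun_prop
  have hk0 : ∀ x, 0 ≤ k x := fun x => by
    have := le_max_left (-M') (min M' (g x))
    exact div_nonneg (by linarith) (by linarith)
  have hk1 : ∀ x, k x ≤ 1 := fun x => by
    have : max (-M') (min M' (g x)) ≤ M' := max_le (by linarith) (min_le_left _ _)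
    rw [div_le_one (by linarith)]
    linarith
  have hkf : ∀ x ∈ frontier U, 2 * M' * k x - M' = f x := fun x hx => by
    have h1 : |f x| ≤ M := hM x hx
    have h2 : |f x| ≤ M' := h1.trans ((le_abs_self M).trans (by simp [M']))
    simp only [k, hgf x hx, min_eq_right (le_of_abs_le h2), max_eq_right (neg_le_of_abs_le h2)]
    field_simp
    ring
  have hne := exists_isUpper (𝒱 := 𝒱) (H := H) (U := U) hH hU hk hk0 hk1
  have hharm := ((perron_harmonic hH hU hne).const_mul (2 * M')).sub hH
    (IsHarmonicOn.const (U := U) hH M')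
  let h : X → ℝ := U.piecewise (fun x => 2 * M' * perron 𝒱 H U k x - M')
    (fun x => 2 * M' * k x - M')
  have hhU : EqOn h (fun x => 2 * M' * perron 𝒱 H U k x - M') U := piecewise_eqOn _ _ _
  have hhUc : ∀ x ∉ U, h x = 2 * M' * k x - M' := fun x hx => piecewise_eq_of_notMem _ _ _ hx
  have hfr : ∀ x ∈ frontier U, x ∉ U := fun x hx => by rw [hU.frontier_eq] at hx; exact hx.2
  refine ⟨h, ?_, fun x hx => ?_, hharm.congr hH hhU⟩
  · intro x hx
    by_cases hxU : x ∈ U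
    · exact (((hharm.1.congr hhU)).continuousAt (hU.mem_nhds hxU)).continuousWithinAt
    · have hxf : x ∈ frontier U := by rw [hU.frontier_eq]; exact ⟨hx, hxU⟩
      obtain ⟨b, hb⟩ := hb x hxf
      have h1 : ContinuousWithinAt h U x := by
        have := ((tendsto_perron hH hP hU hUP hUc hb hk hk0 hk1).const_mul (2 * M')).sub_const M'
        rw [ContinuousWithinAt, hhUc x hxU]
        exact this.congr' (eventually_nhdsWithin_of_forall fun y hy => (hhU hy).symm)
      have h2 : ContinuousWithinAt h Uᶜ x := by
        have : Continuous fun x => 2 * M' * k x - M' := by fun_prop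
        exact this.continuousWithinAt.congr (fun y hy => hhUc y hy) (hhUc x hxU)
      exact ((h1.union h2).mono (by rw [union_compl_self]; exact subset_univ _))
  · rw [hhUc x (hfr x hx), hkf x hx]

end Perron
end Darning

namespace Darning

/-! ### Harmonic kernels of regular sets, by Riesz representation. -/

section HarmonicKernel

open CompactlySupported

variable {X : Type*} [TopologicalSpace X] [T2Space X] [LocallyCompactSpace X]
    [SecondCountableTopology X] [MeasurableSpace X] [BorelSpace X]
    {𝒱 : Set (Set X)} {H : Set X → Kernel X X} {U : Set X}

theorem IsHarmonicOn.add (hH : IsNormalBauerFamily 𝒱 H) {f g : X → ℝ}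
    (hf : IsHarmonicOn 𝒱 H U f) (hg : IsHarmonicOn 𝒱 H U g) :
    IsHarmonicOn 𝒱 H U fun x => f x + g x := by
  refine ⟨hf.1.add hg.1, fun W hW x hx => ?_⟩
  rw [integral_add (hH.integrable_of_continuousOn hW hf.1 hx)
    (hH.integrable_of_continuousOn hW hg.1 hx), hf.2 W hW x hx, hg.2 W hW x hx]

theorem IsRegular.isCompact_frontier (hU : IsRegular 𝒱 H U) : IsCompact (frontier U) :=
  hU.2.1.of_isClosed_subset isClosed_frontier frontier_subset_closure

theorem IsRegular.eqOn (hU : IsRegular 𝒱 H U) {f h h' : X → ℝ} (hf : ContinuousOn f (frontier U))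
    (hh : IsDirichletSolution 𝒱 H U f h) (hh' : IsDirichletSolution 𝒱 H U f h') :
    EqOn h h' (closure U) := by
  obtain ⟨k, -, huniq, -⟩ := hU.2.2 f hf
  exact (huniq h hh).trans (huniq h' hh').symm

theorem IsRegular.nonneg (hU : IsRegular 𝒱 H U) {f h : X → ℝ} (hf : ContinuousOn f (frontier U))
    (hh : IsDirichletSolution 𝒱 H U f h) (h0 : ∀ x ∈ frontier U, 0 ≤ f x) :
    ∀ x ∈ closure U, 0 ≤ h x := by
  obtain ⟨k, -, huniq, hpos⟩ := hU.2.2 f hf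
  intro x hx
  rw [huniq h hh hx]
  exact hpos h0 x hx

theorem IsRegular.exists_solution (hU : IsRegular 𝒱 H U) {f : X → ℝ}
    (hf : ContinuousOn f (frontier U)) : ∃ h, IsDirichletSolution 𝒱 H U f h :=
  let ⟨h, hh, _⟩ := hU.2.2 f hf
  ⟨h, hh⟩

open Classical in
/-- The solution of the Dirichlet problem. -/
noncomputable def dirichlet (𝒱 : Set (Set X)) (H : Set X → Kernel X X) (U : Set X)
    (f : X → ℝ) : X → ℝ :=
  if h : ∃ h, IsDirichletSolution 𝒱 H U f h then h.choose else 0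

theorem IsRegular.dirichlet_spec (hU : IsRegular 𝒱 H U) {f : X → ℝ}
    (hf : ContinuousOn f (frontier U)) :
    IsDirichletSolution 𝒱 H U f (dirichlet 𝒱 H U f) := by
  rw [dirichlet, dif_pos (hU.exists_solution hf)]
  exact (hU.exists_solution hf).choose_spec

/-- Evaluation of the solution of the Dirichlet problem as a positive functional. -/
noncomputable def dirichletFunctional (hH : IsNormalBauerFamily 𝒱 H) (hU : IsRegular 𝒱 H U)
    {x : X} (hx : x ∈ U) : C_c(X, ℝ) →ₚ[ℝ] ℝ where
  toFun f := dirichlet 𝒱 H U f x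
  map_add' f g := by
    have hf := hU.dirichlet_spec (f := ⇑f) f.continuous.continuousOn
    have hg := hU.dirichlet_spec (f := ⇑g) g.continuous.continuousOn
    exact hU.eqOn (f + g).continuous.continuousOn
      (hU.dirichlet_spec (f + g).continuous.continuousOn)
      ⟨hf.1.add hg.1, fun y hy => by simp [hf.2.1 hy, hg.2.1 hy], hf.2.2.add hH hg.2.2⟩
      (subset_closure hx)
  map_smul' c f := by
    have hf := hU.dirichlet_spec (f := ⇑f) f.continuous.continuousOn
    exact hU.eqOn (c • f).continuous.continuousOn
      (hU.dirichlet_spec (c • f).continuous.continuousOn)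
      ⟨hf.1.const_mul c, fun y hy => by simp [hf.2.1 hy], hf.2.2.const_mul c⟩
      (subset_closure hx)
  monotone' f g hfg := by
    have hf := hU.dirichlet_spec (f := ⇑f) f.continuous.continuousOn
    have hg := hU.dirichlet_spec (f := ⇑g) g.continuous.continuousOn
    exact sub_nonneg.1 (hU.nonneg (g - f).continuous.continuousOn (f := ⇑(g - f))
      ⟨hg.1.sub hf.1, fun y hy => by simp [hf.2.1 hy, hg.2.1 hy], hg.2.2.sub hH hf.2.2⟩
      (fun y _ => by simpa using sub_nonneg.2 (hfg y)) x (subset_closure hx))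

/-- The harmonic measure at a point of a regular set. -/
noncomputable def harmonicMeasure (hH : IsNormalBauerFamily 𝒱 H) (hU : IsRegular 𝒱 H U)
    {x : X} (hx : x ∈ U) : Measure X :=
  RealRMK.rieszMeasure (dirichletFunctional hH hU hx)

/-- A compact set off the boundary has a bump function vanishing on `frontier U`, whose Dirichlet
solution is `0` by uniqueness; inner regularity does the rest. -/
theorem harmonicMeasure_compl (hH : IsNormalBauerFamily 𝒱 H) (hU : IsRegular 𝒱 H U)
    {x : X} (hx : x ∈ U) : harmonicMeasure hH hU hx (frontier U)ᶜ = 0 := by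
  have : (harmonicMeasure hH hU hx).Regular := RealRMK.regular_rieszMeasure _
  rw [isClosed_frontier.isOpen_compl.measure_eq_iSup_isCompact]
  simp only [ENNReal.iSup_eq_zero]
  intro C hC hCc
  obtain ⟨f, hf1, hf2, hf3⟩ := exists_continuousMap_one_of_isCompact_subset_isOpen hCc
    isClosed_frontier.isOpen_compl hC
  let g : C_c(X, ℝ) := ⟨f, hf2⟩
  have hg0 : ∀ y ∈ frontier U, g y = 0 := fun y hy =>
    image_eq_zero_of_notMem_tsupport fun h => hf3.1 h hy
  have hle := RealRMK.rieszMeasure_le_of_eq_one (dirichletFunctional hH hU hx) (f := g)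
    (fun y => (hf3.2 y).1) hCc fun y hy => hf1 hy
  have h0 : dirichletFunctional hH hU hx g = 0 :=
    hU.eqOn g.continuous.continuousOn (hU.dirichlet_spec (f := ⇑g) g.continuous.continuousOn)
      (h' := fun _ => 0) ⟨continuousOn_const, fun y hy => (hg0 y hy).symm, IsHarmonicOn.const hH 0⟩
      (subset_closure hx)
  rw [h0, ENNReal.ofReal_zero] at hle
  exact le_antisymm hle zero_le

theorem exists_compactlySupported_eqOn {Y : Set X} (hY : IsCompact Y) {f : X → ℝ}
    (hf : ContinuousOn f Y) : ∃ g : C_c(X, ℝ), EqOn g f Y := by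
  obtain ⟨g, hg⟩ := ContinuousMap.exists_restrict_eq hY.isClosed
    ⟨_, continuousOn_iff_continuous_domRestrict.1 hf⟩
  obtain ⟨k, hk1, hk2, -⟩ := exists_continuousMap_one_of_isCompact_subset_isOpen hY isOpen_univ
    (subset_univ _)
  refine ⟨⟨g * k, HasCompactSupport.mul_left hk2⟩, fun y hy => ?_⟩
  have h1 : k y = 1 := hk1 hy
  have h2 : g y = f y := DFunLike.congr_fun hg (⟨y, hy⟩ : Y)
  simp [h1, h2]

theorem integral_harmonicMeasure (hH : IsNormalBauerFamily 𝒱 H) (hU : IsRegular 𝒱 H U)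
    {x : X} (hx : x ∈ U) {f h : X → ℝ} (hf : ContinuousOn f (frontier U))
    (hh : IsDirichletSolution 𝒱 H U f h) : ∫ y, f y ∂(harmonicMeasure hH hU hx) = h x := by
  obtain ⟨g, hg⟩ := exists_compactlySupported_eqOn hU.isCompact_frontier hf
  have hae : ∀ᵐ y ∂(harmonicMeasure hH hU hx), y ∈ frontier U := by
    have := harmonicMeasure_compl hH hU hx
    rwa [← mem_ae_iff] at this
  rw [integral_congr_ae (g := g) (hae.mono fun y hy => (hg hy).symm)]
  rw [harmonicMeasure, RealRMK.integral_rieszMeasure]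
  exact hU.eqOn g.continuous.continuousOn (hU.dirichlet_spec (f := ⇑g) g.continuous.continuousOn)
    ⟨hh.1, hh.2.1.trans hg.symm, hh.2.2⟩ (subset_closure hx)

theorem IsHarmonicKernel.isMarkovKernel (hH : IsNormalBauerFamily 𝒱 H) {T : Kernel X X}
    (hT : IsHarmonicKernel 𝒱 H U T) : IsMarkovKernel T := by
  refine ⟨fun x => ?_⟩
  by_cases hx : x ∈ U
  · have := hT.2 (fun _ => 1) (fun _ => 1) continuousOn_const
      ⟨continuousOn_const, fun _ _ => rfl, IsHarmonicOn.const hH 1⟩ x hx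
    simp only [integral_const, smul_eq_mul, mul_one] at this
    refine ⟨?_⟩
    rw [measureReal_def] at this
    rw [← ENNReal.toReal_eq_one_iff, this]
  · rw [hT.1.2 x hx]
    infer_instance

theorem isProbabilityMeasure_harmonicMeasure (hH : IsNormalBauerFamily 𝒱 H)
    (hU : IsRegular 𝒱 H U) {x : X} (hx : x ∈ U) :
    IsProbabilityMeasure (harmonicMeasure hH hU hx) := by
  have := integral_harmonicMeasure hH hU hx (f := fun _ => 1) (h := fun _ => 1) continuousOn_const
    ⟨continuousOn_const, fun _ _ => rfl, IsHarmonicOn.const hH 1⟩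
  simp only [integral_const, smul_eq_mul, mul_one] at this
  refine ⟨?_⟩
  rw [measureReal_def] at this
  rw [← ENNReal.toReal_eq_one_iff, this]

/-- Families of probability measures are measurable if the integrals of bounded continuous
functions are. -/
theorem measurable_of_forall_continuous {Y : Type*} [MeasurableSpace Y] {κ : Y → Measure X}
    [∀ y, IsProbabilityMeasure (κ y)]
    (h : ∀ φ : X → ℝ, Continuous φ → Measurable fun y => ∫ x, φ x ∂(κ y)) : Measurable κ := by
  refine Measurable.measure_of_isPiSystem_of_isProbabilityMeasure
    (S := {s : Set X | IsClosed s})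
    (by rw [← borel_eq_generateFrom_isClosed]; exact BorelSpace.measurable_eq)
    isPiSystem_isClosed fun F hF => ?_
  refine measurable_of_tendsto_metrizable (f := fun n y =>
    ENNReal.ofReal (∫ x, (hF.apprSeq n x : ℝ) ∂(κ y))) (fun n => ?_)
    (tendsto_pi_nhds.2 fun y => ?_)
  · exact ENNReal.measurable_ofReal.comp
      (h _ (NNReal.continuous_coe.comp (hF.apprSeq n).continuous))
  · refine (HasOuterApproxClosed.tendsto_lintegral_apprSeq hF (κ y)).congr fun n => ?_
    rw [← BoundedContinuousFunction.toReal_lintegral_coe_eq_integral (hF.apprSeq n) (κ y),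
      ENNReal.ofReal_toReal
        (BoundedContinuousFunction.lintegral_lt_top_of_nnreal (κ y) (hF.apprSeq n)).ne]

/-- Only measurability in the starting point is at stake. For continuous `φ` the integral is the
Dirichlet solution on `U` and `φ` off `U`, each continuous on its piece. -/
theorem IsRegular.exists_isHarmonicKernel (hH : IsNormalBauerFamily 𝒱 H) (hU : IsRegular 𝒱 H U) :
    ∃ T : Kernel X X, IsHarmonicKernel 𝒱 H U T := by
  classical
  let κ : X → Measure X := fun x =>
    if hx : x ∈ U then harmonicMeasure hH hU hx else Measure.dirac x
  have hκU : ∀ x (hx : x ∈ U), κ x = harmonicMeasure hH hU hx := fun x hx => dif_pos hx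
  have hκU' : ∀ x, x ∉ U → κ x = Measure.dirac x := fun x hx => dif_neg hx
  have hprob : ∀ x, IsProbabilityMeasure (κ x) := fun x => by
    by_cases hx : x ∈ U
    · rw [hκU x hx]; exact isProbabilityMeasure_harmonicMeasure hH hU hx
    · rw [hκU' x hx]; infer_instance
  have hmeas : Measurable κ := by
    refine measurable_of_forall_continuous fun φ hφ => ?_
    have hs := hU.dirichlet_spec (f := φ) hφ.continuousOn
    have : (fun y => ∫ x, φ x ∂(κ y)) = U.piecewise (dirichlet 𝒱 H U φ) φ := by
      funext y
      by_cases hy : y ∈ U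
      · rw [hκU y hy, integral_harmonicMeasure hH hU hy hφ.continuousOn hs,
          piecewise_eq_of_mem _ _ _ hy]
      · rw [hκU' y hy, integral_dirac, piecewise_eq_of_notMem _ _ _ hy]
    rw [this]
    exact hs.2.2.1.measurable_piecewise hφ.continuousOn hU.1.measurableSet
  refine ⟨⟨κ, hmeas⟩, ⟨fun x hx => ?_, fun x hx => hκU' x hx⟩, fun f h hf hh x hx => ?_⟩
  · change κ x _ = 0
    rw [hκU x hx]
    exact harmonicMeasure_compl hH hU hx
  · change ∫ y, f y ∂(κ x) = _
    rw [hκU x hx]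
    exact integral_harmonicMeasure hH hU hx hf hh

variable (hH : IsNormalBauerFamily 𝒱 H) (hU : IsRegular 𝒱 H U)
include hH hU

theorem IsRegular.isHarmonicKernel : IsHarmonicKernel 𝒱 H U (harmonicKernel 𝒱 H U) := by
  rw [harmonicKernel, dif_pos (hU.exists_isHarmonicKernel hH)]
  exact (hU.exists_isHarmonicKernel hH).choose_spec

theorem IsRegular.isMarkovKernel : IsMarkovKernel (harmonicKernel 𝒱 H U) :=
  (hU.isHarmonicKernel hH).isMarkovKernel hH

theorem IsRegular.kernel_of_notMem {x : X} (hx : x ∉ U) :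
    harmonicKernel 𝒱 H U x = Measure.dirac x :=
  (hU.isHarmonicKernel hH).1.2 x hx

theorem IsRegular.integral_of_notMem {x : X} (hx : x ∉ U) (f : X → ℝ) :
    ∫ y, f y ∂(harmonicKernel 𝒱 H U x) = f x := by
  rw [hU.kernel_of_notMem hH hx, integral_dirac]

theorem IsRegular.ae_frontier {x : X} (hx : x ∈ U) :
    ∀ᵐ y ∂(harmonicKernel 𝒱 H U x), y ∈ frontier U := by
  have := (hU.isHarmonicKernel hH).1.1 x hx
  rwa [← mem_ae_iff] at this

theorem IsRegular.integral_eq {q : X → ℝ} (hq : ContinuousOn q (closure U))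
    (hqh : IsHarmonicOn 𝒱 H U q) (x : X) : ∫ y, q y ∂(harmonicKernel 𝒱 H U x) = q x := by
  by_cases hx : x ∈ U
  · exact (hU.isHarmonicKernel hH).2 q q (hq.mono frontier_subset_closure)
      ⟨hq, fun _ _ => rfl, hqh⟩ x hx
  · exact hU.integral_of_notMem hH hx q

theorem IsRegular.integral_eqOn_dirichlet {f : X → ℝ} (hf : ContinuousOn f (frontier U)) :
    EqOn (fun x => ∫ y, f y ∂(harmonicKernel 𝒱 H U x)) (dirichlet 𝒱 H U f) (closure U) := by
  have hs := hU.dirichlet_spec hf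
  intro x hx
  by_cases hxU : x ∈ U
  · exact (hU.isHarmonicKernel hH).2 f _ hf hs x hxU
  · exact (hU.integral_of_notMem hH hxU f).trans
      (hs.2.1 (by rw [hU.1.frontier_eq]; exact ⟨hx, hxU⟩)).symm

theorem IsRegular.isHarmonicOn_integral {f : X → ℝ} (hf : ContinuousOn f (frontier U)) :
    IsHarmonicOn 𝒱 H U fun x => ∫ y, f y ∂(harmonicKernel 𝒱 H U x) :=
  (hU.dirichlet_spec hf).2.2.congr hH
    ((hU.integral_eqOn_dirichlet hH hf).mono subset_closure)

theorem IsRegular.continuous_integral {f : X → ℝ} (hf : Continuous f) :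
    Continuous fun x => ∫ y, f y ∂(harmonicKernel 𝒱 H U x) := by
  have h1 := (hU.dirichlet_spec hf.continuousOn).1.congr
    (hU.integral_eqOn_dirichlet hH hf.continuousOn)
  have h2 : ContinuousOn (fun x => ∫ y, f y ∂(harmonicKernel 𝒱 H U x)) Uᶜ :=
    hf.continuousOn.congr fun x hx => hU.integral_of_notMem hH hx f
  have := h1.union_of_isClosed h2 isClosed_closure hU.1.isClosed_compl
  rwa [show closure U ∪ Uᶜ = univ from
    eq_univ_of_forall fun x => (em (x ∈ U)).imp (fun h => subset_closure h) id,
    continuousOn_univ] at this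

theorem IsRegular.comp_apply {W : Set X} (hW : W ∈ inside 𝒱 U) {x : X} (hx : x ∈ W) :
    (harmonicKernel 𝒱 H U ∘ₖ H W) x = harmonicKernel 𝒱 H U x := by
  have := hU.isMarkovKernel hH
  have := hH.markov W hW.1
  refine ext_of_forall_integral_eq_of_IsFiniteMeasure fun f => ?_
  rw [Kernel.integral_comp (f.integrable _)]
  exact (hU.isHarmonicOn_integral hH f.continuous.continuousOn).2 W hW x hx

/-- On a small `W` one has `H_U f = H_W (H_U f)`, so the smoothing property of `H_W` is inherited.
-/
theorem IsRegular.strongFeller {f : X → ℝ} (hf : Measurable f) {C : ℝ} (hC : ∀ x, |f x| ≤ C) :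
    ContinuousOn (fun x => ∫ y, f y ∂(harmonicKernel 𝒱 H U x)) U := by
  intro x hx
  have := hU.isMarkovKernel hH
  obtain ⟨W, hW, hxW, hWU⟩ := hH.exists_mem_subset (hU.1.mem_nhds hx)
  have hm := hH.markov W hW
  have hc := hH.strongFeller W hW _ (measurable_integral_kernel (harmonicKernel 𝒱 H U) hf)
    ⟨C, fun y => abs_integral_le_of_bounded hC⟩
  have hcongr : EqOn (fun x => ∫ y, f y ∂(harmonicKernel 𝒱 H U x))
      (fun x => ∫ z, ∫ y, f y ∂(harmonicKernel 𝒱 H U z) ∂(H W x)) W := by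
    intro z hz
    have := hU.comp_apply hH ⟨hW, hWU⟩ hz
    simp only
    conv_lhs => rw [← this]
    exact Kernel.integral_comp (integrable_of_bounded hf hC)
  exact ((hc.congr hcongr).continuousAt ((hH.base.isOpen hW).mem_nhds hxW)).continuousWithinAt

end HarmonicKernel
end Darning

namespace Darning

/-! ### The gauge function, the shells and sweeping between levels. -/

section Setup

variable {X : Type*} [TopologicalSpace X] [T2Space X] [LocallyCompactSpace X]
    [SecondCountableTopology X] [MeasurableSpace X] [BorelSpace X]
    {𝒱 : Set (Set X)} {H : Set X → Kernel X X} {K W₀ : Set X} {G : X → ℝ}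

/-- `G` is a continuous function on `X` which vanishes exactly on `K`, equals `1` off `W₀`, and
coincides with the gauge on `W₀ \ K`. -/
structure IsGauge (𝒱 : Set (Set X)) (H : Set X → Kernel X X) (K W₀ : Set X) (G : X → ℝ) :
    Prop where
  bauer : IsNormalBauerFamily 𝒱 H
  isPSet : IsPSet 𝒱 H W₀
  isCompact : IsCompact K
  continuous : Continuous G
  nonneg : ∀ x, 0 ≤ G x
  eq_zero_iff : ∀ x, G x = 0 ↔ x ∈ K
  harmonic : IsHarmonicOn 𝒱 H (W₀ \ K) G
  isCompact_le : ∀ r < 1, IsCompact {x | G x ≤ r}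
  mem_of_lt : ∀ x, G x < 1 → x ∈ W₀
  eq_gauge : ∀ x ∈ W₀ \ K, gauge 𝒱 H K W₀ x = G x

/-- `G` is the harmonic extension into `W₀ \ K` of the function `0` on `W₀`, `1` off `W₀`. That
function is continuous on the boundary of `W₀ \ K`, because `K` lies in the open set `W₀` and is
closed. Strict positivity of the gauge makes `K` the exact zero set. -/
theorem exists_isGauge (hH : IsNormalBauerFamily 𝒱 H) (hK : IsCompact K) (hKW : K ⊆ W₀)
    (hWP : IsPSet 𝒱 H W₀) (hWc : IsCompact (closure W₀)) (hD : IsRegular 𝒱 H (W₀ \ K))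
    (hg : ∀ x ∈ W₀ \ K, 0 < gauge 𝒱 H K W₀ x) : ∃ G, IsGauge 𝒱 H K W₀ G := by
  classical
  have hm := hD.isMarkovKernel hH
  set D := W₀ \ K with hDdef
  let f : X → ℝ := fun x => if x ∈ W₀ then 0 else 1
  have hf0 : ∀ x, 0 ≤ f x := fun x => by simp only [f]; split_ifs <;> norm_num
  have hf1 : ∀ x, f x ≤ 1 := fun x => by simp only [f]; split_ifs <;> norm_num
  have hfb : ∀ x, |f x| ≤ 1 := fun x => by rw [abs_of_nonneg (hf0 x)]; exact hf1 x
  have hfW : ∀ x ∈ W₀, f x = 0 := fun x hx => if_pos hx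
  have hfW' : ∀ x, x ∉ W₀ → f x = 1 := fun x hx => if_neg hx
  have hfr : ∀ x ∈ frontier D, x ∈ closure W₀ ∧ (x ∈ W₀ → x ∈ K) := by
    intro x hx
    rw [hD.1.frontier_eq] at hx
    exact ⟨closure_mono sdiff_subset hx.1, fun h => by_contra fun hxK => hx.2 ⟨h, hxK⟩⟩
  have hfc : ContinuousOn f (frontier D) := by
    intro x hx
    by_cases hxW : x ∈ W₀
    · have : f =ᶠ[𝓝 x] fun _ => 0 := by
        filter_upwards [hWP.1.mem_nhds hxW] with y hy using hfW y hy
      exact (continuousAt_const.congr this.symm).continuousWithinAt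
    · have hxK : x ∈ Kᶜ := fun h => hxW (hKW h)
      have : f =ᶠ[𝓝[frontier D] x] fun _ => 1 := by
        filter_upwards [self_mem_nhdsWithin,
          nhdsWithin_le_nhds (hK.isClosed.isOpen_compl.mem_nhds hxK)] with y hy hyK
        exact hfW' y fun h => hyK ((hfr y hy).2 h)
      exact continuousWithinAt_const.congr_of_eventuallyEq this (hfW' x hxW)
  let G : X → ℝ := fun x => ∫ y, f y ∂(harmonicKernel 𝒱 H D x)
  have hGK : ∀ x ∈ K, G x = 0 := fun x hx => by
    simp only [G]
    rw [hD.integral_of_notMem hH (fun h => h.2 hx), hfW x (hKW hx)]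
  have hGW : ∀ x, x ∉ W₀ → G x = 1 := fun x hx => by
    simp only [G]
    rw [hD.integral_of_notMem hH (fun h => hx h.1), hfW' x hx]
  have hgauge : ∀ x ∈ D, gauge 𝒱 H K W₀ x = G x := by
    intro x hx
    rw [gauge, ← integral_indicator_one isClosed_frontier.measurableSet]
    refine integral_congr_ae ((hD.ae_frontier hH hx).mono fun y hy => ?_)
    by_cases hyW : y ∈ W₀
    · simp only [hfW y hyW]
      exact indicator_of_notMem (fun h => by rw [hWP.1.frontier_eq] at h; exact h.2 hyW) _
    · simp only [hfW' y hyW]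
      exact indicator_of_mem (by rw [hWP.1.frontier_eq]; exact ⟨(hfr y hy).1, hyW⟩) _
  have hcont : Continuous G := by
    have h1 : ContinuousOn G (closure D) :=
      (hD.dirichlet_spec hfc).1.congr (hD.integral_eqOn_dirichlet hH hfc)
    have h2 : ContinuousOn G K := continuousOn_const.congr hGK
    have h3 : ContinuousOn G W₀ᶜ := continuousOn_const.congr hGW
    have := (h1.union_of_isClosed h2 isClosed_closure hK.isClosed).union_of_isClosed h3
      (isClosed_closure.union hK.isClosed) hWP.1.isClosed_compl
    rwa [show closure D ∪ K ∪ W₀ᶜ = univ from eq_univ_of_forall fun x => by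
      by_cases hxW : x ∈ W₀
      · by_cases hxK : x ∈ K
        · exact Or.inl (Or.inr hxK)
        · exact Or.inl (Or.inl (subset_closure ⟨hxW, hxK⟩))
      · exact Or.inr hxW, continuousOn_univ] at this
  have hlt : ∀ x, G x < 1 → x ∈ W₀ := fun x hx => by
    by_contra h
    exact absurd (hGW x h) hx.ne
  refine ⟨G, hH, hWP, hK, hcont, fun x => integral_nonneg hf0, fun x => ⟨fun h => ?_, hGK x⟩,
    hD.isHarmonicOn_integral hH hfc, fun r hr => ?_, hlt, hgauge⟩
  · have hxW := hlt x (by rw [h]; exact one_pos)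
    by_contra hxK
    have := hg x ⟨hxW, hxK⟩
    rw [hgauge x ⟨hxW, hxK⟩, h] at this
    exact lt_irrefl _ this
  · exact hWc.of_isClosed_subset (isClosed_le hcont continuous_const)
      fun x hx => subset_closure (hlt x (lt_of_le_of_lt hx hr))

namespace IsGauge

variable (hG : IsGauge 𝒱 H K W₀ G)
include hG

theorem pos_iff (x : X) : 0 < G x ↔ x ∉ K := by
  rw [← hG.eq_zero_iff, lt_iff_le_and_ne]
  exact ⟨fun h => h.2.symm, fun h => ⟨hG.nonneg x, Ne.symm h⟩⟩

theorem mem_shell {r : ℝ} (hr : r ≤ 1) {x : X} :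
    x ∈ shell 𝒱 H K W₀ r ↔ 0 < G x ∧ G x < r := by
  rw [hG.pos_iff]
  constructor
  · rintro ⟨hx, hlt⟩
    exact ⟨hx.2, by rwa [hG.eq_gauge x hx] at hlt⟩
  · rintro ⟨hx, hlt⟩
    have hxD : x ∈ W₀ \ K := ⟨hG.mem_of_lt x (hlt.trans_le hr), hx⟩
    exact ⟨hxD, by rwa [hG.eq_gauge x hxD]⟩

theorem mem_level {r : ℝ} (hr : r ∈ Ioo (0 : ℝ) 1) {x : X} :
    x ∈ level 𝒱 H K W₀ r ↔ G x = r := by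
  constructor
  · rintro ⟨hx, h⟩
    rwa [hG.eq_gauge x hx] at h
  · intro h
    have hxD : x ∈ W₀ \ K := ⟨hG.mem_of_lt x (h ▸ hr.2), (hG.pos_iff x).1 (h ▸ hr.1)⟩
    exact ⟨hxD, by rwa [hG.eq_gauge x hxD]⟩

theorem shell_subset (r : ℝ) : shell 𝒱 H K W₀ r ⊆ W₀ \ K := fun _ hx => hx.1

theorem isOpen_diff : IsOpen (W₀ \ K) := hG.isPSet.1.sdiff hG.isCompact.isClosed

theorem shell_eq {r : ℝ} (hr : r ≤ 1) : shell 𝒱 H K W₀ r = {x | 0 < G x ∧ G x < r} :=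
  ext fun _ => hG.mem_shell hr

theorem isOpen_shell {r : ℝ} (hr : r ≤ 1) : IsOpen (shell 𝒱 H K W₀ r) := by
  rw [hG.shell_eq hr]
  exact (isOpen_lt continuous_const hG.continuous).inter
    (isOpen_lt hG.continuous continuous_const)

theorem closure_shell_subset {r : ℝ} (hr : r ≤ 1) :
    closure (shell 𝒱 H K W₀ r) ⊆ {x | G x ≤ r} :=
  closure_minimal (fun _ hx => ((hG.mem_shell hr).1 hx).2.le)
    (isClosed_le hG.continuous continuous_const)

theorem frontier_shell {r : ℝ} (hr : r ≤ 1) {x : X} (hx : x ∈ frontier (shell 𝒱 H K W₀ r)) :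
    G x = 0 ∨ G x = r := by
  rw [(hG.isOpen_shell hr).frontier_eq, Set.mem_sdiff, hG.mem_shell hr] at hx
  have h1 : G x ≤ r := hG.closure_shell_subset hr hx.1
  rcases (hG.nonneg x).eq_or_lt with h | h
  · exact Or.inl h.symm
  · exact Or.inr (le_antisymm h1 (not_lt.1 fun h2 => hx.2 ⟨h, h2⟩))

theorem isCompact_closure_shell {r : ℝ} (hr : r < 1) : IsCompact (closure (shell 𝒱 H K W₀ r)) :=
  (hG.isCompact_le r hr).of_isClosed_subset isClosed_closure (hG.closure_shell_subset hr.le)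

theorem harmonic_shell (r : ℝ) : IsHarmonicOn 𝒱 H (shell 𝒱 H K W₀ r) G :=
  hG.harmonic.mono (hG.shell_subset r)

/-- `G` is a barrier at every boundary point with `G = 0`, and `r - G` at every boundary point with
`G = r`. -/
theorem isRegular_shell {r : ℝ} (hr : r < 1) : IsRegular 𝒱 H (shell 𝒱 H K W₀ r) := by
  refine isRegular_of_barrier hG.bauer hG.isPSet (hG.isOpen_shell hr.le)
    ((hG.shell_subset r).trans sdiff_subset) (hG.isCompact_closure_shell hr) fun z hz => ?_
  rcases hG.frontier_shell hr.le hz with h | h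
  · refine ⟨G, hG.harmonic_shell r, fun x hx => ((hG.mem_shell hr.le).1 hx).1, ?_⟩
    have := hG.continuous.continuousAt (x := z)
    rw [ContinuousAt, h] at this
    exact this.mono_left nhdsWithin_le_nhds
  · refine ⟨fun x => r - G x, (IsHarmonicOn.const hG.bauer r).sub hG.bauer (hG.harmonic_shell r),
      fun x hx => sub_pos.2 ((hG.mem_shell hr.le).1 hx).2, ?_⟩
    have := hG.continuous.continuousAt (x := z) |>.const_sub r
    rw [h, sub_self] at this
    exact this.mono_left nhdsWithin_le_nhds

end IsGauge

/-- The integral of `f` over `{t ≤ G}` with respect to the harmonic kernel of the shell `A_t`. -/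
noncomputable def sweepFun (𝒱 : Set (Set X)) (H : Set X → Kernel X X) (K W₀ : Set X) (G : X → ℝ)
    (t : ℝ) (f : X → ℝ) (x : X) : ℝ :=
  ∫ y in {y | t ≤ G y}, f y ∂(harmonicKernel 𝒱 H (shell 𝒱 H K W₀ t) x)

namespace IsGauge

variable (hG : IsGauge 𝒱 H K W₀ G)
include hG

theorem measurableSet_le (t : ℝ) : MeasurableSet {y | t ≤ G y} :=
  (isClosed_le continuous_const hG.continuous).measurableSet

theorem ae_shell {t : ℝ} (ht : t ∈ Ioo (0 : ℝ) 1) (x : X) :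
    ∀ᵐ y ∂(harmonicKernel 𝒱 H (shell 𝒱 H K W₀ t) x), G y = 0 ∨ t ≤ G y := by
  have hreg := hG.isRegular_shell ht.2
  by_cases hx : x ∈ shell 𝒱 H K W₀ t
  · filter_upwards [hreg.ae_frontier hG.bauer hx] with y hy
    exact (hG.frontier_shell ht.2.le hy).imp id fun h => h.ge
  · rw [hreg.kernel_of_notMem hG.bauer hx, ae_dirac_eq, eventually_pure]
    rw [hG.mem_shell ht.2.le] at hx
    rcases (hG.nonneg x).eq_or_lt with h | h
    · exact Or.inl h.symm
    · exact Or.inr (not_lt.1 fun h2 => hx ⟨h, h2⟩)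

/-- The kernel of `A_t` charges only `{G = 0} ∪ {t ≤ G}`, so the discontinuous truncation to `{t ≤
G}` may be replaced by any `φ` with the right values there, in particular by a continuous one. -/
theorem sweepFun_eq {t : ℝ} (ht : t ∈ Ioo (0 : ℝ) 1) {f φ : X → ℝ} (h0 : ∀ x, G x = 0 → φ x = 0)
    (h1 : ∀ x, t ≤ G x → φ x = f x) (x : X) :
    sweepFun 𝒱 H K W₀ G t f x = ∫ y, φ y ∂(harmonicKernel 𝒱 H (shell 𝒱 H K W₀ t) x) := by
  rw [sweepFun, ← integral_indicator (hG.measurableSet_le t)]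
  refine integral_congr_ae ((hG.ae_shell ht x).mono fun y hy => ?_)
  rcases hy with hy | hy
  · have : y ∉ {y | t ≤ G y} := fun h => by
      have : t ≤ G y := h
      linarith [ht.1]
    simp only [indicator_of_notMem this, h0 y hy]
  · rw [indicator_of_mem (show y ∈ {y | t ≤ G y} from hy), h1 y hy]

theorem exists_cutoff {t : ℝ} (ht : 0 < t) {f : X → ℝ} (hf : Continuous f) :
    ∃ φ : X → ℝ, Continuous φ ∧ (∀ x, G x = 0 → φ x = 0) ∧ (∀ x, t ≤ G x → φ x = f x) := by
  refine ⟨fun x => min 1 (G x / t) * f x, ?_, fun x hx => ?_, fun x hx => ?_⟩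
  · have := hG.continuous
    fun_prop
  · simp [hx]
  · simp only [min_eq_left ((one_le_div ht).2 hx), one_mul]

theorem continuous_sweepFun {t : ℝ} (ht : t ∈ Ioo (0 : ℝ) 1) {f : X → ℝ} (hf : Continuous f) :
    Continuous (sweepFun 𝒱 H K W₀ G t f) := by
  obtain ⟨φ, hφ, h0, h1⟩ := hG.exists_cutoff ht.1 hf
  rw [funext (hG.sweepFun_eq ht h0 h1)]
  exact (hG.isRegular_shell ht.2).continuous_integral hG.bauer hφ

theorem harmonic_sweepFun {t : ℝ} (ht : t ∈ Ioo (0 : ℝ) 1) {f : X → ℝ} (hf : Continuous f) :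
    IsHarmonicOn 𝒱 H (shell 𝒱 H K W₀ t) (sweepFun 𝒱 H K W₀ G t f) := by
  obtain ⟨φ, hφ, h0, h1⟩ := hG.exists_cutoff ht.1 hf
  rw [funext (hG.sweepFun_eq ht h0 h1)]
  exact (hG.isRegular_shell ht.2).isHarmonicOn_integral hG.bauer hφ.continuousOn

theorem sweepFun_of_zero {t : ℝ} (ht : t ∈ Ioo (0 : ℝ) 1) (f : X → ℝ) {x : X} (hx : G x = 0) :
    sweepFun 𝒱 H K W₀ G t f x = 0 := by
  have h0 : ∀ y, G y = 0 → {y | t ≤ G y}.indicator f y = 0 := fun y hy =>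
    indicator_of_notMem (fun h => by
      have : t ≤ G y := h
      linarith [ht.1]) _
  rw [hG.sweepFun_eq ht h0 fun y hy => indicator_of_mem (show y ∈ {y | t ≤ G y} from hy) _,
    (hG.isRegular_shell ht.2).integral_of_notMem hG.bauer, h0 x hx]
  rw [hG.mem_shell ht.2.le, hx]
  exact fun h => lt_irrefl _ h.1

theorem sweepFun_of_le {t : ℝ} (ht : t ∈ Ioo (0 : ℝ) 1) (f : X → ℝ) {x : X} (hx : t ≤ G x) :
    sweepFun 𝒱 H K W₀ G t f x = f x := by
  have h0 : ∀ y, G y = 0 → {y | t ≤ G y}.indicator f y = 0 := fun y hy =>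
    indicator_of_notMem (fun h => by
      have : t ≤ G y := h
      linarith [ht.1]) _
  rw [hG.sweepFun_eq ht h0 fun y hy => indicator_of_mem (show y ∈ {y | t ≤ G y} from hy) _,
    (hG.isRegular_shell ht.2).integral_of_notMem hG.bauer]
  · exact indicator_of_mem (show x ∈ {y | t ≤ G y} from hx) _
  · rw [hG.mem_shell ht.2.le]
    exact fun h => absurd h.2 (not_lt.2 hx)

theorem abs_sweepFun_le {t : ℝ} (ht : t < 1) {f : X → ℝ} {C : ℝ}
    (hC : ∀ x, |f x| ≤ C) (x : X) : |sweepFun 𝒱 H K W₀ G t f x| ≤ C := by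
  have hm := (hG.isRegular_shell ht).isMarkovKernel hG.bauer
  rw [sweepFun, ← integral_indicator (hG.measurableSet_le t)]
  refine abs_integral_le_of_bounded fun y => ?_
  by_cases hy : y ∈ {y | t ≤ G y}
  · rw [indicator_of_mem hy]; exact hC y
  · rw [indicator_of_notMem hy, abs_zero]
    exact (abs_nonneg _).trans (hC y)

/-- `H_{A_t} 1_{S_t} = G / t` on `{G ≤ t}`. -/
theorem sweepFun_one {t : ℝ} (ht : t ∈ Ioo (0 : ℝ) 1) {x : X} (hx : G x ≤ t) :
    sweepFun 𝒱 H K W₀ G t (fun _ => 1) x = G x / t := by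
  have hreg := hG.isRegular_shell (𝒱 := 𝒱) (H := H) (K := K) (W₀ := W₀) ht.2
  rcases hx.eq_or_lt with h | h
  · rw [hG.sweepFun_of_le ht _ h.ge, h, div_self ht.1.ne']
  by_cases hx0 : G x = 0
  · rw [hG.sweepFun_of_zero ht _ hx0, hx0, zero_div]
  have hxs : x ∈ shell 𝒱 H K W₀ t :=
    (hG.mem_shell ht.2.le).2 ⟨lt_of_le_of_ne (hG.nonneg x) (Ne.symm hx0), h⟩
  rw [hG.sweepFun_eq ht (φ := fun y => min 1 (G y / t)) (fun y hy => by simp [hy])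
    (fun y hy => min_eq_left ((one_le_div ht.1).2 hy))]
  -- On the boundary of the shell the truncated function agrees with the harmonic function `G / t`.
  have : ∀ᵐ y ∂(harmonicKernel 𝒱 H (shell 𝒱 H K W₀ t) x), min 1 (G y / t) = t⁻¹ * G y := by
    filter_upwards [hreg.ae_frontier hG.bauer hxs] with y hy
    rcases hG.frontier_shell ht.2.le hy with h | h
    · simp [h]
    · rw [h, div_self ht.1.ne', min_self, inv_mul_cancel₀ ht.1.ne']
  rw [integral_congr_ae this, integral_const_mul,
    hreg.integral_eq hG.bauer hG.continuous.continuousOn (hG.harmonic_shell t), mul_comm,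
    div_eq_mul_inv]

theorem sweepFun_of_harmonic {r : ℝ} (hr : r ∈ Ioo (0 : ℝ) 1) {q : X → ℝ}
    (hq : Continuous q) (hqh : IsHarmonicOn 𝒱 H (shell 𝒱 H K W₀ r) q) (h0 : ∀ x, G x = 0 → q x = 0)
    (x : X) : sweepFun 𝒱 H K W₀ G r q x = q x := by
  rw [hG.sweepFun_eq hr h0 fun _ _ => rfl]
  exact (hG.isRegular_shell hr.2).integral_eq hG.bauer hq.continuousOn hqh x

theorem shell_mono {r t : ℝ} (h : r ≤ t) : shell 𝒱 H K W₀ r ⊆ shell 𝒱 H K W₀ t :=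
  fun _ hx => ⟨hx.1, hx.2.trans_le h⟩

/-- Transitivity of sweeping: the swept function is continuous, harmonic on the smaller shell and
zero on `K`, hence reproduced. -/
theorem sweepFun_sweepFun {r t : ℝ} (hr : 0 < r) (hrt : r ≤ t) (ht : t < 1) {f : X → ℝ}
    (hf : Continuous f) (x : X) :
    sweepFun 𝒱 H K W₀ G r (sweepFun 𝒱 H K W₀ G t f) x = sweepFun 𝒱 H K W₀ G t f x :=
  have ht' : t ∈ Ioo (0 : ℝ) 1 := ⟨hr.trans_le hrt, ht⟩
  hG.sweepFun_of_harmonic ⟨hr, hrt.trans_lt ht⟩ (hG.continuous_sweepFun ht' hf)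
    ((hG.harmonic_sweepFun ht' hf).mono (hG.shell_mono hrt))
    (fun _ hx => hG.sweepFun_of_zero ht' f hx) x

end IsGauge

/-- Integrals with respect to `ν H_{A_t}`. -/
theorem integral_bind_kernel {ν : Measure X} [IsFiniteMeasure ν] {T : Kernel X X}
    [IsMarkovKernel T] {f : X → ℝ} (hf : Measurable f) {C : ℝ} (hC : ∀ x, |f x| ≤ C) :
    ∫ x, f x ∂(ν.bind T) = ∫ x, ∫ y, f y ∂(T x) ∂ν := by
  rw [Measure.comp_eq_comp_const_apply, Kernel.integral_comp (integrable_of_bounded hf hC),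
    Kernel.const_apply]

namespace IsGauge

variable (hG : IsGauge 𝒱 H K W₀ G)
include hG

theorem ae_level {s : ℝ} (hs : s ∈ Ioo (0 : ℝ) 1) {ν : Measure X}
    (hν : IsProbabilityOn (level 𝒱 H K W₀ s) ν) : ∀ᵐ x ∂ν, G x = s := by
  have h := hν.2
  rw [← mem_ae_iff] at h
  filter_upwards [h] with x hx using (hG.mem_level hs).1 hx

theorem measurableSet_level {s : ℝ} (hs : s ∈ Ioo (0 : ℝ) 1) :
    MeasurableSet (level 𝒱 H K W₀ s) := by
  rw [show level 𝒱 H K W₀ s = {x | G x = s} from ext fun _ => hG.mem_level hs]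
  exact (isClosed_eq hG.continuous continuous_const).measurableSet

/-- Duality between sweeping measures and functions. From `S_s` with `s < t` the exit points have `G
= 0` or `G = t`, so restricting to `S_t` and truncating to `{t ≤ G}` agree. -/
theorem integral_sweep {s t : ℝ} (hs : 0 < s) (hst : s < t) (ht : t < 1) {ν : Measure X}
    (hν : IsProbabilityOn (level 𝒱 H K W₀ s) ν) {f : X → ℝ} (hf : Measurable f) {C : ℝ}
    (hC : ∀ x, |f x| ≤ C) :
    ∫ x, f x ∂(sweep 𝒱 H K W₀ s t ν) = t / s * ∫ x, sweepFun 𝒱 H K W₀ G t f x ∂ν := by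
  have ht' : t ∈ Ioo (0 : ℝ) 1 := ⟨hs.trans hst, ht⟩
  have hreg := hG.isRegular_shell (𝒱 := 𝒱) (H := H) (K := K) (W₀ := W₀) ht
  have hm := hreg.isMarkovKernel hG.bauer
  have := hν.1
  have hlm := hG.measurableSet_level (𝒱 := 𝒱) (H := H) (K := K) (W₀ := W₀) ht'
  rw [sweep, integral_smul_measure, ENNReal.toReal_ofReal (div_nonneg ht'.1.le hs.le), smul_eq_mul,
    ← integral_indicator hlm, integral_bind_kernel (hf.indicator hlm) (C := C)]
  · congr 1
    refine integral_congr_ae ((hG.ae_level ⟨hs, hst.trans ht⟩ hν).mono fun x hx => ?_)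
    have hxs : x ∈ shell 𝒱 H K W₀ t := (hG.mem_shell ht.le).2 ⟨hx ▸ hs, hx ▸ hst⟩
    simp only [sweepFun]
    rw [← integral_indicator (hG.measurableSet_le t)]
    refine integral_congr_ae ((hreg.ae_frontier hG.bauer hxs).mono fun y hy => ?_)
    have hiff : y ∈ level 𝒱 H K W₀ t ↔ y ∈ {y | t ≤ G y} := by
      rw [hG.mem_level ht', mem_ofPred_eq]
      rcases hG.frontier_shell ht.le hy with h | h
      · rw [h]; exact ⟨fun h' => h'.ge, fun h' => absurd h' (not_le.2 ht'.1)⟩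
      · rw [h]; simp
    by_cases hyl : y ∈ level 𝒱 H K W₀ t
    · simp only [indicator_of_mem hyl, indicator_of_mem (hiff.1 hyl)]
    · simp only [indicator_of_notMem hyl, indicator_of_notMem (fun h => hyl (hiff.2 h))]
  · intro x
    by_cases hx : x ∈ level 𝒱 H K W₀ t
    · rw [indicator_of_mem hx]; exact hC x
    · rw [indicator_of_notMem hx, abs_zero]
      exact (abs_nonneg _).trans (hC x)

theorem isFiniteMeasure_sweep {s t : ℝ} (ht : t < 1) {ν : Measure X}
    [IsFiniteMeasure ν] : IsFiniteMeasure (sweep 𝒱 H K W₀ s t ν) := by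
  have hm := (hG.isRegular_shell (𝒱 := 𝒱) (H := H) (K := K) (W₀ := W₀) ht).isMarkovKernel hG.bauer
  have : IsFiniteMeasure
      ((ν.bind (harmonicKernel 𝒱 H (shell 𝒱 H K W₀ t))).restrict (level 𝒱 H K W₀ t)) := by
    infer_instance
  exact Measure.smul_finite _ ENNReal.ofReal_ne_top

/-- From any point of `S_s` the shell `A_t` is left through `S_t` with probability `s / t`, which
the factor `t / s` compensates. -/
theorem isProbabilityOn_sweep {s t : ℝ} (hs : 0 < s) (hst : s < t) (ht : t < 1) {ν : Measure X}
    (hν : IsProbabilityOn (level 𝒱 H K W₀ s) ν) :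
    IsProbabilityOn (level 𝒱 H K W₀ t) (sweep 𝒱 H K W₀ s t ν) := by
  have ht' : t ∈ Ioo (0 : ℝ) 1 := ⟨hs.trans hst, ht⟩
  have := hν.1
  have hfin := hG.isFiniteMeasure_sweep (𝒱 := 𝒱) (H := H) (K := K) (W₀ := W₀) (s := s) (ν := ν) ht
  constructor
  · have h := hG.integral_sweep hs hst ht hν (f := fun _ => 1) measurable_const (C := 1) (by simp)
    have h2 : ∫ x, sweepFun 𝒱 H K W₀ G t (fun _ => 1) x ∂ν = s / t := by
      rw [integral_congr_ae (g := fun _ => s / t)]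
      · simp
      · filter_upwards [hG.ae_level ⟨hs, hst.trans ht⟩ hν] with x hx
        rw [hG.sweepFun_one ht' (hx ▸ hst.le), hx]
    rw [h2] at h
    simp only [integral_const, smul_eq_mul, mul_one] at h
    rw [div_mul_div_cancel₀ hs.ne', div_self ht'.1.ne'] at h
    exact isProbabilityMeasure_iff_real.2 h
  · have hlm := hG.measurableSet_level (𝒱 := 𝒱) (H := H) (K := K) (W₀ := W₀) ht'
    rw [sweep, Measure.smul_apply, Measure.restrict_apply hlm.compl, compl_inter_self,
      measure_empty, smul_zero]

/-- Sweeping from `s` to `t` may pause at `r`: this is transitivity, with the factors combining as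
`t / s = (t / r) * (r / s)`. -/
theorem integral_sweep_eq {s r t : ℝ} (hs : 0 < s) (hsr : s < r) (hrt : r < t) (ht : t < 1)
    {ν : Measure X} (hν : IsProbabilityOn (level 𝒱 H K W₀ s) ν) {f : X → ℝ} (hf : Continuous f)
    {C : ℝ} (hC : ∀ x, |f x| ≤ C) :
    ∫ x, f x ∂(sweep 𝒱 H K W₀ s t ν) =
      t / r * ∫ x, sweepFun 𝒱 H K W₀ G t f x ∂(sweep 𝒱 H K W₀ s r ν) := by
  have hr0 : 0 < r := hs.trans hsr
  have ht' : t ∈ Ioo (0 : ℝ) 1 := ⟨hr0.trans hrt, ht⟩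
  rw [hG.integral_sweep hs (hsr.trans hrt) ht hν hf.measurable hC,
    hG.integral_sweep hs hsr (hrt.trans ht) hν (hG.continuous_sweepFun ht' hf).measurable
      (hG.abs_sweepFun_le ht hC), ← mul_assoc, div_mul_div_cancel₀ hr0.ne']
  simp only [hG.sweepFun_sweepFun hr0 hrt.le ht hf]

end IsGauge

end Setup
end Darning

namespace Darning

/-! ### Weak limits, compatibility and the masses of components. -/

section Limits

variable {X : Type*} [TopologicalSpace X] [T2Space X] [LocallyCompactSpace X]
    [SecondCountableTopology X] [MeasurableSpace X] [BorelSpace X]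
    {𝒱 : Set (Set X)} {H : Set X → Kernel X X} {K W₀ : Set X} {G : X → ℝ}
    {η : ℕ → ℝ} {ν : ℕ → Measure X} {φ : ℕ → ℕ} {σ : ℝ → Measure X}

theorem pos_of_strictAnti_tendsto_zero (hη : StrictAnti η) (hηlim : Tendsto η atTop (𝓝 0)) (n : ℕ) :
    0 < η n :=
  (hη.antitone.le_of_tendsto hηlim (n + 1)).trans_lt (hη (Nat.lt_succ_self n))

theorem mem_Ioo_of_strictAnti (hη0 : η 0 = 1) (hη : StrictAnti η) (hηlim : Tendsto η atTop (𝓝 0))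
    {n : ℕ} (hn : 1 ≤ n) : η n ∈ Ioo (0 : ℝ) 1 :=
  ⟨pos_of_strictAnti_tendsto_zero hη hηlim n, hη0 ▸ hη hn⟩

namespace IsGauge

variable (hG : IsGauge 𝒱 H K W₀ G)
include hG

/-- `H_{A_t} f` on `{0 < G}` as a bounded continuous function. -/
noncomputable def sweepBCF {t : ℝ} (ht : t ∈ Ioo (0 : ℝ) 1) (f : BoundedContinuousFunction X ℝ) :
    BoundedContinuousFunction X ℝ :=
  .ofNormedAddCommGroup (sweepFun 𝒱 H K W₀ G t f) (hG.continuous_sweepFun ht f.continuous) ‖f‖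
    (hG.abs_sweepFun_le ht.2 f.norm_coe_le_norm)

theorem isCompact_level {s : ℝ} (hs : s ∈ Ioo (0 : ℝ) 1) : IsCompact (level 𝒱 H K W₀ s) := by
  rw [show level 𝒱 H K W₀ s = {x | G x = s} from ext fun _ => hG.mem_level hs]
  exact (hG.isCompact_le s hs.2).of_isClosed_subset (isClosed_eq hG.continuous continuous_const)
    fun x hx => le_of_eq hx

/-- Only the countably many levels `S_{η (m + 1)}` need compactness. Probability measures on a
compact level form a compact set, and so does their countable product, which yields one subsequence
for all of them. Every other level is reached by sweeping from a lower one of these, a weakly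
continuous operation. -/
theorem exists_isLimitFamily (hη0 : η 0 = 1) (hη : StrictAnti η) (hηlim : Tendsto η atTop (𝓝 0))
    (hν : ∀ n, 1 ≤ n → IsProbabilityOn (level 𝒱 H K W₀ (η n)) (ν n)) :
    ∃ (φ : ℕ → ℕ) (σ : ℝ → Measure X), IsLimitFamily 𝒱 H K W₀ η ν φ σ := by
  classical
  have hηI : ∀ n, η (n + 1) ∈ Ioo (0 : ℝ) 1 := fun n =>
    mem_Ioo_of_strictAnti hη0 hη hηlim (Nat.succ_pos n)
  have hν' : ∀ n, IsProbabilityOn (level 𝒱 H K W₀ (η (n + 1))) (ν (n + 1)) := fun n =>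
    hν _ (Nat.succ_pos n)
  have hsw : ∀ k m, m < k → IsProbabilityOn (level 𝒱 H K W₀ (η (m + 1)))
      (sweep 𝒱 H K W₀ (η (k + 1)) (η (m + 1)) (ν (k + 1))) := fun k m hmk =>
    hG.isProbabilityOn_sweep (hηI k).1 (hη (Nat.succ_lt_succ hmk)) (hηI m).2 (hν' k)
  let x : ℕ → ℕ → ProbabilityMeasure X := fun k m =>
    if h : m < k then ⟨_, (hsw k m h).1⟩ else ⟨_, (hν' m).1⟩
  have hx1 : ∀ k m (h : m < k), x k m = ⟨_, (hsw k m h).1⟩ := fun k m h => dif_pos h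
  have hx2 : ∀ k m (_ : ¬ m < k), x k m = ⟨_, (hν' m).1⟩ := fun k m h => dif_neg h
  let C : ℕ → Set (ProbabilityMeasure X) := fun m =>
    {μ | ∀ _ : ℕ, μ (level 𝒱 H K W₀ (η (m + 1)))ᶜ ≤ 0}
  have hCc : ∀ m, IsCompact (C m) := fun m =>
    isCompact_setOfPred_probabilityMeasure_mass_eq_compl_isCompact_le (u := fun _ => 0)
      (K := fun _ => level 𝒱 H K W₀ (η (m + 1))) tendsto_const_nhds
      (fun _ => hG.isCompact_level (hηI m)) (Or.inr monotone_const)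
  have hxC : ∀ k, x k ∈ univ.pi C := by
    intro k m _ _
    by_cases h : m < k
    · rw [hx1 k m h]
      exact (ProbabilityMeasure.null_iff_toMeasure_null _ _).2 (hsw k m h).2 |>.le
    · rw [hx2 k m h]
      exact (ProbabilityMeasure.null_iff_toMeasure_null _ _).2 (hν' m).2 |>.le
  obtain ⟨μ, hμC, ψ, hψ, hlim⟩ := (isCompact_univ_pi hCc).tendsto_subseq hxC
  have hμ : ∀ m, IsProbabilityOn (level 𝒱 H K W₀ (η (m + 1))) (μ m : Measure X) := fun m =>
    ⟨inferInstance, (ProbabilityMeasure.null_iff_toMeasure_null _ _).1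
      (le_antisymm (hμC m (mem_univ m) 0) zero_le)⟩
  have hlim' : ∀ m, ∀ f : BoundedContinuousFunction X ℝ,
      Tendsto (fun k => ∫ y, f y ∂(x (ψ k) m : Measure X)) atTop (𝓝 (∫ y, f y ∂(μ m : Measure X))) :=
    fun m => ProbabilityMeasure.tendsto_iff_forall_integral_tendsto.1 (tendsto_pi_nhds.1 hlim m)
  -- Each `t` gets one auxiliary level below it, from which the limit at `t` is defined by sweeping.
  have hex : ∀ t ∈ Ioo (0 : ℝ) 1, ∃ m, η (m + 1) < t := fun t ht =>
    (((tendsto_add_atTop_iff_nat 1).2 hηlim).eventually (gt_mem_nhds ht.1)).exists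
  choose! m hm using hex
  refine ⟨fun k => ψ k + 1, fun t => sweep 𝒱 H K W₀ (η (m t + 1)) t (μ (m t)),
    fun k => Nat.succ_pos _, fun a b h => Nat.succ_lt_succ (hψ h), fun t ht => ?_, fun t ht f => ?_⟩
  · exact hG.isProbabilityOn_sweep (hηI _).1 (hm t ht) ht.2 (hμ _)
  · have hfb : ∀ y, |f y| ≤ ‖f‖ := f.norm_coe_le_norm
    rw [hG.integral_sweep (hηI _).1 (hm t ht) ht.2 (hμ _) f.continuous.measurable hfb]
    refine ((hlim' (m t) (hG.sweepBCF ht f)).const_mul (t / η (m t + 1))).congr' ?_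
    filter_upwards [hψ.tendsto_atTop.eventually (eventually_gt_atTop (m t))] with k hk
    rw [hG.integral_sweep_eq (hηI _).1 (hη (Nat.succ_lt_succ hk)) (hm t ht) ht.2 (hν' _)
      f.continuous hfb]
    rw [hx1 _ _ hk]
    rfl

theorem _root_.Darning.IsLimitFamily.eventually_lt (hσ : IsLimitFamily 𝒱 H K W₀ η ν φ σ)
    (hηlim : Tendsto η atTop (𝓝 0)) {r : ℝ} (hr : 0 < r) : ∀ᶠ k in atTop, η (φ k) < r :=
  (hηlim.comp hσ.strictMono.tendsto_atTop).eventually (gt_mem_nhds hr)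

/-- The limit may be taken in the transitivity identity because `sweepFun` of a bounded continuous
function is again a bounded continuous test function. -/
theorem integral_limit (hη0 : η 0 = 1) (hη : StrictAnti η)
    (hηlim : Tendsto η atTop (𝓝 0))
    (hν : ∀ n, 1 ≤ n → IsProbabilityOn (level 𝒱 H K W₀ (η n)) (ν n))
    (hσ : IsLimitFamily 𝒱 H K W₀ η ν φ σ) {r t : ℝ} (hr : 0 < r) (hrt : r < t) (ht : t < 1)
    (f : BoundedContinuousFunction X ℝ) :
    ∫ x, f x ∂(σ t) = t / r * ∫ x, sweepFun 𝒱 H K W₀ G t f x ∂(σ r) := by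
  have ht' : t ∈ Ioo (0 : ℝ) 1 := ⟨hr.trans hrt, ht⟩
  refine tendsto_nhds_unique (hσ.tendsto t ht' f)
    (((hσ.tendsto r ⟨hr, hrt.trans ht⟩ (hG.sweepBCF ht' f)).const_mul (t / r)).congr' ?_)
  filter_upwards [hσ.eventually_lt hG hηlim hr] with k hk
  exact (hG.integral_sweep_eq (mem_Ioo_of_strictAnti hη0 hη hηlim (hσ.one_le k)).1 hk hrt ht
    (hν _ (hσ.one_le k)) f.continuous f.norm_coe_le_norm).symm

theorem sweep_limit (hη0 : η 0 = 1) (hη : StrictAnti η)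
    (hηlim : Tendsto η atTop (𝓝 0))
    (hν : ∀ n, 1 ≤ n → IsProbabilityOn (level 𝒱 H K W₀ (η n)) (ν n))
    (hσ : IsLimitFamily 𝒱 H K W₀ η ν φ σ) {r t : ℝ} (hr : 0 < r) (hrt : r < t) (ht : t < 1) :
    sweep 𝒱 H K W₀ r t (σ r) = σ t := by
  have hσr := hσ.probability r ⟨hr, hrt.trans ht⟩
  have hσt := hσ.probability t ⟨hr.trans hrt, ht⟩
  have := (hG.isProbabilityOn_sweep hr hrt ht hσr).1
  have := hσt.1
  refine ext_of_forall_integral_eq_of_IsFiniteMeasure fun f => ?_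
  rw [hG.integral_sweep hr hrt ht hσr f.continuous.measurable f.norm_coe_le_norm,
    hG.integral_limit hη0 hη hηlim hν hσ hr hrt ht]

theorem isCompatible (hη0 : η 0 = 1) (hη : StrictAnti η) (hηlim : Tendsto η atTop (𝓝 0))
    (hν : ∀ n, 1 ≤ n → IsProbabilityOn (level 𝒱 H K W₀ (η n)) (ν n))
    (hσ : IsLimitFamily 𝒱 H K W₀ η ν φ σ) : IsCompatible 𝒱 H K W₀ σ := by
  intro r t hr hrt ht
  have ht0 := hr.trans hrt
  rw [← hG.sweep_limit hη0 hη hηlim hν hσ hr hrt ht, sweep, smul_smul,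
    ← ENNReal.ofReal_mul (by positivity), div_mul_div_cancel₀ ht0.ne', div_self hr.ne',
    ENNReal.ofReal_one, one_smul,
    Measure.restrict_restrict (hG.measurableSet_level ⟨ht0, ht⟩), inter_self]

end IsGauge

/-- The open set whose components form `compAt η n`. -/
def domainAt (𝒱 : Set (Set X)) (H : Set X → Kernel X X) (K W₀ : Set X) (η : ℕ → ℝ) : ℕ → Set X
  | 0 => W₀ \ K
  | n + 1 => shell 𝒱 H K W₀ (η (n + 1))

theorem compAt_eq (n : ℕ) : compAt 𝒱 H K W₀ η n = components (domainAt 𝒱 H K W₀ η n) := by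
  cases n <;> rfl

section Components

variable {D V : Set X}

theorem subset_of_mem_components (hV : V ∈ components D) : V ⊆ D := by
  obtain ⟨x, -, rfl⟩ := hV
  exact connectedComponentIn_subset D x

theorem isConnected_of_mem_components (hV : V ∈ components D) : IsConnected V := by
  obtain ⟨x, hx, rfl⟩ := hV
  exact isConnected_connectedComponentIn_iff.2 hx

theorem eq_of_mem_components (hV : V ∈ components D) {x : X} (hx : x ∈ V) :
    V = connectedComponentIn D x := by
  obtain ⟨y, -, rfl⟩ := hV
  exact connectedComponentIn_eq hx

theorem isOpen_of_mem_components [LocallyConnectedSpace X] (hD : IsOpen D)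
    (hV : V ∈ components D) : IsOpen V := by
  obtain ⟨x, -, rfl⟩ := hV
  exact hD.connectedComponentIn

theorem isOpen_diff_of_mem_components [LocallyConnectedSpace X] (hD : IsOpen D)
    (hV : V ∈ components D) : IsOpen (D \ V) := by
  rw [isOpen_iff_mem_nhds]
  rintro x ⟨hxD, hxV⟩
  filter_upwards [hD.connectedComponentIn.mem_nhds (mem_connectedComponentIn hxD)] with y hy
  refine ⟨connectedComponentIn_subset D x hy, fun hyV => hxV ?_⟩
  rw [eq_of_mem_components hV hyV, ← connectedComponentIn_eq hy]
  exact mem_connectedComponentIn hxD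

theorem pairwiseDisjoint_components : (components D).PairwiseDisjoint id := by
  intro V hV V' hV' hne
  refine disjoint_left.2 fun x hx hx' => hne ?_
  rw [eq_of_mem_components hV hx, eq_of_mem_components hV' hx']

theorem countable_components [LocallyConnectedSpace X] (hD : IsOpen D) :
    (components D).Countable :=
  pairwiseDisjoint_components.countable_of_isOpen
    (fun _ hV => isOpen_of_mem_components hD hV)
    fun _ hV => (isConnected_of_mem_components hV).nonempty

end Components

namespace IsGauge

variable (hG : IsGauge 𝒱 H K W₀ G)
include hG

theorem mem_domainAt (hη0 : η 0 = 1) (hη : StrictAnti η) {n : ℕ} {x : X} (h0 : 0 < G x)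
    (hx : G x < η n) : x ∈ domainAt 𝒱 H K W₀ η n := by
  cases n with
  | zero => exact ⟨hG.mem_of_lt x (hη0 ▸ hx), (hG.pos_iff x).1 h0⟩
  | succ n => exact (hG.mem_shell (hη0 ▸ hη (Nat.succ_pos n)).le).2 ⟨h0, hx⟩

theorem isOpen_domainAt (hη0 : η 0 = 1) (hη : StrictAnti η) (n : ℕ) :
    IsOpen (domainAt 𝒱 H K W₀ η n) := by
  cases n with
  | zero => exact hG.isOpen_diff
  | succ n => exact hG.isOpen_shell (hη0 ▸ hη (Nat.succ_pos n)).le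

theorem domainAt_succ_subset (hη : StrictAnti η) (n : ℕ) :
    domainAt 𝒱 H K W₀ η (n + 1) ⊆ domainAt 𝒱 H K W₀ η n := by
  cases n with
  | zero => exact hG.shell_subset _
  | succ n => exact hG.shell_mono (hη (Nat.lt_succ_self _)).le

/-- A function which is harmonic on `A_r` and equal to `r` on `S_r ∩ V` and to `0` on
`S_r \ V`. -/
theorem exists_harmonic_of_clopen {D V : Set X} {r ρ : ℝ} (hrρ : r < ρ) (hV : IsOpen V)
    (hDV : IsOpen (D \ V)) (hVD : V ⊆ D)
    (hD : ∀ x, 0 < G x → G x < ρ → x ∈ D) :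
    ∃ q : X → ℝ, Continuous q ∧ (∀ x, 0 ≤ q x) ∧ (∀ x, q x ≤ G x) ∧
      (∀ x, G x ≤ r → x ∈ V → q x = G x) ∧ (∀ x, x ∉ V → q x = 0) ∧
      (r ≤ 1 → r ≤ ρ → IsHarmonicOn 𝒱 H (shell 𝒱 H K W₀ r) q) := by
  classical
  obtain ⟨r', hr', hr'ρ⟩ := exists_between hrρ
  -- The cut-off equals `1` up to `r` and vanishes from `r'` on, with `r < r' < ρ`; it makes `1_V G`
  -- continuous where `V` meets the boundary of `D`, since there `G` is `0` or at least `ρ`.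
  let θ : ℝ → ℝ := fun s => max 0 (min 1 ((r' - s) / (r' - r)))
  have hθ : Continuous θ := by fun_prop
  have hθ0 : ∀ s, 0 ≤ θ s := fun s => le_max_left _ _
  have hθ1 : ∀ s, θ s ≤ 1 := fun s => max_le zero_le_one (min_le_left _ _)
  have hθr : ∀ s ≤ r, θ s = 1 := fun s hs => by
    have : 1 ≤ (r' - s) / (r' - r) := by rw [one_le_div (by linarith)]; linarith
    simp only [θ, min_eq_left this, max_eq_right zero_le_one]
  have hθρ : ∀ s, r' ≤ s → θ s = 0 := fun s hs =>
    max_eq_left ((min_le_right _ _).trans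
      (div_nonpos_of_nonpos_of_nonneg (by linarith) (by linarith)))
  let p : X → ℝ := fun x => G x * θ (G x)
  have hp : Continuous p := hG.continuous.mul (hθ.comp hG.continuous)
  have hp0 : ∀ x, 0 ≤ p x := fun x => mul_nonneg (hG.nonneg x) (hθ0 _)
  have hpG : ∀ x, p x ≤ G x := fun x => mul_le_of_le_one_right (hG.nonneg x) (hθ1 _)
  let q : X → ℝ := V.indicator p
  have hqV : ∀ x ∈ V, q x = p x := fun x hx => indicator_of_mem hx _
  have hqV' : ∀ x, x ∉ V → q x = 0 := fun x hx => indicator_of_notMem hx _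
  have hq0 : ∀ x, 0 ≤ q x := fun x => indicator_nonneg (fun y _ => hp0 y) x
  have hqp : ∀ x, q x ≤ p x := fun x => indicator_le_self' (fun y _ => hp0 y) x
  have hqG : ∀ x, q x ≤ G x := fun x => (hqp x).trans (hpG x)
  have hqr : ∀ x, G x ≤ r → x ∈ V → q x = G x := fun x hx hxV => by
    simp only [hqV x hxV, p, hθr _ hx, mul_one]
  have hqc : Continuous q := by
    rw [continuous_iff_continuousAt]
    intro x
    by_cases hxV : x ∈ V
    · refine hp.continuousAt.congr ?_
      filter_upwards [hV.mem_nhds hxV] with y hy using (hqV y hy).symm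
    by_cases hxD : x ∈ D
    · refine (continuousAt_const (y := (0 : ℝ))).congr ?_
      filter_upwards [hDV.mem_nhds ⟨hxD, hxV⟩] with y hy using (hqV' y hy.2).symm
    · have : p x = 0 := by
        by_cases h0 : G x = 0
        · simp only [p, h0, zero_mul]
        · have : ρ ≤ G x := not_lt.1 fun h =>
            hxD (hD x (lt_of_le_of_ne (hG.nonneg x) (Ne.symm h0)) h)
          simp only [p, hθρ _ (hr'ρ.le.trans this), mul_zero]
      rw [ContinuousAt, hqV' x hxV]
      have hpx := hp.continuousAt (x := x)
      rw [ContinuousAt, this] at hpx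
      exact squeeze_zero hq0 hqp hpx
  refine ⟨q, hqc, hq0, hqG, hqr, hqV', fun hr1 hrρ' => ⟨hqc.continuousOn, fun W hW x hx => ?_⟩⟩
  have hS := hG.isOpen_shell (𝒱 := 𝒱) (H := H) (K := K) (W₀ := W₀) hr1
  set S := shell 𝒱 H K W₀ r
  have hSD : S ⊆ D := fun y hy => by
    have := (hG.mem_shell hr1).1 hy
    exact hD y this.1 (this.2.trans hrρ)
  have hA : IsOpen (V ∩ S) := hV.inter hS
  have hB : IsOpen ((D \ V) ∩ S) := hDV.inter hS
  have hAB : Disjoint (V ∩ S) ((D \ V) ∩ S) :=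
    disjoint_left.2 fun y hy hy' => hy'.1.2 hy.1
  have hU : (V ∩ S) ∪ ((D \ V) ∩ S) = S := by
    rw [← union_inter_distrib_right, union_sdiff_cancel hVD, inter_eq_right.2 hSD]
  have hxS := hW.2 (subset_closure hx)
  have haeS := hG.bauer.ae_mem hW.1 hx hW.2
  -- The shell splits into the open sets `V ∩ S` and `(D \ V) ∩ S`, and the harmonic measure from
  -- `x` sees only the piece containing `x`, where `q` is `G` or `0`.
  by_cases hxV : x ∈ V
  · have h0 := hG.bauer.null_of_clopen hA hB hAB hU hW hx ⟨hxV, hxS⟩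
    rw [hqr x ((hG.mem_shell hr1).1 hxS).2.le hxV, ← (hG.harmonic_shell r).2 W hW x hx]
    refine integral_congr_ae ?_
    have h0' : ∀ᵐ y ∂(H W x), y ∉ (D \ V) ∩ S := measure_eq_zero_iff_ae_notMem.1 h0
    filter_upwards [haeS, h0'] with y hyS hy
    refine hqr y ((hG.mem_shell hr1).1 hyS).2.le ?_
    by_contra hyV
    exact hy ⟨⟨hSD hyS, hyV⟩, hyS⟩
  · have h0 := hG.bauer.null_of_clopen hB hA hAB.symm (by rw [union_comm, hU]) hW hx
      ⟨⟨hSD hxS, hxV⟩, hxS⟩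
    have h0' : ∀ᵐ y ∂(H W x), y ∉ V ∩ S := measure_eq_zero_iff_ae_notMem.1 h0
    rw [hqV' x hxV, integral_congr_ae (g := fun _ => 0), integral_zero]
    filter_upwards [haeS, h0'] with y hyS hy
    exact hqV' y fun hyV => hy ⟨hyV, hyS⟩

/-- The masses of the pieces are preserved in the limit. -/
theorem limit_apply_of_clopen (hη0 : η 0 = 1) (hη : StrictAnti η)
    (hηlim : Tendsto η atTop (𝓝 0))
    (hν : ∀ n, 1 ≤ n → IsProbabilityOn (level 𝒱 H K W₀ (η n)) (ν n))
    (hσ : IsLimitFamily 𝒱 H K W₀ η ν φ σ) {D V : Set X} {r ρ : ℝ} (hr : 0 < r) (hrρ : r < ρ)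
    (hr1 : r < 1) (hV : IsOpen V) (hDV : IsOpen (D \ V)) (hVD : V ⊆ D)
    (hD : ∀ x, 0 < G x → G x < ρ → x ∈ D) {a : ℝ}
    (ha : ∀ᶠ n in atTop, (ν n).real V = a) : (σ r).real V = a := by
  obtain ⟨q, hq, hq0, hqG, hqV, hqV', hqh⟩ :=
    hG.exists_harmonic_of_clopen hrρ hV hDV hVD hD
  have hI : r ∈ Ioo (0 : ℝ) 1 := ⟨hr, hr1⟩
  have hh := hqh hr1.le hrρ.le
  have hlev : ∀ s : ℝ, s ≤ r → ∀ x, G x = s → q x = s * V.indicator 1 x := by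
    intro s hs x hx
    by_cases hxV : x ∈ V
    · rw [hqV x (hx.le.trans hs) hxV, indicator_of_mem hxV, Pi.one_apply, mul_one, hx]
    · rw [hqV' x hxV, indicator_of_notMem hxV, mul_zero]
  have hint : ∀ (s : ℝ) (μ : Measure X), s ∈ Ioo (0 : ℝ) 1 → s ≤ r →
      IsProbabilityOn (level 𝒱 H K W₀ s) μ → ∫ x, q x ∂μ = s * μ.real V := by
    intro s μ hs hsr hμ
    rw [integral_congr_ae ((hG.ae_level hs hμ).mono fun x hx => hlev s hsr x hx),
      integral_const_mul, integral_indicator_one hV.measurableSet]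
  -- Weak convergence needs a bounded test function; truncation at `1` changes nothing on `{G ≤ r}`.
  let g : X → ℝ := fun x => min (q x) 1
  have hgb : ∀ x, |g x| ≤ 1 := fun x => by
    rw [abs_of_nonneg (le_min (hq0 x) zero_le_one)]; exact min_le_right _ _
  have hg : Continuous g := hq.min continuous_const
  have hgq : ∀ x, G x ≤ r → g x = q x := fun x hx =>
    min_eq_left ((hqG x).trans (hx.trans hr1.le))
  let gb : BoundedContinuousFunction X ℝ := .ofNormedAddCommGroup g hg 1 hgb
  have hlim := hσ.tendsto r hI gb
  have hsweep : ∀ x, sweepFun 𝒱 H K W₀ G r g x = sweepFun 𝒱 H K W₀ G r q x ∨ r < G x := by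
    intro x
    by_cases hx : r < G x
    · exact Or.inr hx
    refine Or.inl ?_
    rcases (not_lt.1 hx).eq_or_lt with h | h
    · rw [hG.sweepFun_of_le hI _ h.ge, hG.sweepFun_of_le hI _ h.ge, hgq x h.le]
    by_cases h0 : G x = 0
    · rw [hG.sweepFun_of_zero hI _ h0, hG.sweepFun_of_zero hI _ h0]
    have hxs : x ∈ shell 𝒱 H K W₀ r :=
      (hG.mem_shell hr1.le).2 ⟨lt_of_le_of_ne (hG.nonneg x) (Ne.symm h0), h⟩
    refine integral_congr_ae (ae_restrict_of_ae ?_)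
    filter_upwards [(hG.isRegular_shell hr1).ae_frontier hG.bauer hxs] with y hy
    refine hgq y ?_
    rcases hG.frontier_shell hr1.le hy with h | h
    · rw [h]; exact hr.le
    · exact h.le
  -- On level `s ≤ r` the function `q` is `s * 1_V`, so its integral against `ν` is `s * a`; it is
  -- fixed by sweeping, and the factor `r / s` leaves `r * a`.
  have hev : ∀ᶠ k in atTop, ∫ x, gb x ∂(sweep 𝒱 H K W₀ (η (φ k)) r (ν (φ k))) = r * a := by
    filter_upwards [hσ.eventually_lt hG hηlim hr, hσ.strictMono.tendsto_atTop.eventually ha]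
      with k hk hka
    have hsI := mem_Ioo_of_strictAnti hη0 hη hηlim (hσ.one_le k)
    have hνk := hν _ (hσ.one_le k)
    change ∫ x, g x ∂_ = _
    rw [hG.integral_sweep hsI.1 hk hr1 hνk hg.measurable hgb, integral_congr_ae (g := q),
      hint _ _ hsI hk.le hνk, hka, ← mul_assoc, div_mul_cancel₀ _ hsI.1.ne']
    filter_upwards [hG.ae_level hsI hνk] with x hx
    rcases hsweep x with h | h
    · rw [h, hG.sweepFun_of_harmonic hI hq hh]
      intro y hy
      exact le_antisymm (hy ▸ hqG y) (hq0 y)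
    · exact absurd h (not_lt.2 (hx ▸ hk.le))
  have h1 := tendsto_nhds_unique hlim (tendsto_const_nhds.congr' (hev.mono fun _ h => h.symm))
  have hσr := hσ.probability r hI
  have h2 : ∫ x, gb x ∂(σ r) = ∫ x, q x ∂(σ r) :=
    integral_congr_ae ((hG.ae_level hI hσr).mono fun x hx => hgq x hx.le)
  rw [h2, hint r (σ r) hI le_rfl hσr] at h1
  exact mul_left_cancel₀ hr.ne' h1

/-- Induction on the number of generations between `V` and the measure. A later `ν` lives on the
next domain, whose components inside `V` partition the relevant part of `V`; their masses are known
by induction and add up to `α V`. -/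
theorem nu_apply (hη0 : η 0 = 1) (hη : StrictAnti η)
    (hηlim : Tendsto η atTop (𝓝 0)) {α : Set X → ℝ}
    (hα : ∀ n, ∀ V ∈ compAt 𝒱 H K W₀ η n, α V ∈ Icc (0 : ℝ) 1)
    (hαsucc : ∀ n, ∀ V ∈ compAt 𝒱 H K W₀ η n,
      HasSum (fun V' : {V' : Set X // V' ∈ compAt 𝒱 H K W₀ η (n + 1) ∧ V' ⊆ V} => α V') (α V))
    (hν : ∀ n, 1 ≤ n → IsProbabilityOn (level 𝒱 H K W₀ (η n)) (ν n))
    (hνα : ∀ n, ∀ V ∈ compAt 𝒱 H K W₀ η n,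
      ν (n + 1) (V ∩ level 𝒱 H K W₀ (η (n + 1))) = ENNReal.ofReal (α V)) (j : ℕ) :
    ∀ n, ∀ V ∈ compAt 𝒱 H K W₀ η n, ν (n + 1 + j) V = ENNReal.ofReal (α V) := by
  have := hG.bauer.locallyConnectedSpace
  have hae : ∀ n, 1 ≤ n → ∀ᵐ x ∂(ν n), G x = η n := fun n hn =>
    hG.ae_level (mem_Ioo_of_strictAnti hη0 hη hηlim hn) (hν n hn)
  induction j with
  | zero =>
    intro n V hV
    rw [← hνα n V hV]
    refine measure_congr ?_
    filter_upwards [hae (n + 1) (Nat.succ_pos n)] with x hx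
    refine propext ⟨fun h => ⟨h, (hG.mem_level
      (mem_Ioo_of_strictAnti hη0 hη hηlim (Nat.succ_pos n))).2 hx⟩, fun h => h.1⟩
  | succ j ih =>
    intro n V hV
    have hDo := hG.isOpen_domainAt (𝒱 := 𝒱) (H := H) (K := K) (W₀ := W₀) hη0 hη (n + 1)
    rw [compAt_eq] at hV
    let I := {V' : Set X // V' ∈ compAt 𝒱 H K W₀ η (n + 1) ∧ V' ⊆ V}
    have hI : ∀ V' : I, V'.1 ∈ components (domainAt 𝒱 H K W₀ η (n + 1)) := fun V' =>
      compAt_eq (𝒱 := 𝒱) (H := H) (K := K) (W₀ := W₀) (n + 1) ▸ V'.2.1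
    have hcount : Countable I :=
      (((countable_components hDo).mono fun V' (h : V' ∈ {V' | V' ∈ compAt 𝒱 H K W₀ η (n + 1) ∧
        V' ⊆ V}) => compAt_eq (𝒱 := 𝒱) (H := H) (K := K) (W₀ := W₀) (n + 1) ▸ h.1)).to_subtype
    have hunion : V ∩ domainAt 𝒱 H K W₀ η (n + 1) = ⋃ V' : I, V'.1 := by
      ext x
      constructor
      · rintro ⟨hxV, hxD⟩
        have hmem : connectedComponentIn (domainAt 𝒱 H K W₀ η (n + 1)) x ∈
            components (domainAt 𝒱 H K W₀ η (n + 1)) := ⟨x, hxD, rfl⟩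
        refine mem_iUnion.2 ⟨⟨_, by rw [compAt_eq]; exact hmem, ?_⟩, mem_connectedComponentIn hxD⟩
        rw [eq_of_mem_components hV hxV]
        exact isPreconnected_connectedComponentIn.subset_connectedComponentIn
          (mem_connectedComponentIn hxD)
          ((connectedComponentIn_subset _ _).trans (hG.domainAt_succ_subset hη n))
      · intro hx
        obtain ⟨V', hxV'⟩ := mem_iUnion.1 hx
        exact ⟨V'.2.2 hxV', subset_of_mem_components (hI V') hxV'⟩
    have hidx : n + 1 + (j + 1) = n + 1 + 1 + j := by ring
    have hVm : ν (n + 1 + (j + 1)) V =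
        ν (n + 1 + (j + 1)) (V ∩ domainAt 𝒱 H K W₀ η (n + 1)) := by
      refine measure_congr ?_
      filter_upwards [hae (n + 1 + (j + 1)) (by omega)] with x hx
      refine propext ⟨fun h => ⟨h, hG.mem_domainAt hη0 hη ?_ ?_⟩, fun h => h.1⟩
      · rw [hx]; exact pos_of_strictAnti_tendsto_zero hη hηlim _
      · rw [hx]; exact hη (by omega)
    rw [hVm, hunion, measure_iUnion]
    · rw [hidx]
      simp_rw [fun V' : I => ih (n + 1) V'.1 V'.2.1]
      have hs := hαsucc n V (by rw [compAt_eq]; exact hV)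
      rw [← hs.tsum_eq, ENNReal.ofReal_tsum_of_nonneg (fun V' => (hα _ _ V'.2.1).1) hs.summable]
    · intro V' V'' hne
      exact pairwiseDisjoint_components (hI V') (hI V'') fun h => hne (Subtype.ext h)
    · exact fun V' => (isOpen_of_mem_components hDo (hI V')).measurableSet

/-- A component of an open set is open with open relative complement, so mass preservation applies
with `ρ = η n`; the approximating mass is exactly `α V` from index `n + 1` on. -/
theorem limit_apply (hη0 : η 0 = 1) (hη : StrictAnti η)
    (hηlim : Tendsto η atTop (𝓝 0)) {α : Set X → ℝ}
    (hα : ∀ n, ∀ V ∈ compAt 𝒱 H K W₀ η n, α V ∈ Icc (0 : ℝ) 1)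
    (hαsucc : ∀ n, ∀ V ∈ compAt 𝒱 H K W₀ η n,
      HasSum (fun V' : {V' : Set X // V' ∈ compAt 𝒱 H K W₀ η (n + 1) ∧ V' ⊆ V} => α V') (α V))
    (hν : ∀ n, 1 ≤ n → IsProbabilityOn (level 𝒱 H K W₀ (η n)) (ν n))
    (hνα : ∀ n, ∀ V ∈ compAt 𝒱 H K W₀ η n,
      ν (n + 1) (V ∩ level 𝒱 H K W₀ (η (n + 1))) = ENNReal.ofReal (α V))
    (hσ : IsLimitFamily 𝒱 H K W₀ η ν φ σ) {n : ℕ} {V : Set X} (hV : V ∈ compAt 𝒱 H K W₀ η n)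
    {r : ℝ} (hr : 0 < r) (hrη : r < η n) : σ r V = ENNReal.ofReal (α V) := by
  have := hG.bauer.locallyConnectedSpace
  have hDo := hG.isOpen_domainAt (𝒱 := 𝒱) (H := H) (K := K) (W₀ := W₀) hη0 hη n
  have hV' := compAt_eq (𝒱 := 𝒱) (H := H) (K := K) (W₀ := W₀) (η := η) n ▸ hV
  have hr1 : r < 1 := hrη.trans_le (hη0 ▸ hη.antitone (Nat.zero_le n))
  have h := hG.limit_apply_of_clopen hη0 hη hηlim hν hσ hr hrη hr1
    (isOpen_of_mem_components hDo hV') (isOpen_diff_of_mem_components hDo hV')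
    (subset_of_mem_components hV') (fun x h0 hx => hG.mem_domainAt hη0 hη h0 hx) (a := α V) (by
      filter_upwards [eventually_ge_atTop (n + 1)] with m hm
      obtain ⟨j, rfl⟩ := Nat.exists_eq_add_of_le hm
      rw [measureReal_def, hG.nu_apply hη0 hη hηlim hα hαsucc hν hνα j n V hV,
        ENNReal.toReal_ofReal (hα n V hV).1])
  have := (hσ.probability r ⟨hr, hr1⟩).1
  rw [← h, ofReal_measureReal]

end IsGauge

end Limits
end Darning

namespace Darning

/-! ### The quotient space and kernels lifted to it. -/

section Collapse

variable {X : Type*} {K : Set X}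

theorem collapse_of_mem {x : X} (hx : x ∈ K) : collapse K x = center K := dif_pos hx

theorem collapse_of_notMem {x : X} (hx : x ∉ K) :
    collapse K x = (some ⟨x, hx⟩ : Option {x : X // x ∉ K}) := dif_neg hx

theorem collapse_eq_center {x : X} : collapse K x = center K ↔ x ∈ K := by
  refine ⟨fun h => ?_, collapse_of_mem⟩
  by_contra hx
  exact Option.some_ne_none _ ((collapse_of_notMem hx).symm.trans h)

theorem collapse_eq_iff {x y : X} : collapse K x = collapse K y ↔ x = y ∨ x ∈ K ∧ y ∈ K := by
  refine ⟨fun h => ?_, ?_⟩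
  · by_cases hx : x ∈ K
    · exact Or.inr ⟨hx, collapse_eq_center.1 (h ▸ collapse_of_mem hx)⟩
    · by_cases hy : y ∈ K
      · exact absurd (collapse_eq_center.1 (h.trans (collapse_of_mem hy))) hx
      · exact Or.inl (congrArg Subtype.val (Option.some_injective _
          ((collapse_of_notMem hx).symm.trans (h.trans (collapse_of_notMem hy)))))
  · rintro (rfl | ⟨hx, hy⟩)
    · rfl
    · rw [collapse_of_mem hx, collapse_of_mem hy]

theorem surjective_collapse (hK : K.Nonempty) : Function.Surjective (collapse K) := by
  rintro (_ | ⟨x, hx⟩)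
  · exact ⟨hK.choose, collapse_of_mem hK.choose_spec⟩
  · exact ⟨x, collapse_of_notMem hx⟩

theorem collapse_mem_image {V : Set X} (hV : Disjoint V K) {x : X} :
    collapse K x ∈ collapse K '' V ↔ x ∈ V := by
  refine ⟨?_, mem_image_of_mem _⟩
  rintro ⟨y, hy, h⟩
  rcases collapse_eq_iff.1 h with rfl | h
  · exact hy
  · exact absurd h.1 (disjoint_left.1 hV hy)

theorem preimage_image_collapse {V : Set X} (hV : Disjoint V K) :
    collapse K ⁻¹' (collapse K '' V) = V :=
  ext fun _ => collapse_mem_image hV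

theorem preimage_image_collapse_of_subset {V : Set X} (hV : K ⊆ V) :
    collapse K ⁻¹' (collapse K '' V) = V := by
  refine Subset.antisymm ?_ (subset_preimage_image _ _)
  rintro x ⟨y, hy, h⟩
  rcases collapse_eq_iff.1 h with rfl | h
  · exact hy
  · exact hV h.2

/-- A right inverse of the collapsing map. -/
noncomputable def uncollapse (hK : K.Nonempty) (p : DarnedSpace K) : X :=
  Function.surjInv (surjective_collapse hK) p

theorem collapse_uncollapse (hK : K.Nonempty) (p : DarnedSpace K) :
    collapse K (uncollapse hK p) = p :=
  Function.surjInv_eq _ p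

theorem apply_uncollapse_collapse (hK : K.Nonempty) {β : Type*} {w : X → β}
    (hw : ∀ x ∈ K, ∀ y ∈ K, w x = w y) (x : X) : w (uncollapse hK (collapse K x)) = w x := by
  rcases collapse_eq_iff.1 (collapse_uncollapse hK (collapse K x)) with h | h
  · rw [h]
  · exact hw _ h.1 _ h.2

variable [TopologicalSpace X]

theorem isQuotientMap_collapse (hK : K.Nonempty) : IsQuotientMap (collapse K) :=
  ⟨⟨rfl⟩, surjective_collapse hK⟩

theorem isOpen_image_collapse {V : Set X} (hV : IsOpen V) (hVK : Disjoint V K) :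
    IsOpen (collapse K '' V) := by
  refine isOpen_coinduced.2 ?_
  rwa [preimage_image_collapse hVK]

theorem isClosed_of_preimage_collapse {F : Set (DarnedSpace K)}
    (hF : IsClosed (collapse K ⁻¹' F)) : IsClosed F := by
  rw [← isOpen_compl_iff]
  exact isOpen_coinduced.2 hF.isOpen_compl

theorem closure_image_collapse_subset {V : Set X} (hV : Disjoint (closure V) K) :
    closure (collapse K '' V) ⊆ collapse K '' closure V := by
  refine closure_minimal (image_mono subset_closure) (isClosed_of_preimage_collapse ?_)
  rw [preimage_image_collapse hV]
  exact isClosed_closure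

theorem lowerSemicontinuousOn_of_comp_collapse {U : Set (DarnedSpace K)} (hU : IsOpen U)
    {u : DarnedSpace K → ℝ≥0∞}
    (hu : LowerSemicontinuousOn (fun x => u (collapse K x)) (collapse K ⁻¹' U)) :
    LowerSemicontinuousOn u U := by
  have hUo : IsOpen (collapse K ⁻¹' U) := hU.preimage (continuous_collapse K)
  intro p hp y hy
  have ho : IsOpen {q | q ∈ U ∧ y < u q} := by
    refine isOpen_coinduced.2 (isOpen_iff_mem_nhds.2 fun x hx => ?_)
    have h1 := hu x hx.1 y hx.2
    rw [hUo.nhdsWithin_eq hx.1] at h1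
    filter_upwards [h1, hUo.mem_nhds hx.1] with z hz1 hz2 using ⟨hz2, hz1⟩
  filter_upwards [mem_nhdsWithin_of_mem_nhds (ho.mem_nhds ⟨hp, hy⟩)] with q hq using hq.2

variable [MeasurableSpace X] [BorelSpace X]

/-- The value at `center K` is an arbitrary choice, but this is one closed point; apart from it,
preimages of open sets are open. -/
theorem measurable_uncollapse (hK : K.Nonempty) (hKc : IsClosed K) :
    Measurable (uncollapse hK) := by
  have hc : MeasurableSet {center K} := by
    refine (isClosed_of_preimage_collapse ?_).measurableSet
    rwa [show collapse K ⁻¹' {center K} = K from ext fun x => collapse_eq_center]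
  refine measurable_of_isOpen fun O hO => ?_
  have h : uncollapse hK ⁻¹' O =
      (uncollapse hK ⁻¹' O ∩ {center K}) ∪ collapse K '' (O \ K) := by
    ext p
    obtain ⟨x, rfl⟩ := surjective_collapse hK p
    simp only [mem_union, mem_inter_iff, mem_singleton_iff, collapse_eq_center,
      collapse_mem_image (disjoint_sdiff_left (s := K) (t := O)), mem_preimage, Set.mem_sdiff]
    by_cases hx : x ∈ K
    · simp [hx]
    · have h : uncollapse hK (collapse K x) = x :=
        ((collapse_eq_iff.1 (collapse_uncollapse hK _)).resolve_right fun h => hx h.2)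
      simp [hx, h]
  rw [h]
  refine MeasurableSet.union ?_ (isOpen_image_collapse (hO.sdiff hKc)
    disjoint_sdiff_left).measurableSet
  rcases (subset_singleton_iff_eq.1 (inter_subset_right :
    uncollapse hK ⁻¹' O ∩ {center K} ⊆ {center K})) with h | h
  · rw [h]; exact .empty
  · rw [h]; exact hc

/-- The kernel `Q₀` on the darned space is the image of the kernel `Q` under the collapsing map. -/
def IsLift (Q : Kernel X X) (Q₀ : Kernel (DarnedSpace K) (DarnedSpace K)) : Prop :=
  ∀ x, Q₀ (collapse K x) = (Q x).map (collapse K)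

theorem exists_isLift (hK : K.Nonempty) (hKc : IsClosed K) {Q : Kernel X X}
    (hQ : ∀ x ∈ K, ∀ y ∈ K, (Q x).map (collapse K) = (Q y).map (collapse K)) :
    ∃ Q₀ : Kernel (DarnedSpace K) (DarnedSpace K), IsLift Q Q₀ := by
  refine ⟨(Q.comap _ (measurable_uncollapse hK hKc)).map (collapse K), fun x => ?_⟩
  rw [Kernel.map_apply _ (measurable_collapse K), Kernel.comap_apply]
  exact apply_uncollapse_collapse hK (w := fun x => (Q x).map (collapse K)) hQ x

namespace IsLift

variable {Q R : Kernel X X} {Q₀ R₀ : Kernel (DarnedSpace K) (DarnedSpace K)}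

theorem comp (hQ : IsLift Q Q₀) (hR : IsLift R R₀) :
    IsLift (Q ∘ₖ R) (Q₀ ∘ₖ R₀) := by
  have hc := measurable_collapse K
  have h1 : Q₀.comap _ hc = Q.map (collapse K) := by
    ext1 x
    rw [Kernel.comap_apply, hQ x, Kernel.map_apply _ hc]
  have h2 : R₀.comap _ hc = R.map (collapse K) := by
    ext1 x
    rw [Kernel.comap_apply, hR x, Kernel.map_apply _ hc]
  intro x
  rw [← Kernel.map_apply _ hc, Kernel.map_comp, ← h1, ← Kernel.comp_map, ← h2]
  rw [Kernel.comp_apply, Kernel.comp_apply, Kernel.comap_apply]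

theorem unique (hK : K.Nonempty) (hQ : IsLift Q Q₀) (hR : IsLift Q R₀) : Q₀ = R₀ := by
  ext1 p
  obtain ⟨x, rfl⟩ := surjective_collapse hK p
  rw [hQ, hR]

theorem isMarkovKernel (hK : K.Nonempty) [IsMarkovKernel Q] (hQ : IsLift Q Q₀) :
    IsMarkovKernel Q₀ := by
  refine ⟨fun p => ?_⟩
  obtain ⟨x, rfl⟩ := surjective_collapse hK p
  rw [hQ x]
  exact Measure.isProbabilityMeasure_map (measurable_collapse K).aemeasurable

theorem integral (hQ : IsLift Q Q₀) {f : DarnedSpace K → ℝ} (hf : Measurable f) (x : X) :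
    ∫ p, f p ∂(Q₀ (collapse K x)) = ∫ y, f (collapse K y) ∂(Q x) := by
  rw [hQ x, integral_map (measurable_collapse K).aemeasurable hf.aestronglyMeasurable]

/-- The inequality needs no measurability of `u`, which suits hyperharmonic functions: they are
controlled only on the set under consideration. -/
theorem lintegral_le (hQ : IsLift Q Q₀) (u : DarnedSpace K → ℝ≥0∞) (x : X) :
    ∫⁻ p, u p ∂(Q₀ (collapse K x)) ≤ ∫⁻ y, u (collapse K y) ∂(Q x) := by
  rw [hQ x]
  exact lintegral_map_le _ _

theorem isBoundaryKernel (hK : K.Nonempty) (hQ : IsLift Q Q₀) {U : Set (DarnedSpace K)}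
    (h1 : ∀ x, collapse K x ∈ U → ∀ᵐ y ∂(Q x), collapse K y ∈ frontier U)
    (h2 : ∀ x, collapse K x ∉ U → Q x = Measure.dirac x) : IsBoundaryKernel U Q₀ := by
  constructor
  · intro p hp
    obtain ⟨x, rfl⟩ := surjective_collapse hK p
    rw [hQ x, Measure.map_apply (measurable_collapse K) isClosed_frontier.measurableSet.compl]
    have := h1 x hp
    rw [ae_iff] at this
    exact this
  · intro p hp
    obtain ⟨x, rfl⟩ := surjective_collapse hK p
    rw [hQ x, h2 x hp, Measure.map_dirac' (measurable_collapse K)]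

end IsLift

end Collapse
end Darning

namespace Darning

/-! ### The darned kernels, before collapsing `K`. -/

section Kernels

variable {X : Type*} [TopologicalSpace X] [T2Space X] [LocallyCompactSpace X]
    [SecondCountableTopology X] [MeasurableSpace X] [BorelSpace X]
    {𝒱 : Set (Set X)} {H : Set X → Kernel X X} {K W₀ : Set X} {G : X → ℝ} {σ : ℝ → Measure X}

/-- `σ` is a compatible family of probability measures on the levels of `G`. -/
structure IsCoherent (𝒱 : Set (Set X)) (H : Set X → Kernel X X) (K W₀ : Set X)
    (σ : ℝ → Measure X) : Prop where
  probability : ∀ t ∈ Ioo (0 : ℝ) 1, IsProbabilityOn (level 𝒱 H K W₀ t) (σ t)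
  sweep_eq : ∀ r t, 0 < r → r < t → t < 1 → sweep 𝒱 H K W₀ r t (σ r) = σ t

namespace IsGauge

variable (hG : IsGauge 𝒱 H K W₀ G)
include hG

theorem measurableSet_lt (t : ℝ) : MeasurableSet {y | G y < t} :=
  (isOpen_lt hG.continuous continuous_const).measurableSet

open Classical in
/-- The kernel `σ_t` on `{G < t}` and the identity on `{t ≤ G}`. -/
noncomputable def redistribute (σ : ℝ → Measure X) (t : ℝ) : Kernel X X :=
  Kernel.piecewise (hG.measurableSet_lt t) (Kernel.const X (σ t)) Kernel.id

/-- Run `H_{A_t}` and, on reaching `K`, restart with `σ_t`. -/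
noncomputable def darnKernel (σ : ℝ → Measure X) (t : ℝ) : Kernel X X :=
  hG.redistribute σ t ∘ₖ harmonicKernel 𝒱 H (shell 𝒱 H K W₀ t)

theorem redistribute_of_lt {t : ℝ} {y : X} (hy : G y < t) : hG.redistribute σ t y = σ t := by
  rw [redistribute, Kernel.piecewise_apply, if_pos (show y ∈ {y | G y < t} from hy),
    Kernel.const_apply]

theorem redistribute_of_le {t : ℝ} {y : X} (hy : t ≤ G y) :
    hG.redistribute σ t y = Measure.dirac y := by
  rw [redistribute, Kernel.piecewise_apply,
    if_neg (show y ∉ {y | G y < t} from not_lt.2 hy), Kernel.id_apply]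

theorem notMem_shell_of_le {t : ℝ} (ht : t ≤ 1) {x : X} (hx : t ≤ G x) :
    x ∉ shell 𝒱 H K W₀ t := fun h => absurd ((hG.mem_shell ht).1 h).2 (not_lt.2 hx)

theorem notMem_shell_of_zero {t : ℝ} (ht : t ≤ 1) {x : X} (hx : G x = 0) :
    x ∉ shell 𝒱 H K W₀ t := fun h => absurd ((hG.mem_shell ht).1 h).1 (not_lt.2 hx.le)

theorem darnKernel_of_le {t : ℝ} (ht : t < 1) {x : X} (hx : t ≤ G x) :
    hG.darnKernel σ t x = Measure.dirac x := by
  rw [darnKernel, Kernel.comp_apply, (hG.isRegular_shell ht).kernel_of_notMem hG.bauer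
    (hG.notMem_shell_of_le ht.le hx), Measure.dirac_bind (Kernel.measurable _),
    hG.redistribute_of_le hx]

theorem darnKernel_of_zero {t : ℝ} (ht : t ∈ Ioo (0 : ℝ) 1) {x : X} (hx : G x = 0) :
    hG.darnKernel σ t x = σ t := by
  rw [darnKernel, Kernel.comp_apply, (hG.isRegular_shell ht.2).kernel_of_notMem hG.bauer
    (hG.notMem_shell_of_zero ht.2.le hx), Measure.dirac_bind (Kernel.measurable _),
    hG.redistribute_of_lt (hx ▸ ht.1)]

variable (hσ : IsCoherent 𝒱 H K W₀ σ)
include hσ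

theorem isMarkovKernel_redistribute {t : ℝ} (ht : t ∈ Ioo (0 : ℝ) 1) :
    IsMarkovKernel (hG.redistribute σ t) := by
  have := (hσ.probability t ht).1
  refine ⟨fun y => ?_⟩
  rcases lt_or_ge (G y) t with h | h
  · rwa [hG.redistribute_of_lt h]
  · rw [hG.redistribute_of_le h]; infer_instance

theorem isMarkovKernel_darnKernel {t : ℝ} (ht : t ∈ Ioo (0 : ℝ) 1) :
    IsMarkovKernel (hG.darnKernel σ t) := by
  have := hG.isMarkovKernel_redistribute hσ ht
  have := (hG.isRegular_shell (𝒱 := 𝒱) (H := H) (K := K) (W₀ := W₀) ht.2).isMarkovKernel hG.bauer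
  rw [darnKernel]
  infer_instance

/-- `σ_t` is carried by the boundary of the shell `A_t`. -/
theorem ae_frontier_of_coherent {t : ℝ} (ht : t ∈ Ioo (0 : ℝ) 1) :
    ∀ᵐ y ∂(σ t), G y = t ∧ y ∈ frontier (shell 𝒱 H K W₀ t) := by
  refine (hG.ae_level ht (hσ.probability t ht)).and ?_
  -- Being swept from a lower level `r`, the measure `σ t` consists of exit distributions from the
  -- shell.
  obtain ⟨r, hr0, hrt⟩ := exists_between ht.1
  have hreg := hG.isRegular_shell (𝒱 := 𝒱) (H := H) (K := K) (W₀ := W₀) ht.2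
  rw [← hσ.sweep_eq r t hr0 hrt ht.2, sweep]
  refine Measure.ae_smul_measure (ae_restrict_of_ae ?_) _
  rw [ae_iff, show {y | y ∉ frontier (shell 𝒱 H K W₀ t)} = (frontier (shell 𝒱 H K W₀ t))ᶜ from rfl,
    Measure.bind_apply isClosed_frontier.measurableSet.compl (Kernel.aemeasurable _)]
  rw [lintegral_eq_zero_iff
    (Kernel.measurable_coe _ isClosed_frontier.measurableSet.compl)]
  filter_upwards [hG.ae_level ⟨hr0, hrt.trans ht.2⟩ (hσ.probability r ⟨hr0, hrt.trans ht.2⟩)]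
    with x hx
  exact (hreg.isHarmonicKernel hG.bauer).1.1 x ((hG.mem_shell ht.2.le).2 ⟨hx ▸ hr0, hx ▸ hrt⟩)

theorem ae_darnKernel {t : ℝ} (ht : t ∈ Ioo (0 : ℝ) 1) {x : X} (hx : G x < t) :
    ∀ᵐ y ∂(hG.darnKernel σ t x), G y = t ∧ y ∈ frontier (shell 𝒱 H K W₀ t) := by
  have hm : MeasurableSet {y | G y = t ∧ y ∈ frontier (shell 𝒱 H K W₀ t)} :=
    ((isClosed_eq hG.continuous continuous_const).inter isClosed_frontier).measurableSet
  have hσae := hG.ae_frontier_of_coherent hσ ht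
  rcases (hG.nonneg x).eq_or_lt with h | h
  · rwa [hG.darnKernel_of_zero ht h.symm]
  have hxs : x ∈ shell 𝒱 H K W₀ t := (hG.mem_shell ht.2.le).2 ⟨h, hx⟩
  rw [darnKernel, Kernel.comp_apply, ae_iff]
  change (Measure.bind _ _) {y | G y = t ∧ y ∈ frontier (shell 𝒱 H K W₀ t)}ᶜ = 0
  rw [Measure.bind_apply hm.compl (Kernel.aemeasurable _),
    lintegral_eq_zero_iff (Kernel.measurable_coe _ hm.compl)]
  filter_upwards [(hG.isRegular_shell ht.2).ae_frontier hG.bauer hxs] with y hy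
  rcases hG.frontier_shell ht.2.le hy with h | h
  · rw [hG.redistribute_of_lt (h ▸ ht.1)]
    exact hσae
  · rw [hG.redistribute_of_le h.ge, Measure.dirac_apply' _ hm.compl]
    exact indicator_of_notMem (not_not_intro ⟨h, hy⟩) _

theorem ae_le_darnKernel {t : ℝ} (ht : t ∈ Ioo (0 : ℝ) 1) (x : X) :
    ∀ᵐ y ∂(hG.darnKernel σ t x), t ≤ G y := by
  rcases lt_or_ge (G x) t with h | h
  · exact (hG.ae_darnKernel hσ ht h).mono fun y hy => hy.1.ge
  · rw [hG.darnKernel_of_le ht.2 h, ae_dirac_iff (hG.measurableSet_le t)]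
    exact h

theorem integrable_darnKernel {t : ℝ} (ht : t ∈ Ioo (0 : ℝ) 1) {f : X → ℝ}
    (hf : Continuous f) (x : X) : Integrable f (hG.darnKernel σ t x) := by
  have := hG.isMarkovKernel_darnKernel hσ ht
  rcases lt_or_ge (G x) t with h | h
  · refine integrable_of_continuousOn_compact (hG.isCompact_le t ht.2) ?_ hf.continuousOn
    have := (hG.ae_darnKernel hσ ht h).mono fun y hy => hy.1.le
    rw [ae_iff] at this
    exact this
  · rw [hG.darnKernel_of_le ht.2 h]
    exact integrable_dirac (by simp [enorm_lt_top])

theorem integral_redistribute {t : ℝ} {f F : X → ℝ}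
    (h0 : ∀ y, G y = 0 → F y = ∫ z, f z ∂(σ t)) (h1 : ∀ y, t ≤ G y → F y = f y) {y : X}
    (ht : t ∈ Ioo (0 : ℝ) 1)
    (hy : G y = 0 ∨ t ≤ G y) : ∫ z, f z ∂(hG.redistribute σ t y) = F y := by
  rcases hy with h | h
  · rw [hG.redistribute_of_lt (h ▸ ht.1), h0 y h]
  · rw [hG.redistribute_of_le h, integral_dirac, h1 y h]

/-- The darned kernel acts as `H_{A_t}` on the data `F` that equal `f` on `{t ≤ G}` and the constant
`∫ f dσ_t` on `K`. The values of `F` on `{0 < G < t}` are irrelevant and can be chosen to suit: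
continuous for continuity and harmonicity, Borel for the strong Feller property. -/
theorem integral_darnKernel {t : ℝ} (ht : t ∈ Ioo (0 : ℝ) 1) {f F : X → ℝ} {x : X}
    (hf : Integrable f (hG.darnKernel σ t x))
    (h0 : ∀ y, G y = 0 → F y = ∫ z, f z ∂(σ t)) (h1 : ∀ y, t ≤ G y → F y = f y) :
    ∫ y, f y ∂(hG.darnKernel σ t x) = ∫ y, F y ∂(harmonicKernel 𝒱 H (shell 𝒱 H K W₀ t) x) := by
  have := hG.isMarkovKernel_redistribute hσ ht
  have := (hG.isRegular_shell (𝒱 := 𝒱) (H := H) (K := K) (W₀ := W₀) ht.2).isMarkovKernel hG.bauer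
  rw [darnKernel] at hf ⊢
  rw [Kernel.integral_comp hf]
  exact integral_congr_ae ((hG.ae_shell ht x).mono fun y hy =>
    hG.integral_redistribute hσ h0 h1 ht hy)

/-- A continuous function which equals `f` on `{t ≤ G}` and `∫ f dσ_t` on `K`. -/
theorem exists_interpolation {t : ℝ} (ht : t ∈ Ioo (0 : ℝ) 1) {f : X → ℝ} (hf : Continuous f) :
    ∃ F : X → ℝ, Continuous F ∧ (∀ y, G y = 0 → F y = ∫ z, f z ∂(σ t)) ∧
      ∀ y, t ≤ G y → F y = f y := by
  refine ⟨fun y => min 1 (G y / t) * (f y - ∫ z, f z ∂(σ t)) + ∫ z, f z ∂(σ t), ?_,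
    fun y hy => by simp [hy], fun y hy => ?_⟩
  · have := hG.continuous
    fun_prop
  · simp only [min_eq_left ((one_le_div ht.1).2 hy)]
    ring

theorem continuous_darnKernel {t : ℝ} (ht : t ∈ Ioo (0 : ℝ) 1) {f : X → ℝ} (hf : Continuous f) :
    Continuous fun x => ∫ y, f y ∂(hG.darnKernel σ t x) := by
  obtain ⟨F, hF, h0, h1⟩ := hG.exists_interpolation hσ ht hf
  rw [funext fun x => hG.integral_darnKernel hσ ht (hG.integrable_darnKernel hσ ht hf x) h0 h1]
  exact (hG.isRegular_shell ht.2).continuous_integral hG.bauer hF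

theorem harmonic_darnKernel {t : ℝ} (ht : t ∈ Ioo (0 : ℝ) 1) {f : X → ℝ} (hf : Continuous f) :
    IsHarmonicOn 𝒱 H (shell 𝒱 H K W₀ t) fun x => ∫ y, f y ∂(hG.darnKernel σ t x) := by
  obtain ⟨F, hF, h0, h1⟩ := hG.exists_interpolation hσ ht hf
  rw [funext fun x => hG.integral_darnKernel hσ ht (hG.integrable_darnKernel hσ ht hf x) h0 h1]
  exact (hG.isRegular_shell ht.2).isHarmonicOn_integral hG.bauer hF.continuousOn

theorem integral_darnKernel_of_le {t : ℝ} (ht : t < 1) (f : X → ℝ) {x : X} (hx : t ≤ G x) :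
    ∫ y, f y ∂(hG.darnKernel σ t x) = f x := by
  rw [hG.darnKernel_of_le ht hx, integral_dirac]

/-- The deviation from the value on `K` is controlled by `G`. -/
theorem abs_integral_darnKernel_sub_le {t : ℝ} (ht : t ∈ Ioo (0 : ℝ) 1) {f : X → ℝ}
    (hf : Measurable f) {C : ℝ} (hC : ∀ x, |f x| ≤ C) {x : X} (hx : G x ≤ t) :
    |∫ y, f y ∂(hG.darnKernel σ t x) - ∫ y, f y ∂(σ t)| ≤ 2 * C * (G x / t) := by
  classical
  have := hG.isMarkovKernel_darnKernel hσ ht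
  have := (hG.isRegular_shell (𝒱 := 𝒱) (H := H) (K := K) (W₀ := W₀) ht.2).isMarkovKernel hG.bauer
  have := (hσ.probability t ht).1
  set c := ∫ y, f y ∂(σ t) with hc
  have hcC : |c| ≤ C := abs_integral_le_of_bounded hC
  have hC0 : 0 ≤ C := (abs_nonneg _).trans hcC
  have hmeas : Measurable ({y | t ≤ G y}.indicator fun y => f y - c) :=
    (hf.sub_const c).indicator (hG.measurableSet_le t)
  have hbd : ∀ y, |{y | t ≤ G y}.indicator (fun y => f y - c) y| ≤
      {y | t ≤ G y}.indicator (fun _ => 2 * C) y := fun y => by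
    by_cases hy : y ∈ {y | t ≤ G y}
    · rw [indicator_of_mem hy, indicator_of_mem hy]
      exact (abs_sub _ _).trans (by linarith [hC y])
    · rw [indicator_of_notMem hy, indicator_of_notMem hy, abs_zero]
  rw [hG.integral_darnKernel hσ ht (integrable_of_bounded hf hC)
    (F := fun y => {y | t ≤ G y}.indicator (fun y => f y - c) y + c)
    (fun y hy => by
      rw [indicator_of_notMem (fun h => by
        have : t ≤ G y := h
        linarith [ht.1]), zero_add])
    (fun y hy => by rw [indicator_of_mem (show y ∈ {y | t ≤ G y} from hy), sub_add_cancel]),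
    integral_add (integrable_of_bounded hmeas (C := 2 * C) fun y => (hbd y).trans
      (indicator_le_self' (fun _ _ => by positivity) y)) (integrable_const c)]
  simp only [integral_const, probReal_univ, one_smul, add_sub_cancel_right]
  -- After subtracting the constant, the data are supported on `{t ≤ G}` and bounded by `2 * C`,
  -- while that set has harmonic measure `G x / t`.
  refine (abs_integral_le_integral_abs).trans ((integral_mono_of_nonneg (.of_forall fun y =>
    abs_nonneg _) ((integrable_const (2 * C)).indicator (hG.measurableSet_le t))
    (.of_forall hbd)).trans (le_of_eq ?_))
  rw [← hG.sweepFun_one ht hx, sweepFun, integral_indicator (hG.measurableSet_le t),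
    ← integral_const_mul, mul_one]

/-- Off `K` this is the strong Feller property of the regular shell. Points of `K` lie outside the
shell, and continuity there comes from the bound by `2 * C * (G / t)`, which tends to zero. -/
theorem strongFeller_darnKernel {t : ℝ} (ht : t ∈ Ioo (0 : ℝ) 1) {f : X → ℝ}
    (hf : Measurable f) {C : ℝ} (hC : ∀ x, |f x| ≤ C) :
    ContinuousOn (fun x => ∫ y, f y ∂(hG.darnKernel σ t x)) {x | G x < t} := by
  classical
  have := hG.isMarkovKernel_darnKernel hσ ht
  have := (hσ.probability t ht).1
  have hcC : |∫ y, f y ∂(σ t)| ≤ C := abs_integral_le_of_bounded hC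
  intro x hx
  refine ContinuousAt.continuousWithinAt ?_
  rcases (hG.nonneg x).eq_or_lt with h | h
  · have hlim : Tendsto (fun y => 2 * C * (G y / t)) (𝓝 x) (𝓝 0) := by
      have := ((hG.continuous.div_const t).const_mul (2 * C)).tendsto x
      simpa [← h] using this
    rw [ContinuousAt, hG.darnKernel_of_zero ht h.symm, tendsto_iff_dist_tendsto_zero]
    refine squeeze_zero' (.of_forall fun _ => dist_nonneg) ?_ hlim
    filter_upwards [(isOpen_lt hG.continuous continuous_const).mem_nhds hx] with y hy
    exact hG.abs_integral_darnKernel_sub_le hσ ht hf hC (le_of_lt hy)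
  · have hxs : x ∈ shell 𝒱 H K W₀ t := (hG.mem_shell ht.2.le).2 ⟨h, hx⟩
    have hF : Measurable fun y => if G y < t then ∫ z, f z ∂(σ t) else f y :=
      Measurable.ite (hG.measurableSet_lt t) measurable_const hf
    have h2 := (hG.isRegular_shell ht.2).strongFeller hG.bauer hF (C := C) fun y => by
      split_ifs
      exacts [hcC, hC y]
    have h3 : (fun x => ∫ y, f y ∂(hG.darnKernel σ t x)) = fun x =>
        ∫ y, (if G y < t then ∫ z, f z ∂(σ t) else f y)
          ∂(harmonicKernel 𝒱 H (shell 𝒱 H K W₀ t) x) := funext fun x =>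
      hG.integral_darnKernel hσ ht (integrable_of_bounded hf hC)
        (fun y hy => if_pos (hy ▸ ht.1)) (fun y hy => if_neg (not_lt.2 hy))
    rw [h3]
    exact h2.continuousAt ((hG.isOpen_shell ht.2.le).mem_nhds hxs)

/-- Compatibility, in terms of the kernels. -/
theorem integral_integral_darnKernel {s t : ℝ} (hs : 0 < s) (hst : s < t) (ht : t < 1)
    {f : X → ℝ} (hf : Continuous f) {C : ℝ} (hC : ∀ x, |f x| ≤ C) :
    ∫ x, ∫ y, f y ∂(hG.darnKernel σ t x) ∂(σ s) = ∫ y, f y ∂(σ t) := by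
  have ht' : t ∈ Ioo (0 : ℝ) 1 := ⟨hs.trans hst, ht⟩
  have hs' : s ∈ Ioo (0 : ℝ) 1 := ⟨hs, hst.trans ht⟩
  have hps := hσ.probability s hs'
  have := hps.1
  have := (hG.isRegular_shell (𝒱 := 𝒱) (H := H) (K := K) (W₀ := W₀) ht).isMarkovKernel hG.bauer
  have hpt := (hσ.probability t ht').1
  set c := ∫ y, f y ∂(σ t) with hc
  have hcC : |c| ≤ C := abs_integral_le_of_bounded hC
  have hsw : ∫ x, sweepFun 𝒱 H K W₀ G t f x ∂(σ s) = s / t * c := by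
    have := hG.integral_sweep hs hst ht hps hf.measurable hC
    rw [hσ.sweep_eq s t hs hst ht, ← hc] at this
    rw [this, ← mul_assoc, div_mul_div_cancel₀ ht'.1.ne', div_self hs.ne', one_mul]
  -- On `S_s` the shell is left through `K` with probability `1 - s / t`, and that part contributes
  -- `c`. Compatibility gives the swept part the mean `(s / t) * c`, so the total is `c`.
  have hq : ∀ x, G x = s → ∫ y, f y ∂(hG.darnKernel σ t x) =
      sweepFun 𝒱 H K W₀ G t f x + c * (1 - s / t) := by
    intro x hx
    have hxt : G x ≤ t := hx ▸ hst.le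
    have hif : Integrable ({y | t ≤ G y}.indicator f)
        (harmonicKernel 𝒱 H (shell 𝒱 H K W₀ t) x) :=
      (integrable_of_bounded hf.measurable hC).indicator (hG.measurableSet_le t)
    have hi1 : Integrable ({y | t ≤ G y}.indicator fun _ => (1 : ℝ))
        (harmonicKernel 𝒱 H (shell 𝒱 H K W₀ t) x) :=
      (integrable_const 1).indicator (hG.measurableSet_le t)
    have hi2 : Integrable (fun y => c * (1 - {y | t ≤ G y}.indicator (fun _ => (1 : ℝ)) y))
        (harmonicKernel 𝒱 H (shell 𝒱 H K W₀ t) x) := ((integrable_const 1).sub hi1).const_mul c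
    rw [hG.integral_darnKernel hσ ht' (hG.integrable_darnKernel hσ ht' hf x)
      (F := fun y => {y | t ≤ G y}.indicator f y +
        c * (1 - {y | t ≤ G y}.indicator (fun _ => (1 : ℝ)) y))
      (fun y hy => by
        have : y ∉ {y | t ≤ G y} := fun h => by
          have : t ≤ G y := h
          linarith
        rw [indicator_of_notMem this, indicator_of_notMem this]
        ring)
      (fun y hy => by
        have : y ∈ {y | t ≤ G y} := hy
        rw [indicator_of_mem this, indicator_of_mem this]
        ring),
      integral_add hif hi2, integral_const_mul,
      integral_sub (integrable_const 1) hi1, integral_indicator (hG.measurableSet_le t),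
      integral_indicator (hG.measurableSet_le t), ← hx, ← hG.sweepFun_one ht' hxt]
    simp [sweepFun]
  rw [integral_congr_ae ((hG.ae_level hs' hps).mono hq),
    integral_add (integrable_of_bounded (hG.continuous_sweepFun ht' hf).measurable
      (hG.abs_sweepFun_le ht hC)) (integrable_const _), hsw, integral_const, probReal_univ,
    one_smul]
  ring

/-- The function `y ↦ ∫ f` against `darnKernel σ t y` is harmonic on `A_s`, and by compatibility its
value on `K` is its own `σ s`-mean. So it serves as its own boundary data for the smaller kernel and
is reproduced. -/
theorem integral_darnKernel_darnKernel {s t : ℝ} (hs : 0 < s) (hst : s ≤ t) (ht : t < 1)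
    {f : X → ℝ} (hf : Continuous f) {C : ℝ} (hC : ∀ x, |f x| ≤ C) (x : X) :
    ∫ y, ∫ z, f z ∂(hG.darnKernel σ t y) ∂(hG.darnKernel σ s x) =
      ∫ z, f z ∂(hG.darnKernel σ t x) := by
  have ht' : t ∈ Ioo (0 : ℝ) 1 := ⟨hs.trans_le hst, ht⟩
  rcases hst.eq_or_lt with rfl | hst
  · exact integral_congr_ae ((hG.ae_le_darnKernel hσ ht' x).mono fun y hy =>
      hG.integral_darnKernel_of_le hσ ht f hy)
  have hs' : s ∈ Ioo (0 : ℝ) 1 := ⟨hs, hst.trans ht⟩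
  have hq := hG.continuous_darnKernel hσ ht' hf
  rw [hG.integral_darnKernel hσ hs' (hG.integrable_darnKernel hσ hs' hq x)
    (F := fun y => ∫ z, f z ∂(hG.darnKernel σ t y))
    (fun y hy => by
      rw [hG.integral_integral_darnKernel hσ hs hst ht hf hC, hG.darnKernel_of_zero ht' hy])
    (fun y _ => rfl)]
  exact (hG.isRegular_shell hs'.2).integral_eq hG.bauer hq.continuousOn
    ((hG.harmonic_darnKernel hσ ht' hf).mono (hG.shell_mono hst.le)) x

/-- Harmonicity on the shell does not apply to `V` directly, since the closure of `V` may leave the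
shell; the local criterion for continuous functions covers this case. -/
theorem integral_kernel_darnKernel {t : ℝ} (ht : t ∈ Ioo (0 : ℝ) 1) {V : Set X} (hV : V ∈ 𝒱)
    (hVt : V ⊆ shell 𝒱 H K W₀ t) {f : X → ℝ} (hf : Continuous f) {C : ℝ} (hC : ∀ x, |f x| ≤ C)
    (x : X) : ∫ y, ∫ z, f z ∂(hG.darnKernel σ t y) ∂(H V x) = ∫ z, f z ∂(hG.darnKernel σ t x) := by
  have := hG.isMarkovKernel_darnKernel hσ ht
  refine hG.bauer.integral_eq_of_locally hV (hG.continuous_darnKernel hσ ht hf)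
    (fun y => abs_integral_le_of_bounded hC) (fun y hy => ?_) x
  obtain ⟨N, hN, hNc, hNs⟩ := exists_mem_nhds_isClosed_subset
    ((hG.isOpen_shell (𝒱 := 𝒱) (H := H) (K := K) (W₀ := W₀) ht.2.le).mem_nhds (hVt hy))
  exact ⟨N, hN, fun W hW hyW hWN => (hG.harmonic_darnKernel hσ ht hf).2 W
    ⟨hW, (hNc.closure_subset_iff.2 hWN).trans hNs⟩ y hyW⟩

theorem darnKernel_comp_darnKernel {s t : ℝ} (hs : 0 < s) (hst : s ≤ t) (ht : t < 1) :
    hG.darnKernel σ t ∘ₖ hG.darnKernel σ s = hG.darnKernel σ t := by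
  have := hG.isMarkovKernel_darnKernel hσ ⟨hs.trans_le hst, ht⟩
  have := hG.isMarkovKernel_darnKernel hσ ⟨hs, hst.trans_lt ht⟩
  ext1 x
  refine ext_of_forall_integral_eq_of_IsFiniteMeasure fun f => ?_
  rw [Kernel.integral_comp (f.integrable _)]
  exact hG.integral_darnKernel_darnKernel hσ hs hst ht f.continuous f.norm_coe_le_norm x

theorem darnKernel_comp_kernel {t : ℝ} (ht : t ∈ Ioo (0 : ℝ) 1) {V : Set X} (hV : V ∈ 𝒱)
    (hVt : V ⊆ shell 𝒱 H K W₀ t) : hG.darnKernel σ t ∘ₖ H V = hG.darnKernel σ t := by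
  have := hG.isMarkovKernel_darnKernel hσ ht
  have := hG.bauer.markov V hV
  ext1 x
  refine ext_of_forall_integral_eq_of_IsFiniteMeasure fun f => ?_
  rw [Kernel.integral_comp (f.integrable _)]
  exact hG.integral_kernel_darnKernel hσ ht hV hVt f.continuous f.norm_coe_le_norm x

end IsGauge

end Kernels
end Darning

namespace Darning

/-! ### Neighborhoods of the collapsed point, lifting, and separation of points. -/

section Existence

variable {X : Type*} [TopologicalSpace X] [T2Space X] [LocallyCompactSpace X]
    [SecondCountableTopology X] [MeasurableSpace X] [BorelSpace X]
    {𝒱 : Set (Set X)} {H : Set X → Kernel X X} {K W₀ : Set X} {G : X → ℝ} {σ : ℝ → Measure X}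
    {H₀ : Set (DarnedSpace K) → Kernel (DarnedSpace K) (DarnedSpace K)}

theorem IsNormalBauerFamily.frontier_image_collapse (hH : IsNormalBauerFamily 𝒱 H) {V : Set X}
    (hV : V ∈ 𝒱) (hVK : Disjoint (closure V) K) {y : X} (hy : y ∈ frontier V) :
    collapse K y ∈ frontier (collapse K '' V) := by
  have hVK' : Disjoint V K := hVK.mono_left subset_closure
  have hVo := hH.base.isOpen hV
  rw [hVo.frontier_eq] at hy
  rw [(isOpen_image_collapse hVo hVK').frontier_eq, Set.mem_sdiff, collapse_mem_image hVK']
  exact ⟨image_closure_subset_closure_image (continuous_collapse K) (mem_image_of_mem _ hy.1), hy.2⟩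

/-- Separation of points is inherited by sets away from `K`. -/
theorem IsNormalBauerFamily.separates_image_collapse (hH : IsNormalBauerFamily 𝒱 H)
    (hK : K.Nonempty)
    (hV₀ : ∀ V ∈ 𝒱, Disjoint (closure V) K → IsLift (H V) (H₀ (collapse K '' V)))
    {V : Set X} (hV : V ∈ 𝒱) (hVK : Disjoint (closure V) K) :
    ∃ 𝒲 : DarnedSpace K → Set (Set (DarnedSpace K)),
      IsLocalChoice (darnedBase 𝒱 H K W₀) (collapse K '' V) 𝒲 ∧
        HyperharmonicSeparates H₀ 𝒲 (collapse K '' V) := by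
  classical
  have hVK' : Disjoint V K := hVK.mono_left subset_closure
  have hVo := hH.base.isOpen hV
  obtain ⟨𝒲, hc, hs⟩ := hH.separates V hV
  have hin : ∀ x ∈ V, ∀ y, collapse K y = collapse K x → y = x := fun x hx y h =>
    (collapse_eq_iff.1 h).resolve_right fun h => disjoint_left.1 hVK' hx h.2
  have hWK : ∀ x ∈ V, ∀ W ∈ 𝒲 x, Disjoint (closure W) K := fun x hx W hW =>
    hVK'.mono_left (hc.exists_mem_inside hx hW).2.1
  refine ⟨fun p => {U | ∃ x ∈ V, p = collapse K x ∧ ∃ W ∈ 𝒲 x, U = collapse K '' W}, ?_, ?_⟩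
  · rintro p ⟨x, hx, rfl⟩
    refine ⟨?_, fun N hN => ?_⟩
    · rintro U ⟨y, hy, hxy, W, hW, rfl⟩
      obtain ⟨hWV, hWcl, hyW⟩ := hc.exists_mem_inside hy hW
      refine ⟨⟨Or.inr ⟨W, hWV, hWK y hy W hW, rfl⟩, ?_⟩, hxy ▸ mem_image_of_mem _ hyW⟩
      exact (closure_image_collapse_subset (hWK y hy W hW)).trans (image_mono hWcl)
    · obtain ⟨W, hW, hWN⟩ := (hc x hx).2 _ ((continuous_collapse K).continuousAt hN)
      exact ⟨_, ⟨x, hx, rfl, W, hW, rfl⟩, image_subset_iff.2 hWN⟩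
  · rintro p ⟨x, hx, rfl⟩ q ⟨y, hy, rfl⟩ hne
    obtain ⟨u, ⟨hu1, hu2⟩, huxy⟩ := hs x hx y hy fun h => hne (h ▸ rfl)
    -- The transported function is correct off `K`, which suffices because all sets in play have
    -- closure inside `V`.
    have huc : ∀ z ∉ K, u (uncollapse hK (collapse K z)) = u z := fun z hz => by
      rw [(collapse_eq_iff.1 (collapse_uncollapse hK (collapse K z))).resolve_right fun h => hz h.2]
    have hVn : ∀ z ∈ V, z ∉ K := fun z hz => disjoint_left.1 hVK' hz
    refine ⟨fun p => u (uncollapse hK p), ⟨?_, ?_⟩, ?_⟩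
    · refine lowerSemicontinuousOn_of_comp_collapse (isOpen_image_collapse hVo hVK') ?_
      rw [preimage_image_collapse hVK']
      intro z hz a ha
      have ha' : a < u z := by simpa only [gt_iff_lt, huc z (hVn z hz)] using ha
      filter_upwards [hu1 z hz a ha', self_mem_nhdsWithin] with z' hz' hz'V
      show a < u (uncollapse hK (collapse K z'))
      rwa [huc z' (hVn z' hz'V)]
    · rintro p ⟨z, hz, rfl⟩ U ⟨z', hz', hzz, W, hW, rfl⟩
      obtain rfl := hin z' hz' z hzz
      obtain ⟨hWV, hWcl, hyW⟩ := hc.exists_mem_inside hz' hW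
      refine ((hV₀ W hWV (hWK z hz' W hW)).lintegral_le _ z).trans ?_
      change _ ≤ u (uncollapse hK (collapse K z))
      rw [huc z (hVn z hz')]
      refine (lintegral_congr_ae ?_).trans_le (hu2 z hz' W hW)
      filter_upwards [hH.ae_mem hWV hyW hWcl] with w hw using huc w (hVn w hw)
    · simp only [huc x (hVn x hx), huc y (hVn y hy)]
      exact huxy

namespace IsGauge

variable (hG : IsGauge 𝒱 H K W₀ G)
include hG

theorem collapse_mem_darnedNhd {r : ℝ} (hr : r ∈ Ioc (0 : ℝ) 1) {x : X} :
    collapse K x ∈ darnedNhd 𝒱 H K W₀ r ↔ G x < r := by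
  by_cases hx : x ∈ K
  · rw [(hG.eq_zero_iff x).2 hx, collapse_of_mem hx]
    exact ⟨fun _ => hr.1, fun _ => mem_insert _ _⟩
  · rw [darnedNhd, mem_insert_iff, collapse_eq_center, collapse_mem_image
      (disjoint_sdiff_left.mono_left (hG.shell_subset r)), hG.mem_shell hr.2]
    have := (hG.pos_iff x).2 hx
    tauto

theorem preimage_darnedNhd {r : ℝ} (hr : r ∈ Ioc (0 : ℝ) 1) :
    collapse K ⁻¹' darnedNhd 𝒱 H K W₀ r = {x | G x < r} :=
  ext fun _ => hG.collapse_mem_darnedNhd hr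

theorem isOpen_darnedNhd {r : ℝ} (hr : r ∈ Ioc (0 : ℝ) 1) : IsOpen (darnedNhd 𝒱 H K W₀ r) := by
  refine isOpen_coinduced.2 ?_
  rw [hG.preimage_darnedNhd hr]
  exact isOpen_lt hG.continuous continuous_const

theorem closure_darnedNhd_subset (hK : K.Nonempty) {r : ℝ} (hr : r ∈ Ioc (0 : ℝ) 1) :
    closure (darnedNhd 𝒱 H K W₀ r) ⊆ collapse K '' {x | G x ≤ r} := by
  refine closure_minimal (fun p hp => ?_) (isClosed_of_preimage_collapse ?_)
  · obtain ⟨x, rfl⟩ := surjective_collapse hK p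
    exact mem_image_of_mem _ ((hG.collapse_mem_darnedNhd hr).1 hp).le
  · rw [preimage_image_collapse_of_subset]
    · exact isClosed_le hG.continuous continuous_const
    · intro x hx
      rw [mem_ofPred_eq, (hG.eq_zero_iff x).2 hx]
      exact hr.1.le

/-- By compactness `G` has a positive minimum on `{G ≤ 1 / 2} \ N`, unless that set is empty. So the
sets `{G < t}` form a neighborhood base of `K`, and the `U_t` one of `x₀`. -/
theorem exists_lt_subset {N : Set X} (hN : IsOpen N) (hKN : K ⊆ N) :
    ∃ t ∈ Ioo (0 : ℝ) 1, {x | G x < t} ⊆ N := by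
  have hc : IsCompact ({x | G x ≤ 1 / 2} \ N) := (hG.isCompact_le _ (by norm_num)).diff hN
  rcases ({x | G x ≤ 1 / 2} \ N).eq_empty_or_nonempty with he | hne
  · exact ⟨1 / 2, by norm_num, fun x hx => by_contra fun h =>
      (he ▸ notMem_empty x : x ∉ {x | G x ≤ 1 / 2} \ N) ⟨(show G x < 1 / 2 from hx).le, h⟩⟩
  · obtain ⟨z, hz, hmin⟩ := hc.exists_isMinOn hne hG.continuous.continuousOn
    have hz0 : 0 < G z := (hG.pos_iff z).2 fun h => hz.2 (hKN h)
    have hz1 : G z ≤ 1 / 2 := hz.1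
    refine ⟨G z, ⟨hz0, by linarith⟩, fun x hx => by_contra fun h => ?_⟩
    have hx' : G x < G z := hx
    exact absurd (isMinOn_iff.1 hmin x ⟨hx'.le.trans hz1, h⟩) (not_le.2 hx')

variable (hσ : IsCoherent 𝒱 H K W₀ σ)
include hσ

theorem exists_eq_of_coherent {t : ℝ} (ht : t ∈ Ioo (0 : ℝ) 1) : ∃ x, G x = t := by
  have := (hσ.probability t ht).1
  exact (hG.ae_level ht (hσ.probability t ht)).exists

/-- Every level carries a probability measure and so is nonempty; hence the sets `U_t` grow strictly
and determine `t`. -/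
theorem le_of_darnedNhd_subset {s t : ℝ} (hs : s ∈ Ioo (0 : ℝ) 1) (ht : t ∈ Ioo (0 : ℝ) 1)
    (h : darnedNhd 𝒱 H K W₀ s ⊆ darnedNhd 𝒱 H K W₀ t) : s ≤ t := by
  by_contra! hts
  obtain ⟨r, htr, hrs⟩ := exists_between hts
  obtain ⟨x, hx⟩ := hG.exists_eq_of_coherent hσ ⟨ht.1.trans htr, hrs.trans hs.2⟩
  have := (hG.collapse_mem_darnedNhd ⟨ht.1, ht.2.le⟩).1
    (h ((hG.collapse_mem_darnedNhd ⟨hs.1, hs.2.le⟩).2 (hx ▸ hrs)))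
  linarith

/-- Kernels are indexed by sets, so the parameter must be recoverable from the set. Membership of
`x₀` tells the two kinds apart, `t` is determined by `U_t`, and `V` is the preimage of its image.
Other sets get the zero kernel. -/
theorem exists_lifts (hK : K.Nonempty) :
    ∃ H₀ : Set (DarnedSpace K) → Kernel (DarnedSpace K) (DarnedSpace K),
      (∀ t ∈ Ioo (0 : ℝ) 1, IsLift (hG.darnKernel σ t) (H₀ (darnedNhd 𝒱 H K W₀ t))) ∧
      ∀ V ∈ 𝒱, Disjoint (closure V) K → IsLift (H V) (H₀ (collapse K '' V)) := by
  have hKc := hG.isCompact.isClosed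
  have h : ∀ U : Set (DarnedSpace K), ∃ Q₀ : Kernel (DarnedSpace K) (DarnedSpace K),
      (∀ t ∈ Ioo (0 : ℝ) 1, U = darnedNhd 𝒱 H K W₀ t → IsLift (hG.darnKernel σ t) Q₀) ∧
      ∀ V ∈ 𝒱, Disjoint (closure V) K → U = collapse K '' V → IsLift (H V) Q₀ := by
    intro U
    by_cases hc : center K ∈ U
    · have h2 : ∀ V ∈ 𝒱, Disjoint (closure V) K → U ≠ collapse K '' V := by
        rintro V - hVK rfl
        obtain ⟨x, hx, hxc⟩ := hc
        exact disjoint_left.1 hVK (subset_closure hx) (collapse_eq_center.1 hxc)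
      by_cases hU : ∃ t ∈ Ioo (0 : ℝ) 1, U = darnedNhd 𝒱 H K W₀ t
      · obtain ⟨t, ht, rfl⟩ := hU
        obtain ⟨Q₀, hQ₀⟩ := exists_isLift (Q := hG.darnKernel σ t) hK hKc fun x hx y hy => by
          rw [hG.darnKernel_of_zero ht ((hG.eq_zero_iff x).2 hx),
            hG.darnKernel_of_zero ht ((hG.eq_zero_iff y).2 hy)]
        refine ⟨Q₀, fun s hs hst => ?_, fun V hV hVK h => absurd h (h2 V hV hVK)⟩
        obtain rfl : s = t := le_antisymm (hG.le_of_darnedNhd_subset hσ hs ht hst.ge)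
          (hG.le_of_darnedNhd_subset hσ ht hs hst.le)
        exact hQ₀
      · exact ⟨0, fun t ht h => absurd ⟨t, ht, h⟩ hU, fun V hV hVK h => absurd h (h2 V hV hVK)⟩
    · have h1 : ∀ t ∈ Ioo (0 : ℝ) 1, U ≠ darnedNhd 𝒱 H K W₀ t := by
        rintro t - rfl
        exact hc (mem_insert _ _)
      by_cases hU : ∃ V ∈ 𝒱, Disjoint (closure V) K ∧ U = collapse K '' V
      · obtain ⟨V, hV, hVK, rfl⟩ := hU
        have hVK' : Disjoint V K := hVK.mono_left subset_closure
        obtain ⟨Q₀, hQ₀⟩ := exists_isLift (Q := H V) hK hKc fun x hx y hy => by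
          rw [(hG.bauer.boundary V hV).2 x fun h => disjoint_left.1 hVK' h hx,
            (hG.bauer.boundary V hV).2 y fun h => disjoint_left.1 hVK' h hy,
            Measure.map_dirac' (measurable_collapse K), Measure.map_dirac' (measurable_collapse K),
            collapse_of_mem hx, collapse_of_mem hy]
        refine ⟨Q₀, fun t ht h => absurd h (h1 t ht), fun V' hV' hVK'' h => ?_⟩
        obtain rfl : V' = V := by
          rw [← preimage_image_collapse hVK', h,
            preimage_image_collapse (hVK''.mono_left subset_closure)]
        exact hQ₀
      · exact ⟨0, fun t ht h => absurd h (h1 t ht), fun V hV hVK h => absurd ⟨V, hV, hVK, h⟩ hU⟩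
  choose H₀ h1 h2 using h
  exact ⟨H₀, fun t ht => h1 _ t ht rfl, fun V hV hVK => h2 _ V hV hVK rfl⟩

omit hσ in
theorem isTopologicalBasis_darnedBase (hK : K.Nonempty) :
    TopologicalSpace.IsTopologicalBasis (darnedBase 𝒱 H K W₀) := by
  refine TopologicalSpace.isTopologicalBasis_of_isOpen_of_nhds ?_ fun p O hp hO => ?_
  · rintro U (⟨t, ht, rfl⟩ | ⟨V, hV, hVK, rfl⟩)
    · exact hG.isOpen_darnedNhd ⟨ht.1, ht.2.le⟩
    · exact isOpen_image_collapse (hG.bauer.base.isOpen hV) (hVK.mono_left subset_closure)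
  · obtain ⟨x, rfl⟩ := surjective_collapse hK p
    have hO' : IsOpen (collapse K ⁻¹' O) := hO.preimage (continuous_collapse K)
    by_cases hx : x ∈ K
    · obtain ⟨t, ht, htO⟩ := hG.exists_lt_subset hO' fun y hy =>
        (show collapse K y ∈ O by rwa [collapse_of_mem hy, ← collapse_of_mem hx])
      refine ⟨_, Or.inl ⟨t, ht, rfl⟩, collapse_of_mem hx ▸ mem_insert _ _, fun q hq => ?_⟩
      obtain ⟨y, rfl⟩ := surjective_collapse hK q
      exact htO ((hG.collapse_mem_darnedNhd ⟨ht.1, ht.2.le⟩).1 hq)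
    · obtain ⟨V, hV, hxV, hVO⟩ := hG.bauer.exists_mem_subset
        ((hO'.sdiff hG.isCompact.isClosed).mem_nhds ⟨hp, hx⟩)
      exact ⟨_, Or.inr ⟨V, hV, disjoint_left.2 fun y hy => (hVO hy).2, rfl⟩,
        mem_image_of_mem _ hxV, image_subset_iff.2 fun y hy => (hVO (subset_closure hy)).1⟩

omit hσ in
/-- Positive hyperharmonic functions on `W₀` are modified near `K`. -/
theorem exists_separating {t : ℝ} (ht : t ∈ Ioo (0 : ℝ) 1) {x y : X} (hxt : G x < t)
    (hyt : G y < t) (hxy : collapse K x ≠ collapse K y) :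
    ∃ (w : X → ℝ≥0∞) (a : ℝ), (∀ z, G z = 0 → w z = ENNReal.ofReal a) ∧
      LowerSemicontinuousOn w {z | G z < t} ∧ w x ≠ w y ∧
      (∀ s ∈ Ioo (0 : ℝ) t, ∀ z, G z = s → w z ≤ ENNReal.ofReal a) ∧
      ∀ z, ∀ W ∈ 𝒱, z ∈ W → closure W ⊆ shell 𝒱 H K W₀ t → ∫⁻ p, w p ∂(H W z) ≤ w z := by
  have hcont : ∀ C : ℝ, Continuous fun z => ENNReal.ofReal (C * (t - G z)) := fun C =>
    ENNReal.continuous_ofReal.comp (continuous_const.mul (continuous_const.sub hG.continuous))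
  have hlin : ∀ a b : ℝ, ∀ z, ∀ W ∈ 𝒱, z ∈ W → closure W ⊆ shell 𝒱 H K W₀ t →
      (∀ p ∈ shell 𝒱 H K W₀ t, 0 ≤ a + b * G p) →
      ∫⁻ p, ENNReal.ofReal (a + b * G p) ∂(H W z) = ENNReal.ofReal (a + b * G z) := by
    intro a b z W hW hz hWt h0
    have hh := (IsHarmonicOn.const hG.bauer a).add hG.bauer
      ((hG.harmonic_shell (𝒱 := 𝒱) (H := H) (K := K) (W₀ := W₀) t).const_mul b)
    have he : ∫ p, (a + b * G p) ∂(H W z) = a + b * G z := hh.2 W ⟨hW, hWt⟩ z hz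
    rw [← he, ofReal_integral_eq_lintegral_ofReal
      (hG.bauer.integrable_of_continuousOn ⟨hW, hWt⟩ hh.1 hz)]
    exact (hG.bauer.ae_mem hW hz hWt).mono h0
  have hlin' : ∀ C : ℝ, 0 ≤ C → ∀ z, ∀ W ∈ 𝒱, z ∈ W → closure W ⊆ shell 𝒱 H K W₀ t →
      ∫⁻ p, ENNReal.ofReal (C * (t - G p)) ∂(H W z) = ENNReal.ofReal (C * (t - G z)) := by
    intro C hC z W hW hz hWt
    have h := hlin (C * t) (-C) z W hW hz hWt fun p hp => by
      have := ((hG.mem_shell ht.2.le).1 hp).2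
      nlinarith
    have e : ∀ p, C * (t - G p) = C * t + -C * G p := fun p => by ring
    simpa only [e] using h
  -- Points on different levels are separated by `t - G`. On a common level, a hyperharmonic `v` on
  -- `W₀` is truncated by `C * G`, so that it vanishes on `K`, and `C * (t - G)` is added; then `w ≤
  -- C * t` with equality on `K`, which gives hyperharmonicity at `x₀`.
  by_cases hne : G x = G y
  · have hxy' : x ≠ y := fun h => hxy (h ▸ rfl)
    have hx0 : 0 < G x := by
      refine (hG.pos_iff x).2 fun hxK => hxy ?_
      have hyK : y ∈ K := (hG.eq_zero_iff y).1 (hne ▸ (hG.eq_zero_iff x).2 hxK)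
      rw [collapse_of_mem hxK, collapse_of_mem hyK]
    obtain ⟨v, ⟨hv1, hv2⟩, hvxy⟩ := hG.isPSet.2 x (hG.mem_of_lt x (hxt.trans ht.2)) y
      (hG.mem_of_lt y (hyt.trans ht.2)) hxy'
    have hmin : min (v x) (v y) ≠ ∞ := fun h => by
      rw [min_eq_top] at h
      exact hvxy (h.1.trans h.2.symm)
    -- Chosen so that `C * G x` exceeds the smaller of the two values of `v`; the truncation then
    -- keeps them distinct.
    set C : ℝ := ((min (v x) (v y)).toReal + 1) / G x with hC
    have hC0 : 0 ≤ C := by positivity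
    have hCx : C * G x = (min (v x) (v y)).toReal + 1 := div_mul_cancel₀ _ hx0.ne'
    have hlt : min (v x) (v y) < ENNReal.ofReal (C * G x) := by
      rw [hCx, ← ENNReal.ofReal_toReal hmin]
      refine (ENNReal.ofReal_lt_ofReal_iff (by positivity)).2 ?_
      rw [ENNReal.toReal_ofReal ENNReal.toReal_nonneg]
      exact lt_add_one _
    have hcontG : Continuous fun z => ENNReal.ofReal (C * G z) :=
      ENNReal.continuous_ofReal.comp (continuous_const.mul hG.continuous)
    refine ⟨fun z => ENNReal.ofReal (C * (t - G z)) + min (v z) (ENNReal.ofReal (C * G z)), C * t,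
      fun z hz => by simp [hz], ?_, ?_, ?_, ?_⟩
    · have hvt : LowerSemicontinuousOn v {z | G z < t} :=
        hv1.mono fun z hz => hG.mem_of_lt z (lt_trans hz ht.2)
      exact (hcont C).lowerSemicontinuous.lowerSemicontinuousOn _ |>.add
        (hvt.inf (hcontG.lowerSemicontinuous.lowerSemicontinuousOn _))
    · simp only [← hne]
      rw [Ne, ENNReal.add_right_inj ENNReal.ofReal_ne_top]
      rcases lt_or_gt_of_ne hvxy with h | h
      · rw [min_eq_left h.le] at hlt
        rw [min_eq_left hlt.le]
        exact (lt_min h hlt).ne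
      · rw [min_eq_right h.le] at hlt
        rw [min_eq_left hlt.le]
        exact (lt_min h hlt).ne'
    · rintro s hs z rfl
      refine (add_le_add_right (min_le_right _ _) _).trans ?_
      rw [← ENNReal.ofReal_add (mul_nonneg hC0 (sub_nonneg.2 hs.2.le))
        (mul_nonneg hC0 hs.1.le)]
      exact ENNReal.ofReal_le_ofReal (by linarith)
    · intro z W hW hz hWt
      rw [lintegral_add_left (hcont C).measurable, hlin' C hC0 z W hW hz hWt]
      refine add_le_add_right (le_min ?_ ?_) _
      · refine (lintegral_mono fun p => min_le_left _ _).trans ?_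
        exact hv2 z (hG.shell_subset t (hWt (subset_closure hz))).1 W
          ⟨⟨hW, hWt.trans ((hG.shell_subset t).trans sdiff_subset)⟩, hz⟩
      · refine (lintegral_mono fun p => min_le_right _ _).trans ?_
        have h := hlin 0 C z W hW hz hWt fun p hp => by
          have := hG.nonneg p
          positivity
        simp only [zero_add] at h
        exact h.le
  · refine ⟨fun z => ENNReal.ofReal (1 * (t - G z)), t, fun z hz => by simp [hz],
      (hcont 1).lowerSemicontinuous.lowerSemicontinuousOn _, fun h => hne ?_, fun s hs z hz =>
      ENNReal.ofReal_le_ofReal (by linarith [hs.1]), fun z W hW hz hWt =>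
      (hlin' 1 zero_le_one z W hW hz hWt).le⟩
    have := (ENNReal.ofReal_eq_ofReal_iff (by linarith) (by linarith)).1 h
    linarith

end IsGauge

end Existence
end Darning

namespace Darning

/-! ### The darned family satisfies the axioms. -/

section DarnedFamily

variable {X : Type*} [TopologicalSpace X] [T2Space X] [LocallyCompactSpace X]
    [SecondCountableTopology X] [MeasurableSpace X] [BorelSpace X]
    {𝒱 : Set (Set X)} {H : Set X → Kernel X X} {K W₀ : Set X} {G : X → ℝ} {σ : ℝ → Measure X}
    {H₀ : Set (DarnedSpace K) → Kernel (DarnedSpace K) (DarnedSpace K)}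

namespace IsGauge

variable (hG : IsGauge 𝒱 H K W₀ G) (hσ : IsCoherent 𝒱 H K W₀ σ) (hK : K.Nonempty)
  (hU₀ : ∀ t ∈ Ioo (0 : ℝ) 1, IsLift (hG.darnKernel σ t) (H₀ (darnedNhd 𝒱 H K W₀ t)))
  (hV₀ : ∀ V ∈ 𝒱, Disjoint (closure V) K → IsLift (H V) (H₀ (collapse K '' V)))
include hG hσ hK hU₀ hV₀

/-- The local choice is made as economical as possible: at `x₀` only the sets `U_s` with `s < t`,
elsewhere only images of sets with closure in `A_t`. Hyperharmonicity then has to be checked against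
the measures `σ s` at `x₀` and against the original kernels elsewhere. -/
theorem separates_darnedNhd {t : ℝ} (ht : t ∈ Ioo (0 : ℝ) 1) :
    ∃ 𝒲 : DarnedSpace K → Set (Set (DarnedSpace K)),
      IsLocalChoice (darnedBase 𝒱 H K W₀) (darnedNhd 𝒱 H K W₀ t) 𝒲 ∧
        HyperharmonicSeparates H₀ 𝒲 (darnedNhd 𝒱 H K W₀ t) := by
  have ht' : t ∈ Ioc (0 : ℝ) 1 := ⟨ht.1, ht.2.le⟩
  have hI : ∀ s ∈ Ioo (0 : ℝ) t, s ∈ Ioo (0 : ℝ) 1 := fun s hs => ⟨hs.1, hs.2.trans ht.2⟩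
  have hI' : ∀ s ∈ Ioo (0 : ℝ) t, s ∈ Ioc (0 : ℝ) 1 := fun s hs => ⟨hs.1, (hI s hs).2.le⟩
  have hdisj : ∀ {A : Set X}, A ⊆ shell 𝒱 H K W₀ t → Disjoint A K := fun hA =>
    disjoint_sdiff_left.mono_left (hA.trans (hG.shell_subset t))
  refine ⟨fun p => {U | (∃ s ∈ Ioo (0 : ℝ) t, p = center K ∧ U = darnedNhd 𝒱 H K W₀ s) ∨
    ∃ W ∈ 𝒱, closure W ⊆ shell 𝒱 H K W₀ t ∧ p ∈ collapse K '' W ∧ U = collapse K '' W}, ?_, ?_⟩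
  · intro p hp
    refine ⟨?_, fun N hN => ?_⟩
    · rintro U (⟨s, hs, rfl, rfl⟩ | ⟨W, hW, hWt, hpW, rfl⟩)
      · refine ⟨⟨Or.inl ⟨s, hI s hs, rfl⟩, ?_⟩, mem_insert _ _⟩
        refine (hG.closure_darnedNhd_subset hK (hI' s hs)).trans ?_
        rintro _ ⟨x, hx, rfl⟩
        exact (hG.collapse_mem_darnedNhd ht').2 (lt_of_le_of_lt hx hs.2)
      · refine ⟨⟨Or.inr ⟨W, hW, hdisj hWt, rfl⟩, ?_⟩, hpW⟩
        exact (closure_image_collapse_subset (hdisj hWt)).trans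
          ((image_mono hWt).trans (subset_insert _ _))
    · obtain ⟨x, rfl⟩ := surjective_collapse hK p
      rw [hG.collapse_mem_darnedNhd ht'] at hp
      obtain ⟨O, hON, hO, hxO⟩ := mem_nhds_iff.1 hN
      have hO' : IsOpen (collapse K ⁻¹' O) := hO.preimage (continuous_collapse K)
      by_cases hx : x ∈ K
      · obtain ⟨s, hs, hsO⟩ := hG.exists_lt_subset hO' fun y hy =>
          (show collapse K y ∈ O by rwa [collapse_of_mem hy, ← collapse_of_mem hx])
        -- The minimum with `t / 2` keeps the parameter strictly below `t`.
        have hst : min s (t / 2) ∈ Ioo (0 : ℝ) t :=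
          ⟨lt_min hs.1 (half_pos ht.1), (min_le_right _ _).trans_lt (half_lt_self ht.1)⟩
        refine ⟨_, Or.inl ⟨_, hst, collapse_of_mem hx, rfl⟩, fun q hq => ?_⟩
        obtain ⟨y, rfl⟩ := surjective_collapse hK q
        exact hON (hsO (((hG.collapse_mem_darnedNhd (hI' _ hst)).1 hq).trans_le (min_le_left _ _)))
      · obtain ⟨W, hW, hxW, hWO⟩ := hG.bauer.exists_mem_subset
          ((hO'.inter (hG.isOpen_shell (𝒱 := 𝒱) (H := H) (K := K) (W₀ := W₀) ht.2.le)).mem_nhds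
            ⟨hxO, (hG.mem_shell ht.2.le).2 ⟨(hG.pos_iff x).2 hx, hp⟩⟩)
        exact ⟨_, Or.inr ⟨W, hW, fun y hy => (hWO hy).2, mem_image_of_mem _ hxW, rfl⟩,
          image_subset_iff.2 fun y hy => hON (hWO (subset_closure hy)).1⟩
  · intro p hp q hq hpq
    obtain ⟨x, rfl⟩ := surjective_collapse hK p
    obtain ⟨y, rfl⟩ := surjective_collapse hK q
    rw [hG.collapse_mem_darnedNhd ht'] at hp hq
    obtain ⟨w, a, hwK, hwl, hwxy, hws, hwW⟩ := hG.exists_separating ht hp hq hpq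
    have hwc : ∀ z, w (uncollapse hK (collapse K z)) = w z :=
      apply_uncollapse_collapse hK fun u hu v hv => by
        rw [hwK u ((hG.eq_zero_iff u).2 hu), hwK v ((hG.eq_zero_iff v).2 hv)]
    refine ⟨fun p => w (uncollapse hK p), ⟨?_, ?_⟩, ?_⟩
    · refine lowerSemicontinuousOn_of_comp_collapse (hG.isOpen_darnedNhd ht') ?_
      rw [hG.preimage_darnedNhd ht']
      simpa only [hwc] using hwl
    · rintro p - U (⟨s, hs, rfl, rfl⟩ | ⟨W, hW, hWt, ⟨z, hz, rfl⟩, rfl⟩)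
      · obtain ⟨k, hk⟩ := hK
        have hk0 := (hG.eq_zero_iff k).2 hk
        have hps := hσ.probability s (hI s hs)
        have := hps.1
        rw [← collapse_of_mem hk]
        refine ((hU₀ s (hI s hs)).lintegral_le _ k).trans ?_
        simp only [hwc, hwK k hk0, hG.darnKernel_of_zero (hI s hs) hk0]
        refine (lintegral_mono_ae ((hG.ae_level (hI s hs) hps).mono fun z hz =>
          hws s hs z hz)).trans ?_
        simp
      · refine ((hV₀ W hW (hdisj hWt)).lintegral_le _ z).trans ?_
        simp only [hwc]
        exact hwW z W hW hz hWt
    · simpa only [hwc] using hwxy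

/-- Each axiom is pulled back along the quotient map and checked on `X` for the darned kernels and
for the given kernels away from `K`. -/
theorem isNormalBauerFamily_darned : IsNormalBauerFamily (darnedBase 𝒱 H K W₀) H₀ where
  base := hG.isTopologicalBasis_darnedBase hK
  relCompact := by
    rintro U (⟨t, ht, rfl⟩ | ⟨V, hV, hVK, rfl⟩)
    · exact ((hG.isCompact_le t ht.2).image (continuous_collapse K)).of_isClosed_subset
        isClosed_closure (hG.closure_darnedNhd_subset hK ⟨ht.1, ht.2.le⟩)
    · exact ((hG.bauer.relCompact V hV).image (continuous_collapse K)).of_isClosed_subset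
        isClosed_closure (closure_image_collapse_subset hVK)
  boundary := by
    rintro U (⟨t, ht, rfl⟩ | ⟨V, hV, hVK, rfl⟩)
    · have ht' : t ∈ Ioc (0 : ℝ) 1 := ⟨ht.1, ht.2.le⟩
      refine (hU₀ t ht).isBoundaryKernel hK (fun x hx => ?_) fun x hx => ?_
      · rw [hG.collapse_mem_darnedNhd ht'] at hx
        filter_upwards [hG.ae_darnKernel hσ ht hx] with y hy
        rw [(hG.isOpen_darnedNhd ht').frontier_eq, Set.mem_sdiff, hG.collapse_mem_darnedNhd ht', hy.1]
        exact ⟨closure_mono (subset_insert _ _) (image_closure_subset_closure_image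
          (continuous_collapse K) (mem_image_of_mem _ (frontier_subset_closure hy.2))),
          lt_irrefl t⟩
      · rw [hG.collapse_mem_darnedNhd ht', not_lt] at hx
        exact hG.darnKernel_of_le ht.2 hx
    · have hVK' : Disjoint V K := hVK.mono_left subset_closure
      refine (hV₀ V hV hVK).isBoundaryKernel hK (fun x hx => ?_) fun x hx => ?_
      · rw [collapse_mem_image hVK'] at hx
        have h := (hG.bauer.boundary V hV).1 x hx
        rw [← mem_ae_iff] at h
        filter_upwards [h] with y hy using hG.bauer.frontier_image_collapse hV hVK hy
      · rw [collapse_mem_image hVK'] at hx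
        exact (hG.bauer.boundary V hV).2 x hx
  comp := by
    rintro U (⟨t, ht, rfl⟩ | ⟨V, hV, hVK, rfl⟩) U' (⟨s, hs, rfl⟩ | ⟨V', hV', hVK', rfl⟩) hUU
    · refine IsLift.unique hK (Q := hG.darnKernel σ t) ?_ (hU₀ t ht)
      rw [← hG.darnKernel_comp_darnKernel hσ hs.1 (hG.le_of_darnedNhd_subset hσ hs ht hUU) ht.2]
      exact (hU₀ t ht).comp (hU₀ s hs)
    · refine IsLift.unique hK (Q := hG.darnKernel σ t) ?_ (hU₀ t ht)
      rw [← hG.darnKernel_comp_kernel hσ ht hV' fun x hx => ?_]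
      · exact (hU₀ t ht).comp (hV₀ V' hV' hVK')
      · exact (hG.mem_shell ht.2.le).2 ⟨(hG.pos_iff x).2 (disjoint_left.1 hVK' (subset_closure hx)),
          (hG.collapse_mem_darnedNhd ⟨ht.1, ht.2.le⟩).1 (hUU (mem_image_of_mem _ hx))⟩
    · obtain ⟨x, hx, hxc⟩ := hUU (mem_insert _ _)
      exact absurd (collapse_eq_center.1 hxc) (disjoint_left.1 hVK (subset_closure hx))
    · refine IsLift.unique hK (Q := H V) ?_ (hV₀ V hV hVK)
      rw [← hG.bauer.comp V hV V' hV' fun x hx =>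
        (collapse_mem_image (hVK.mono_left subset_closure)).1 (hUU (mem_image_of_mem _ hx))]
      exact (hV₀ V hV hVK).comp (hV₀ V' hV' hVK')
  continuous := by
    rintro U (⟨t, ht, rfl⟩ | ⟨V, hV, hVK, rfl⟩) f hf
    · rw [(isQuotientMap_collapse hK).continuous_iff]
      simpa only [Function.comp_def, (hU₀ t ht).integral hf.measurable] using
        hG.continuous_darnKernel hσ ht (hf.comp (continuous_collapse K))
    · rw [(isQuotientMap_collapse hK).continuous_iff]
      simpa only [Function.comp_def, (hV₀ V hV hVK).integral hf.measurable] using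
        hG.bauer.continuous V hV _ (hf.comp (continuous_collapse K))
  markov := by
    rintro U (⟨t, ht, rfl⟩ | ⟨V, hV, hVK, rfl⟩)
    · have := hG.isMarkovKernel_darnKernel hσ ht
      exact (hU₀ t ht).isMarkovKernel hK
    · have := hG.bauer.markov V hV
      exact (hV₀ V hV hVK).isMarkovKernel hK
  separates := by
    rintro U (⟨t, ht, rfl⟩ | ⟨V, hV, hVK, rfl⟩)
    · exact hG.separates_darnedNhd hσ hK hU₀ hV₀ ht
    · exact hG.bauer.separates_image_collapse hK hV₀ hV hVK
  strongFeller := by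
    rintro U (⟨t, ht, rfl⟩ | ⟨V, hV, hVK, rfl⟩) f hf ⟨C, hC⟩
    · have ht' : t ∈ Ioc (0 : ℝ) 1 := ⟨ht.1, ht.2.le⟩
      rw [(isQuotientMap_collapse hK).continuousOn_isOpen_iff (hG.isOpen_darnedNhd ht'),
        hG.preimage_darnedNhd ht']
      simpa only [Function.comp_def, (hU₀ t ht).integral hf] using
        hG.strongFeller_darnKernel hσ ht (hf.comp (measurable_collapse K)) fun x => hC (collapse K x)
    · have hVK' : Disjoint V K := hVK.mono_left subset_closure
      rw [(isQuotientMap_collapse hK).continuousOn_isOpen_iff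
        (isOpen_image_collapse (hG.bauer.base.isOpen hV) hVK'), preimage_image_collapse hVK']
      simpa only [Function.comp_def, (hV₀ V hV hVK).integral hf] using
        hG.bauer.strongFeller V hV _ (hf.comp (measurable_collapse K))
          ⟨C, fun x => hC (collapse K x)⟩

omit hU₀ hV₀ in
theorem exists_isDarning : ∃ H₀, IsDarning 𝒱 H K W₀ σ H₀ := by
  obtain ⟨H₀, hU₀, hV₀⟩ := hG.exists_lifts hσ hK
  refine ⟨H₀, hG.isNormalBauerFamily_darned hσ hK hU₀ hV₀, hV₀, fun t ht => ?_⟩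
  obtain ⟨k, hk⟩ := hK
  rw [← collapse_of_mem hk, hU₀ t ht k, hG.darnKernel_of_zero ht ((hG.eq_zero_iff k).2 hk)]

end IsGauge

end DarnedFamily

/-! ### Ellipticity of darnings. -/

section Elliptic

variable {X : Type*} [TopologicalSpace X] [T2Space X] [LocallyCompactSpace X]
    [SecondCountableTopology X] [MeasurableSpace X] [BorelSpace X]
    {𝒱 : Set (Set X)} {H : Set X → Kernel X X} {K W₀ : Set X} {G : X → ℝ} {σ : ℝ → Measure X}
    {H₀ : Set (DarnedSpace K) → Kernel (DarnedSpace K) (DarnedSpace K)}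
    {U : Set (DarnedSpace K)} {h : DarnedSpace K → ℝ}

/-- Integrals of functions which are continuous on an open set carrying the measure. -/
theorem integral_map_collapse {μ : Measure X} (hU : IsOpen U) (hh : ContinuousOn h U)
    (hμ : ∀ᵐ x ∂μ, collapse K x ∈ U) :
    ∫ p, h p ∂(μ.map (collapse K)) = ∫ x, h (collapse K x) ∂μ := by
  refine integral_map (measurable_collapse K).aemeasurable ?_
  have hae : ∀ᵐ p ∂(μ.map (collapse K)), p ∈ U :=
    (ae_map_iff (measurable_collapse K).aemeasurable hU.measurableSet).2 hμ
  rw [← Measure.restrict_eq_self_of_ae_mem hae]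
  exact hh.aestronglyMeasurable hU.measurableSet

/-- Functions which are harmonic on the darned space are harmonic off `K`. -/
theorem IsDarning.isHarmonicOn_comp (hH : IsNormalBauerFamily 𝒱 H)
    (hD : IsDarning 𝒱 H K W₀ σ H₀) (hU : IsOpen U)
    (hh : IsHarmonicOn (darnedBase 𝒱 H K W₀) H₀ U h) :
    IsHarmonicOn 𝒱 H (collapse K ⁻¹' U \ K) fun x => h (collapse K x) := by
  refine ⟨hh.1.comp (continuous_collapse K).continuousOn fun x hx => hx.1, fun V hV x hx => ?_⟩
  have hVK : Disjoint (closure V) K := disjoint_left.2 fun y hy => (hV.2 hy).2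
  have hae : ∀ᵐ y ∂(H V x), collapse K y ∈ U := (hH.ae_mem hV.1 hx hV.2).mono fun y hy => hy.1
  have h1 := hh.2 (collapse K '' V) ⟨Or.inr ⟨V, hV.1, hVK, rfl⟩,
    (closure_image_collapse_subset hVK).trans (image_subset_iff.2 fun y hy => (hV.2 hy).1)⟩
    _ (mem_image_of_mem _ hx)
  rwa [hD.away V hV.1 hVK x, integral_map_collapse hU hh.1 hae] at h1

namespace IsGauge

variable {η : ℕ → ℝ} (hG : IsGauge 𝒱 H K W₀ G)
include hG

/-- Zeros of positive harmonic functions are interior points of the zero set: points off `K`. -/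
theorem eventually_eq_zero_collapse (hell : IsElliptic 𝒱 H) (hD : IsDarning 𝒱 H K W₀ σ H₀)
    (hU : IsOpen U) (hh : IsHarmonicOn (darnedBase 𝒱 H K W₀) H₀ U h) (h0 : ∀ p ∈ U, 0 ≤ h p)
    {x : X} (hx : x ∉ K) (hxU : collapse K x ∈ U) (hhx : h (collapse K x) = 0) :
    ∀ᶠ p in 𝓝 (collapse K x), h p = 0 := by
  have := hG.bauer.locallyConnectedSpace
  have hDo : IsOpen (collapse K ⁻¹' U \ K) :=
    (hU.preimage (continuous_collapse K)).sdiff hG.isCompact.isClosed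
  have hxD : x ∈ collapse K ⁻¹' U \ K := ⟨hxU, hx⟩
  have hCD := connectedComponentIn_subset (collapse K ⁻¹' U \ K) x
  have hCo : IsOpen (connectedComponentIn (collapse K ⁻¹' U \ K) x) := hDo.connectedComponentIn
  have hxC := mem_connectedComponentIn hxD
  -- Ellipticity on `X` applies on the component of `x`, which is open by local connectedness and
  -- contains the zero `x`.
  have hz : ∀ y ∈ connectedComponentIn (collapse K ⁻¹' U \ K) x, h (collapse K y) = 0 :=
    (hell _ hCo (isConnected_connectedComponentIn_iff.2 hxD) _
      ((hD.isHarmonicOn_comp hG.bauer hU hh).mono hCD) fun y hy => h0 _ (hCD hy).1).resolve_right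
      fun hpos => (hpos x hxC).ne' hhx
  filter_upwards [(isOpen_image_collapse hCo (disjoint_sdiff_left.mono_left hCD)).mem_nhds
    (mem_image_of_mem _ hxC)]
  rintro _ ⟨y, hy, rfl⟩
  exact hz y hy

/-- Zeros of positive harmonic functions are interior points of the zero set: the point `x₀`. -/
theorem eventually_eq_zero_center (hK : K.Nonempty) (hη0 : η 0 = 1) (hη : StrictAnti η)
    (hηlim : Tendsto η atTop (𝓝 0))
    (hσ : ∀ t ∈ Ioo (0 : ℝ) 1, IsProbabilityOn (level 𝒱 H K W₀ t) (σ t))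
    (hpos : ∀ n, ∀ V ∈ compAt 𝒱 H K W₀ η n, ∀ r, 0 < r → r < η n → σ r V ≠ 0)
    (hell : IsElliptic 𝒱 H) (hD : IsDarning 𝒱 H K W₀ σ H₀)
    (hU : IsOpen U) (hh : IsHarmonicOn (darnedBase 𝒱 H K W₀) H₀ U h) (h0 : ∀ p ∈ U, 0 ≤ h p)
    (hxU : center K ∈ U) (hhx : h (center K) = 0) : ∀ᶠ p in 𝓝 (center K), h p = 0 := by
  have := hG.bauer.locallyConnectedSpace
  have hUo : IsOpen (collapse K ⁻¹' U) := hU.preimage (continuous_collapse K)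
  obtain ⟨s, hs, hsU⟩ := hG.exists_lt_subset hUo fun y hy =>
    (show collapse K y ∈ U by rwa [collapse_of_mem hy])
  obtain ⟨n, hn⟩ := (((tendsto_add_atTop_iff_nat 1).2 hηlim).eventually (gt_mem_nhds hs.1)).exists
  have hηI := mem_Ioo_of_strictAnti hη0 hη hηlim (Nat.succ_pos n)
  obtain ⟨t, ht0, htη⟩ := exists_between hηI.1
  have ht : t ∈ Ioo (0 : ℝ) 1 := ⟨ht0, htη.trans hηI.2⟩
  have htU : {x | G x ≤ t} ⊆ collapse K ⁻¹' U := fun x hx =>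
    hsU (lt_of_le_of_lt hx (htη.trans hn))
  have hps := hσ t ht
  have := hps.1
  have hae : ∀ᵐ y ∂(σ t), y ∈ {x | G x ≤ t} := (hG.ae_level ht hps).mono fun y hy => hy.le
  -- The mean value property at `x₀`: the `σ t`-mean of `h ≥ 0` is `h x₀ = 0`, so `h` vanishes
  -- almost everywhere for `σ t`.
  have hint := hh.2 (darnedNhd 𝒱 H K W₀ t) ⟨Or.inl ⟨t, ht, rfl⟩,
    (hG.closure_darnedNhd_subset hK ⟨ht.1, ht.2.le⟩).trans (image_subset_iff.2 htU)⟩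
    _ (mem_insert _ _)
  have hcomp : ContinuousOn (fun x => h (collapse K x)) (collapse K ⁻¹' U) :=
    hh.1.comp (continuous_collapse K).continuousOn fun x hx => hx
  rw [hD.atCenter t ht, integral_map_collapse hU hh.1 (hae.mono htU), hhx,
    integral_eq_zero_iff_of_nonneg_ae (hae.mono fun y hy => h0 _ (htU hy))
      (integrable_of_continuousOn_compact (hG.isCompact_le t ht.2) (by rwa [← mem_ae_iff])
        (hcomp.mono htU))] at hint
  have hsub : shell 𝒱 H K W₀ (η (n + 1)) ⊆ collapse K ⁻¹' U \ K := fun x hx =>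
    ⟨hsU (((hG.mem_shell hηI.2.le).1 hx).2.trans hn), hx.1.2⟩
  have hzero : ∀ x ∈ shell 𝒱 H K W₀ (η (n + 1)), h (collapse K x) = 0 := by
    intro x hx
    have hV : connectedComponentIn (shell 𝒱 H K W₀ (η (n + 1))) x ∈
        components (shell 𝒱 H K W₀ (η (n + 1))) := ⟨x, hx, rfl⟩
    have hVs := (subset_of_mem_components hV).trans hsub
    refine (hell _ (isOpen_of_mem_components (hG.isOpen_shell hηI.2.le) hV)
      (isConnected_of_mem_components hV) _ ((hD.isHarmonicOn_comp hG.bauer hU hh).mono hVs)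
      fun y hy => h0 _ (hVs hy).1).resolve_right (fun hp => ?_) x (mem_connectedComponentIn hx)
    -- If `h` were strictly positive on the component, that component would be `σ t`-null, contrary
    -- to its positive mass.
    refine hpos (n + 1) _ hV t ht0 htη (measure_mono_null (fun y hy => ?_) (ae_iff.1 hint))
    exact (hp y hy).ne'
  filter_upwards [(hG.isOpen_darnedNhd ⟨hηI.1, hηI.2.le⟩).mem_nhds
    (mem_insert _ _ : center K ∈ darnedNhd 𝒱 H K W₀ (η (n + 1)))]
  rintro _ (rfl | ⟨x, hx, rfl⟩)
  exacts [hhx, hzero x hx]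

/-- The zero set of a nonnegative harmonic function is open by the two local statements and
relatively closed by continuity, so connectedness decides. Of the darned kernels, only those away
from `K` and the values at `x₀` enter, which any darning prescribes. -/
theorem isElliptic_darned (hK : K.Nonempty) (hη0 : η 0 = 1) (hη : StrictAnti η)
    (hηlim : Tendsto η atTop (𝓝 0))
    (hσ : ∀ t ∈ Ioo (0 : ℝ) 1, IsProbabilityOn (level 𝒱 H K W₀ t) (σ t))
    (hpos : ∀ n, ∀ V ∈ compAt 𝒱 H K W₀ η n, ∀ r, 0 < r → r < η n → σ r V ≠ 0)
    (hell : IsElliptic 𝒱 H) (hD : IsDarning 𝒱 H K W₀ σ H₀) :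
    IsElliptic (darnedBase 𝒱 H K W₀) H₀ := by
  intro U hU hUc h hh h0
  have hloc : ∀ p ∈ U, h p = 0 → ∀ᶠ q in 𝓝 p, h q = 0 := by
    intro p hp hhp
    obtain ⟨x, rfl⟩ := surjective_collapse hK p
    by_cases hx : x ∈ K
    · rw [collapse_of_mem hx] at hp hhp ⊢
      exact hG.eventually_eq_zero_center hK hη0 hη hηlim hσ hpos hell hD hU hh h0 hp hhp
    · exact hG.eventually_eq_zero_collapse hell hD hU hh h0 hx hp hhp
  by_contra! hcon
  obtain ⟨⟨q, hq, hhq⟩, p, hp, hhp⟩ := hcon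
  have hZ : IsOpen {p | p ∈ U ∧ h p = 0} := isOpen_iff_mem_nhds.2 fun p hp => by
    filter_upwards [hU.mem_nhds hp.1, hloc p hp.1 hp.2] with q h1 h2 using ⟨h1, h2⟩
  have hN : IsOpen (U ∩ h ⁻¹' {0}ᶜ) := hh.1.isOpen_inter_preimage hU isOpen_compl_singleton
  obtain ⟨r, -, hr1, hr2⟩ := hUc.isPreconnected _ _ hZ hN
    (fun r hr => (em (h r = 0)).imp (fun h => ⟨hr, h⟩) fun h => ⟨hr, h⟩)
    ⟨p, hp, hp, le_antisymm hhp (h0 p hp)⟩ ⟨q, hq, hq, hhq⟩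
  exact hr2.2 hr1.2

end IsGauge

end Elliptic
end Darning

/-! ### The main theorem. -/

theorem theorem2p6 {X : Type*} [TopologicalSpace X] [T2Space X] [LocallyCompactSpace X]
    [SecondCountableTopology X] [MeasurableSpace X] [BorelSpace X]
    -- a normal Bauer family of harmonic boundary kernels
    (𝒱 : Set (Set X)) (H : Set X → Kernel X X) (hH : Darning.IsNormalBauerFamily 𝒱 H)
    -- a strongly stable compact set, and the neighborhood `W₀` with `g > 0` on `W₀ \ K`
    (K : Set X) (hK : Darning.IsStronglyStable 𝒱 H K)
    (W₀ : Set X) (hKW : K ⊆ W₀) (hWP : Darning.IsPSet 𝒱 H W₀) (hWreg : Darning.IsRegular 𝒱 H W₀)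
    (hWKreg : Darning.IsRegular 𝒱 H (W₀ \ K))
    (hg : ∀ x ∈ W₀ \ K, 0 < Darning.gauge 𝒱 H K W₀ x)
    -- the sequence `η`, with `η 0 = 1`
    (η : ℕ → ℝ) (hη0 : η 0 = 1) (hη : StrictAnti η) (hηlim : Tendsto η atTop (𝓝 0))
    -- the weights
    (α : Set X → ℝ)
    (hα : ∀ n, ∀ V ∈ Darning.compAt 𝒱 H K W₀ η n, α V ∈ Icc (0 : ℝ) 1)
    (hα0 : HasSum (fun V : {V : Set X // V ∈ Darning.compAt 𝒱 H K W₀ η 0} => α V) 1)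
    (hαsucc : ∀ n, ∀ V ∈ Darning.compAt 𝒱 H K W₀ η n,
      HasSum (fun V' : {V' : Set X // V' ∈ Darning.compAt 𝒱 H K W₀ η (n + 1) ∧ V' ⊆ V} => α V')
        (α V))
    -- the measures `ν n`, `n ≥ 1`
    (ν : ℕ → Measure X)
    (hν : ∀ n, 1 ≤ n → Darning.IsProbabilityOn (Darning.level 𝒱 H K W₀ (η n)) (ν n))
    (hνα : ∀ n, ∀ V ∈ Darning.compAt 𝒱 H K W₀ η n,
      ν (n + 1) (V ∩ Darning.level 𝒱 H K W₀ (η (n + 1))) = ENNReal.ofReal (α V)) :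
    (∀ r ∈ Ioo (0 : ℝ) 1, Darning.IsRegular 𝒱 H (Darning.shell 𝒱 H K W₀ r)) ∧
    (∃ (φ : ℕ → ℕ) (σ : ℝ → Measure X), Darning.IsLimitFamily 𝒱 H K W₀ η ν φ σ) ∧
    ∀ (φ : ℕ → ℕ) (σ : ℝ → Measure X), Darning.IsLimitFamily 𝒱 H K W₀ η ν φ σ →
      Darning.IsCompatible 𝒱 H K W₀ σ ∧
      (∀ n, ∀ V ∈ Darning.compAt 𝒱 H K W₀ η n, ∀ r, 0 < r → r < η n →
        σ r V = ENNReal.ofReal (α V)) ∧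
      (∃ H₀, Darning.IsDarning 𝒱 H K W₀ σ H₀) ∧
      (Darning.IsElliptic 𝒱 H →
        (∀ n, ∀ V ∈ Darning.compAt 𝒱 H K W₀ η n, 0 < α V) →
        ∀ H₀, Darning.IsDarning 𝒱 H K W₀ σ H₀ →
          Darning.IsElliptic (Darning.darnedBase 𝒱 H K W₀) H₀) := by
  obtain ⟨G, hG⟩ := Darning.exists_isGauge hH hK.1 hKW hWP hWreg.2.1 hWKreg hg
  refine ⟨fun r hr => hG.isRegular_shell hr.2, hG.exists_isLimitFamily hη0 hη hηlim hν,
    fun φ σ hσ => ?_⟩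
  have hσV : ∀ n, ∀ V ∈ Darning.compAt 𝒱 H K W₀ η n, ∀ r, 0 < r → r < η n →
      σ r V = ENNReal.ofReal (α V) := fun n V hV r hr hrn =>
    hG.limit_apply hη0 hη hηlim hα hαsucc hν hνα hσ hV hr hrn
  refine ⟨hG.isCompatible hη0 hη hηlim hν hσ, hσV,
    hG.exists_isDarning ⟨hσ.probability, fun r t hr hrt ht =>
      hG.sweep_limit hη0 hη hηlim hν hσ hr hrt ht⟩ hK.2.1,
    fun hell hα0 H₀ hD => hG.isElliptic_darned hK.2.1 hη0 hη hηlim hσ.probability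
      (fun n V hV r hr hrn => ?_) hell hD⟩
  rw [hσV n V hV r hr hrn]
  exact (ENNReal.ofReal_pos.2 (hα0 n V hV)).ne'
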